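/- For a partition $\lambda$, let its rank be the largest part minus the number of parts; the empty partition of $0$ has rank $0$. Let $p(n)$ be the number of partitions of $n$ and $N(a,M;n)$ the number of partitions of $n$ with rank congruent to $a$ modulo $M$. For complex $q$ with $0<|q|<1$ put $$D(a,M)=\sum_{n\ge 0}\Big(N(a,M;n)-\frac{p(n)}{M}\Big)q^n,\qquad R(a,b,M,c,m)=\sum_{n\ge 0}\big(N(a,M;mn+c)-N(b,M;mn+c)\big)q^n,$$ $$(x;q)_n=\prod_{i=0}^{n-1}(1-q^ix),\quad (x;q)_\infty=\prod_{i\ge 0}(1-q^ix),\quad j(x;q)=(x;q)_\infty(q/x;q)_\infty(q;q)_\infty,$$ $$J_{a,m}=j(q^a;q^m),\quad J_m=J_{m,3m},\quad g(x,q)=x^{-1}\Big(-1+\sum_{n\ge 0}\frac{q^{n^2}}{(x;q)_{n+1}(q/x;q)_n}\Big).$$ Then for every complex $q$ with $0<|q|<1$ the series $D(a,5)$ and $R(a,b,5,c,5)$ (for integers $a,b$ and $c\ge 0$) converge absolutely, and $$D(0,5)=-2q^5g(q^5,q^{25})+\frac45\frac{J_5J_{25}^3}{J_{5,25}^3}+\frac45\,q\,\frac{J_{25}^2}{J_{5,25}}-\frac25\,q^2\frac{J_{25}^2}{J_{10,25}}+\frac25\,q^3\frac{J_5J_{25}^3}{J_{10,25}^3},$$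 $$D(1,5)=D(4,5)=q^5g(q^5,q^{25})-q^8g(q^{10},q^{25})-\frac15\frac{J_5J_{25}^3}{J_{5,25}^3}-\frac15\,q\,\frac{J_{25}^2}{J_{5,25}}+\frac35\,q^2\frac{J_{25}^2}{J_{10,25}}-\frac35\,q^3\frac{J_5J_{25}^3}{J_{10,25}^3},$$ $$D(2,5)=D(3,5)=q^8g(q^{10},q^{25})-\frac15\frac{J_5J_{25}^3}{J_{5,25}^3}-\frac15\,q\,\frac{J_{25}^2}{J_{5,25}}-\frac25\,q^2\frac{J_{25}^2}{J_{10,25}}+\frac25\,q^3\frac{J_5J_{25}^3}{J_{10,25}^3}.$$ Moreover, the following modulus-$5$ rank-difference identities of Atkin and Swinnerton-Dyer hold for all such $q$: $$R(1,2,5,0,5)=q\,g(q,q^5),\qquad R(0,2,5,0,5)+2R(1,2,5,0,5)=\frac{J_1J_5^3}{J_{1,5}^3},\qquad R(0,2,5,1,5)=\frac{J_5^2}{J_{1,5}},$$ $$R(1,2,5,2,5)=\frac{J_5^2}{J_{2,5}},\qquad R(0,2,5,3,5)=-q\,g(q^2,q^5),\qquad R(0,1,5,3,5)+R(0,2,5,3,5)=\frac{J_1J_5^3}{J_{2,5}^3};$$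 and Dyson's conjectures for modulus $5$ hold: for every integer $n\ge 0$, $$N(1,5;5n+1)=N(2,5;5n+1),\quad N(0,5;5n+2)=N(2,5;5n+2),\quad N(0,5;5n+4)=N(1,5;5n+4)=N(2,5;5n+4).$$ -/

import Mathlib

namespace DysonRank

/-- Dyson's rank of a partition: largest part minus number of parts.
The empty partition has rank `0`. -/
def rank {n : ℕ} (P : Nat.Partition n) : ℤ :=
  (P.parts.sup : ℤ) - (Multiset.card P.parts : ℤ)

/-- `p(n)`, the number of partitions of `n`. -/
def numPartitions (n : ℕ) : ℕ := Fintype.card (Nat.Partition n)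

/-- `N(a, M; n)`, the number of partitions of `n` with rank congruent to `a` modulo `M`. -/
def rankCount (a : ℤ) (M n : ℕ) : ℕ :=
  (Finset.univ.filter (fun P : Nat.Partition n => rank P ≡ a [ZMOD (M : ℤ)])).card

/-- The `n`-th term of the series `D(a, M, q)`. -/
noncomputable def deviationTerm (a : ℤ) (M : ℕ) (q : ℂ) (n : ℕ) : ℂ :=
  ((rankCount a M n : ℂ) - (numPartitions n : ℂ) / (M : ℂ)) * q ^ n

/-- `D(a, M, q) = ∑_{n ≥ 0} (N(a, M; n) - p(n) / M) q ^ n`. -/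
noncomputable def deviation (a : ℤ) (M : ℕ) (q : ℂ) : ℂ :=
  ∑' n : ℕ, deviationTerm a M q n

/-- The `n`-th term of the series `R(a, b, M, c, m)` in the variable `q`. -/
noncomputable def rankDiffTerm (a b : ℤ) (M c m : ℕ) (q : ℂ) (n : ℕ) : ℂ :=
  ((rankCount a M (m * n + c) : ℂ) - (rankCount b M (m * n + c) : ℂ)) * q ^ n

/-- `R(a, b, M, c, m) = ∑_{n ≥ 0} (N(a, M; m n + c) - N(b, M; m n + c)) q ^ n`. -/
noncomputable def rankDiff (a b : ℤ) (M c m : ℕ) (q : ℂ) : ℂ :=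
  ∑' n : ℕ, rankDiffTerm a b M c m q n

/-- `(x; q)_n = ∏_{0 ≤ i < n} (1 - q ^ i x)`. -/
noncomputable def qPoch (x q : ℂ) (n : ℕ) : ℂ :=
  ∏ i ∈ Finset.range n, (1 - q ^ i * x)

/-- `(x; q)_∞ = ∏_{i ≥ 0} (1 - q ^ i x)`; the product converges for `‖q‖ < 1`. -/
noncomputable def qPochInf (x q : ℂ) : ℂ :=
  ∏' i : ℕ, (1 - q ^ i * x)

/-- The theta function `j(x; q) = (x; q)_∞ (q / x; q)_∞ (q; q)_∞`. -/
noncomputable def jTheta (x q : ℂ) : ℂ :=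
  qPochInf x q * qPochInf (q / x) q * qPochInf q q

/-- `J_{a,m} = j(q ^ a; q ^ m)`. -/
noncomputable def J₂ (a : ℤ) (m : ℕ) (q : ℂ) : ℂ := jTheta (q ^ a) (q ^ m)

/-- `J_m = J_{m,3m}`. -/
noncomputable def J₁ (m : ℕ) (q : ℂ) : ℂ := J₂ (m : ℤ) (3 * m) q

/-- The universal mock theta function
`g(x, q) = x⁻¹ (-1 + ∑_{n ≥ 0} q ^ (n ^ 2) / ((x; q)_{n+1} (q / x; q)_n))`. -/
noncomputable def gMock (x q : ℂ) : ℂ :=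
  x⁻¹ * (-1 + ∑' n : ℕ, q ^ (n ^ 2) / (qPoch x q (n + 1) * qPoch (q / x) q n))

end DysonRank

namespace DysonRank

open Filter Topology Finset

/-! Write `lam x y q` for the Lambert series with summands (-1)^k q^(3k(k-1)/2) y^k / (1 - x q^k),
and `lamFive w y q` for its analogue with denominators 1 - w q^(5k). At a pole the convention 0⁻¹ =
0 drops the singular summand.

Sorting partitions by largest part and applying Fine's transformation gives the rank generating
function ∑ z^rank q^n in Eulerian form. Partial fractions and Cauchy's Durfee rectangle identity
turn it into (1 - z) lam z q² / (q;q)_∞ (`tsum_eulerian_eq_lam`, `tsum_rankMonomial`). The same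
computation shows that the mock theta function is itself such a series: g(x, q) = lam x q³ / (q;q)_∞
(`gMock_eq_lam`).

At a fifth root of unity z ≠ 1, expanding 1/(1 - z q^k) over 1 - q^(5k) and reflecting k ↦ -k leaves
only the two series `lamFive 1 (q^6) q` and `lamFive 1 (q^3) q` (`lam_root_of_unity`). Orthogonality
of characters then writes every D(a, 5) as a combination of 1 and these two, divided by (q;q)_∞.

To evaluate the two series, split the summation index modulo 5. This gives five series `lam` in base
q^25: one central term and two symmetric pairs. The addition formula `lam_add_lam`, which is the
partial fraction expansion of 1/(j(x/Z) j(x) j(xZ)), reduces each pair to a multiple of the central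
term plus a theta quotient. The total coefficient of the central term is a monomial times (q;q)_∞ /
(q^25;q^25)_∞ by `qPochInf_dissection`, so that dividing by (q;q)_∞ leaves exactly a g. One pair
contains a pole; there the limiting form `lam_one_add_lam` produces logarithmic derivatives of theta
functions. They are evaluated by the differentiated Weierstrass relation `ell_relation`.

For the rank differences, the formulas for D(a, 5) - D(b, 5) are sums of q^c times functions of q^5.
Evaluating at all five fifth roots of a given number and inverting a Vandermonde matrix compares
them class by class. Dyson's conjectures are the classes with nothing in them, read off by
uniqueness of power series coefficients. -/

/-! ### Convergence and bounds for q-Pochhammer symbols -/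

@[simp] lemma qPoch_zero (x q : ℂ) : qPoch x q 0 = 1 := by simp [qPoch]

lemma qPoch_succ (x q : ℂ) (n : ℕ) : qPoch x q (n + 1) = qPoch x q n * (1 - q ^ n * x) := by
  simp [qPoch, prod_range_succ]

lemma qPoch_succ' (x q : ℂ) (n : ℕ) : qPoch x q (n + 1) = (1 - x) * qPoch (q * x) q n := by
  simp only [qPoch, prod_range_succ', pow_zero, one_mul, mul_comm _ (1 - x)]
  congr 1
  exact prod_congr rfl fun i _ => by ring

lemma qPoch_ne_zero {x q : ℂ} (h : ∀ i : ℕ, 1 - q ^ i * x ≠ 0) (n : ℕ) : qPoch x q n ≠ 0 :=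
  prod_ne_zero_iff.2 fun i _ => h i

lemma summable_norm_pow_mul {q : ℂ} (hq : ‖q‖ < 1) (x : ℂ) : Summable fun i : ℕ => ‖q ^ i * x‖ := by
  simp_rw [norm_mul, norm_pow]
  exact (summable_geometric_of_lt_one (norm_nonneg _) hq).mul_right _

lemma multipliable_qPoch {q : ℂ} (hq : ‖q‖ < 1) (x : ℂ) :
    Multipliable fun i : ℕ => 1 - q ^ i * x := by
  have := multipliable_one_add_of_summable (f := fun i : ℕ => -(q ^ i * x))
    (by simpa using summable_norm_pow_mul hq x)
  simpa [sub_eq_add_neg] using this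

lemma tendsto_qPoch {q : ℂ} (hq : ‖q‖ < 1) (x : ℂ) :
    Tendsto (qPoch x q) atTop (𝓝 (qPochInf x q)) :=
  (multipliable_qPoch hq x).hasProd.tendsto_prod_nat

lemma qPochInf_eq {q : ℂ} (hq : ‖q‖ < 1) (x : ℂ) :
    qPochInf x q = (1 - x) * qPochInf (q * x) q := by
  refine tendsto_nhds_unique ((tendsto_add_atTop_iff_nat 1).2 (tendsto_qPoch hq x)) ?_
  simp_rw [qPoch_succ']
  exact (tendsto_qPoch hq _).const_mul _

lemma qPochInf_ne_zero {x q : ℂ} (hq : ‖q‖ < 1) (h : ∀ i : ℕ, 1 - q ^ i * x ≠ 0) :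
    qPochInf x q ≠ 0 := by
  have := tprod_one_add_ne_zero_of_summable (f := fun i : ℕ => -(q ^ i * x))
    (by simpa [sub_eq_add_neg] using h) (by simpa using summable_norm_pow_mul hq x)
  simpa [sub_eq_add_neg, qPochInf] using this

lemma exists_norm_qPoch_le {q : ℂ} (hq : ‖q‖ < 1) (x : ℂ) :
    ∃ C : ℝ, 0 < C ∧ ∀ n, ‖qPoch x q n‖ ≤ C := by
  obtain ⟨C, hC⟩ := (Metric.isBounded_range_of_tendsto _ (tendsto_qPoch hq x)).exists_norm_le
  exact ⟨max C 1, by positivity, fun n => (hC _ ⟨n, rfl⟩).trans (le_max_left _ _)⟩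

lemma exists_norm_inv_qPoch_le {x q : ℂ} (hq : ‖q‖ < 1) (h : ∀ i : ℕ, 1 - q ^ i * x ≠ 0) :
    ∃ C : ℝ, 0 < C ∧ ∀ n, ‖(qPoch x q n)⁻¹‖ ≤ C := by
  obtain ⟨C, hC⟩ := (Metric.isBounded_range_of_tendsto _
    ((tendsto_qPoch hq x).inv₀ (qPochInf_ne_zero hq h))).exists_norm_le
  exact ⟨max C 1, by positivity, fun n => (hC _ ⟨n, rfl⟩).trans (le_max_left _ _)⟩

lemma one_sub_ne_zero_of_norm_lt {x : ℂ} (hx : ‖x‖ < 1) : 1 - x ≠ 0 := by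
  intro h
  rw [← sub_eq_zero.1 h] at hx
  simp at hx

lemma one_sub_pow_mul_ne_zero {x q : ℂ} (hq : ‖q‖ < 1) (hx : ‖x‖ < 1) (i : ℕ) :
    1 - q ^ i * x ≠ 0 := by
  refine one_sub_ne_zero_of_norm_lt ?_
  rw [norm_mul, norm_pow]
  exact (mul_le_of_le_one_left (norm_nonneg _) (pow_le_one₀ (norm_nonneg _) hq.le)).trans_lt hx

/-! ### Triangular exponents and bilateral summability -/

/-- `k (k - 1) / 2`. -/
def tri (k : ℤ) : ℤ := k * (k - 1) / 2

lemma two_mul_tri (k : ℤ) : 2 * tri k = k * (k - 1) := by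
  rw [tri, mul_comm]
  exact Int.ediv_mul_cancel (by
    rcases Int.even_or_odd' k with ⟨m, rfl | rfl⟩
    · exact ⟨m * (2 * m - 1), by ring⟩
    · exact ⟨(2 * m + 1) * m, by ring⟩)

lemma tri_add (k l : ℤ) : tri (k + l) = tri k + tri l + k * l := by
  linarith [two_mul_tri (k + l), two_mul_tri k, two_mul_tri l]

lemma tri_neg (k : ℤ) : tri (-k) = tri k + k := by
  linarith [two_mul_tri (-k), two_mul_tri k]

@[simp] lemma tri_zero : tri 0 = 0 := rfl
@[simp] lemma tri_one : tri 1 = 0 := rfl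

lemma tri_add_one (k : ℤ) : tri (k + 1) = tri k + k := by
  simp [tri_add]

/-- On the nonnegative half the ratio of consecutive terms is r^n z, which tends to 0. The negative
half is a series of the same shape with y replaced by r y⁻¹, because tri (-k) = tri k + k. -/
lemma summable_zpow_tri {r y : ℝ} (hr0 : 0 < r) (hr : r < 1) (hy : 0 < y) :
    Summable fun k : ℤ => r ^ tri k * y ^ k := by
  have key : ∀ z : ℝ, 0 < z → Summable fun k : ℕ => r ^ tri k * z ^ k := by
    intro z hz
    refine summable_of_ratio_test_tendsto_lt_one zero_lt_one
      (Eventually.of_forall fun n => by positivity) ?_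
    have : ∀ n : ℕ, ‖r ^ tri (n + 1 : ℕ) * z ^ (n + 1)‖ / ‖r ^ tri n * z ^ n‖ = r ^ n * z := by
      intro n
      rw [Real.norm_of_nonneg (by positivity), Real.norm_of_nonneg (by positivity)]
      push_cast
      rw [tri_add_one, zpow_add₀ hr0.ne', zpow_natCast, pow_succ]
      field_simp
    simp_rw [this]
    simpa using (tendsto_pow_atTop_nhds_zero_of_lt_one hr0.le hr).mul_const z
  refine Summable.of_nat_of_neg (by simpa using key y hy) ?_
  refine (key (r * y⁻¹) (by positivity)).congr fun n => ?_
  rw [tri_neg, zpow_add₀ hr0.ne', zpow_natCast, mul_pow, zpow_neg, zpow_natCast, inv_pow]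
  ring

lemma zpow_ne_one_of_norm_lt_one {q : ℂ} (hq : ‖q‖ < 1) {l : ℤ} (hl : l ≠ 0) :
    q ^ l ≠ 1 := by
  intro h
  have h1 : ‖q‖ ^ l = 1 := by rw [← norm_zpow, h, norm_one]
  exact hl ((zpow_eq_one_iff_right₀ (norm_nonneg _) hq.ne).1 h1)

/-! ### Finite theta products and their partial fractions -/

/-- The finite theta product `(c; q)_a (q / c; q)_b`. -/
noncomputable def thetaFin (c q : ℂ) (a b : ℕ) : ℂ := qPoch c q a * qPoch (q / c) q b

/-- One factor moves from one product to the other through 1 - c/q = -(c/q)(1 - q/c). Iterating this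
gives the finite quasi-periodicity of theta products. -/
lemma thetaFin_div {c q : ℂ} (hc : c ≠ 0) (hq : q ≠ 0) (a b : ℕ) :
    thetaFin (c / q) q (a + 1) b = -(c / q) * thetaFin c q a (b + 1) := by
  rw [thetaFin, thetaFin, qPoch_succ', qPoch_succ' (q / c)]
  have h1 : q * (c / q) = c := by field_simp
  have h2 : q / (c / q) = q * (q / c) := by field_simp
  rw [h1, h2]
  field_simp
  ring

lemma thetaFin_div_pow {c q : ℂ} (hc : c ≠ 0) (hq : q ≠ 0) (a : ℕ) (k b : ℕ) :
    thetaFin (c * q ^ (-k : ℤ)) q (a + k) b =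
      (-c) ^ k * q ^ (-tri (k + 1)) * thetaFin c q a (b + k) := by
  induction k generalizing b with
  | zero => simp
  | succ k ih =>
    have h1 : c * q ^ (-(k + 1 : ℕ) : ℤ) = (c * q ^ (-k : ℤ)) / q := by
      push_cast
      rw [neg_add, zpow_add₀ hq, zpow_neg_one]
      field_simp
    rw [h1, ← add_assoc, thetaFin_div (mul_ne_zero hc (zpow_ne_zero _ hq)) hq, ih]
    push_cast
    rw [tri_add_one (k + 1), neg_add (tri _), zpow_add₀ hq, neg_add (k : ℤ), zpow_add₀ hq,
      zpow_neg_one, add_right_comm b 1 k, add_assoc b, pow_succ]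
    field_simp

lemma thetaFin_mul_zpow {c q : ℂ} (hc : c ≠ 0) (hq : q ≠ 0) {a b a' b' : ℕ} {k : ℤ}
    (ha : (a' : ℤ) = a - k) (hb : (b' : ℤ) = b + k) :
    thetaFin (c * q ^ (-k)) q a b = (-c) ^ k * q ^ (-tri (k + 1)) * thetaFin c q a' b' := by
  obtain ⟨m, rfl | rfl⟩ := k.eq_nat_or_neg
  · obtain rfl : a = a' + m := by omega
    obtain rfl : b' = b + m := by omega
    rw [thetaFin_div_pow hc hq, zpow_natCast]
  · obtain rfl : a' = a + m := by omega
    obtain rfl : b = b' + m := by omega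
    have h := thetaFin_div_pow (mul_ne_zero hc (zpow_ne_zero (m : ℤ) hq)) hq a m b'
    rw [mul_assoc, ← zpow_add₀ hq, add_neg_cancel, zpow_zero, mul_one] at h
    rw [h, neg_neg, zpow_neg, zpow_natCast, zpow_natCast, neg_mul_eq_neg_mul, mul_pow]
    have h2 : q ^ (-tri (-(m : ℤ) + 1)) * (q ^ m) ^ m * q ^ (-tri (m + 1)) = 1 := by
      rw [← pow_mul, ← zpow_natCast, ← zpow_add₀ hq, ← zpow_add₀ hq]
      convert zpow_zero q
      push_cast
      linarith [two_mul_tri (-(m : ℤ) + 1), two_mul_tri (m + 1)]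
    have h3 : (-c) ^ m ≠ 0 := pow_ne_zero _ (neg_ne_zero.2 hc)
    field_simp
    linear_combination (-thetaFin (c * q ^ m) q a (b' + m)) * h2

lemma prod_Icc_neg (n : ℕ) (f : ℤ → ℂ) :
    ∏ l ∈ Icc (-n : ℤ) n, f l = ∏ i ∈ range (2 * n + 1), f (i - n) := by
  symm
  refine prod_nbij' (fun i => (i : ℤ) - n) (fun l => (l + n).toNat) ?_ ?_ ?_ ?_ ?_ <;>
    intros <;> simp_all <;> omega

lemma prod_Icc_one_sub_mul_zpow {y q : ℂ} (hy : y ≠ 0) (hq : q ≠ 0) (n : ℕ) :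
    ∏ l ∈ Icc (-n : ℤ) n, (1 - y * q ^ l) =
      (-y) ^ n * q ^ (-tri (n + 1)) * thetaFin y q (n + 1) n := by
  have h := thetaFin_div_pow hy hq (n + 1) n 0
  rw [zero_add] at h
  rw [← h, prod_Icc_neg, thetaFin, qPoch_zero, mul_one, qPoch, show n + 1 + n = 2 * n + 1 by ring]
  refine prod_congr rfl fun i _ => ?_
  rw [sub_eq_add_neg (i : ℤ), zpow_add₀ hq, zpow_natCast]
  ring

lemma prod_erase_one_sub_zpow {q : ℂ} (hq : q ≠ 0) {n : ℕ} {k : ℤ} (hk : k ∈ Icc (-n : ℤ) n) :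
    ∏ l ∈ (Icc (-n : ℤ) n).erase k, (1 - q ^ (l - k)) =
      (-1) ^ (n + k) * q ^ (-tri (n + k + 1)) *
        (qPoch q q (n - k).toNat * qPoch q q (n + k).toNat) := by
  rw [mem_Icc] at hk
  have hU : (Icc (-n : ℤ) n).erase k = Ioc k n ∪ Ico (-n : ℤ) k := by
    ext l; simp; omega
  have hD : Disjoint (Ioc k (n : ℤ)) (Ico (-n : ℤ) k) := by
    rw [disjoint_left]; intro l; simp; omega
  have h1 : ∏ l ∈ Ioc k (n : ℤ), (1 - q ^ (l - k)) = qPoch q q (n - k).toNat := by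
    symm
    refine prod_nbij' (fun i => (i : ℤ) + k + 1) (fun l => (l - k - 1).toNat) ?_ ?_ ?_ ?_ ?_
    any_goals (intro i hi; simp only [mem_range, mem_Ioc] at *; omega)
    intro i _
    rw [show (i : ℤ) + k + 1 - k = (i + 1 : ℕ) by push_cast; ring, zpow_natCast, pow_succ]
  have h2 : ∏ l ∈ Ico (-n : ℤ) k, (1 - q ^ (l - k)) =
      ∏ i ∈ range (n + k).toNat, (1 - q ^ (-(i + 1) : ℤ)) := by
    symm
    refine prod_nbij' (fun i => k - i - 1) (fun l => (k - l - 1).toNat) ?_ ?_ ?_ ?_ ?_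
    any_goals (intro i hi; simp only [mem_range, mem_Ico] at *; omega)
    intro i _
    congr 2; ring
  have h3 : ∀ N : ℕ, ∏ i ∈ range N, (1 - q ^ (-(i + 1) : ℤ)) =
      (-1) ^ N * q ^ (-tri (N + 1)) * qPoch q q N := by
    intro N
    induction N with
    | zero => simp
    | succ N ih =>
      rw [prod_range_succ, ih, qPoch_succ]
      push_cast
      rw [tri_add_one (N + 1), neg_add (tri _), zpow_add₀ hq, zpow_neg q (N + 1), pow_succ,
        ← Nat.cast_succ, zpow_natCast, Nat.succ_eq_add_one]
      field_simp
      ring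
  obtain ⟨N, hN⟩ := Int.eq_ofNat_of_zero_le (show 0 ≤ n + k by omega)
  rw [hU, prod_union hD, h1, h2, h3, hN, Int.toNat_natCast, zpow_natCast]
  ring

/-- Since d is smaller than the number of poles, Lagrange interpolation at the poles 1/u i
reproduces X^d exactly. Its barycentric form, divided by the nodal polynomial, is the partial
fraction expansion. -/
lemma pow_div_prod_one_sub_eq {κ : Type*} [DecidableEq κ] (s : Finset κ) (u : κ → ℂ)
    (hu : Set.InjOn u s) (hu0 : ∀ i ∈ s, u i ≠ 0) {d : ℕ} (hd : d < s.card) {z : ℂ}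
    (hz : ∀ i ∈ s, 1 - z * u i ≠ 0) :
    z ^ d / ∏ i ∈ s, (1 - z * u i) =
      ∑ i ∈ s, (u i ^ d * ∏ j ∈ s.erase i, (1 - u j / u i))⁻¹ * (1 - z * u i)⁻¹ := by
  set v : κ → ℂ := fun i => (u i)⁻¹ with hv
  have hvi : Set.InjOn v s := fun a ha b hb h => hu ha hb (inv_injective h)
  have hzv : ∀ i ∈ s, z ≠ v i := by
    intro i hi h
    apply hz i hi
    rw [h, hv]
    simp [hu0 i hi]
  have h1 : (Polynomial.X ^ d : Polynomial ℂ) = Lagrange.interpolate s v (fun i => v i ^ d) := by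
    have := Lagrange.eq_interpolate (f := (Polynomial.X ^ d : Polynomial ℂ)) hvi
      (by rw [Polynomial.degree_X_pow]; exact_mod_cast hd)
    simpa using this
  have h2 := congrArg (Polynomial.eval z) h1
  rw [Lagrange.eval_interpolate_not_at_node _ hzv, Lagrange.eval_nodal] at h2
  simp only [Polynomial.eval_pow, Polynomial.eval_X] at h2
  have h3 : ∏ i ∈ s, (z - v i) = (∏ i ∈ s, (-v i)) * ∏ i ∈ s, (1 - z * u i) := by
    rw [← prod_mul_distrib]
    refine prod_congr rfl fun i hi => ?_
    have := hu0 i hi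
    simp only [hv]
    field_simp
    ring
  have h4 : ∏ i ∈ s, (1 - z * u i) ≠ 0 := prod_ne_zero_iff.2 hz
  rw [h2, h3, mul_assoc, mul_div_assoc, mul_div_cancel_left₀ _ h4, mul_sum]
  refine sum_congr rfl fun i hi => ?_
  have h5 : Lagrange.nodalWeight s v i =
      (∏ j ∈ s.erase i, (-v j))⁻¹ * (∏ j ∈ s.erase i, (1 - u j / u i))⁻¹ := by
    rw [Lagrange.nodalWeight, ← mul_inv, ← prod_mul_distrib, ← prod_inv_distrib]
    refine prod_congr rfl fun j hj => ?_
    have h6 := hu0 i hi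
    have h7 := hu0 j (mem_of_mem_erase hj)
    congr 1
    simp only [hv]
    field_simp
    ring
  have h6 := hu0 i hi
  have h7 : ∏ j ∈ s.erase i, (-v j) ≠ 0 := prod_ne_zero_iff.2 fun j hj =>
    neg_ne_zero.2 (inv_ne_zero (hu0 j (mem_of_mem_erase hj)))
  have h8 : z - v i = -v i * (1 - z * u i) := by
    simp only [hv]; field_simp; ring
  have h9 : v i ≠ 0 := inv_ne_zero h6
  have h10 := hz i hi
  rw [h5, h8, ← mul_prod_erase s _ hi, mul_inv (-v i), mul_inv (u i ^ d)]
  have h11 : v i ^ d = (u i ^ d)⁻¹ := by simp [hv]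
  rw [h11]
  field_simp

/-- The coefficient of `1 / (1 - z cᵢ q ^ k)` in the partial fraction expansion of
`∏ⱼ 1 / ((z cⱼ; q)_{n+1} (q / (z cⱼ); q)_n)`. -/
noncomputable def thetaCoeff {ι : Type*} [Fintype ι] [DecidableEq ι] (c : ι → ℂ) (q : ℂ) (n : ℕ)
    (i : ι) (k : ℤ) : ℂ :=
  (-1) ^ k * q ^ tri (k + 1) * (qPoch q q (n - k).toNat * qPoch q q (n + k).toNat)⁻¹ *
    ∏ j ∈ univ.erase i, (-(c i / c j)) ^ k * q ^ tri (k + 1) *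
      (thetaFin (c j / c i) q (n + 1 - k).toNat (n + k).toNat)⁻¹

/-- For each i the product of 1 - z c i q^l over |l| ≤ n is the finite theta product times z^n and a
constant. The numerator of the rational function to expand is therefore z to the power `Fintype.card
ι * n`, which is less than the number `Fintype.card ι * (2 * n + 1)` of poles. The hypothesis `hcc`
keeps poles from different i apart. -/
lemma inv_prod_thetaFin {ι : Type*} [Fintype ι] [Nonempty ι] [DecidableEq ι] {c : ι → ℂ} {q z : ℂ}
    (hq0 : q ≠ 0) (hq : ‖q‖ < 1) (hc : ∀ i, c i ≠ 0)
    (hcc : ∀ i j, i ≠ j → ∀ k : ℤ, c i ≠ c j * q ^ k) (hz0 : z ≠ 0)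
    (hz : ∀ i (k : ℤ), 1 - z * c i * q ^ k ≠ 0) (n : ℕ) :
    (∏ i, thetaFin (z * c i) q (n + 1) n)⁻¹ =
      ∑ i, ∑ k ∈ Icc (-n : ℤ) n, thetaCoeff c q n i k * (1 - z * c i * q ^ k)⁻¹ := by
  set I := Icc (-n : ℤ) n with hI
  have hIc : I.card = 2 * n + 1 := by rw [hI, Int.card_Icc]; omega
  set s : Finset (ι × ℤ) := univ ×ˢ I with hs
  set u : ι × ℤ → ℂ := fun a => c a.1 * q ^ a.2 with hu
  have hu0 : ∀ a, u a ≠ 0 := fun a => mul_ne_zero (hc _) (zpow_ne_zero _ hq0)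
  have hinj : Set.InjOn u s := by
    rintro ⟨i, k⟩ - ⟨j, l⟩ - h
    simp only [hu] at h
    have hij : i = j := by
      by_contra hij
      apply hcc i j hij (l - k)
      rw [zpow_sub₀ hq0]
      have := zpow_ne_zero k hq0
      field_simp
      exact h
    subst hij
    have h2 : q ^ (k - l) = 1 := by
      rw [zpow_sub₀ hq0, mul_left_cancel₀ (hc i) h, div_self (zpow_ne_zero _ hq0)]
    by_contra hkl
    exact zpow_ne_one_of_norm_lt_one hq (l := k - l) (fun h => hkl (by rw [sub_eq_zero.1 h])) h2
  have hpf := pow_div_prod_one_sub_eq s u hinj (fun a _ => hu0 a)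
    (d := Fintype.card ι * n) (z := z) (by
      rw [hs, card_product, hIc, card_univ]
      exact Nat.mul_lt_mul_of_pos_left (by omega) Fintype.card_pos)
    (fun a _ => by simpa only [hu, mul_assoc] using hz a.1 a.2)
  have hL : ∏ a ∈ s, (1 - z * u a) = (∏ i, ((-(z * c i)) ^ n * q ^ (-tri (n + 1)))) *
      ∏ i, thetaFin (z * c i) q (n + 1) n := by
    rw [← prod_mul_distrib, hs, prod_product]
    refine prod_congr rfl fun i _ => ?_
    rw [← prod_Icc_one_sub_mul_zpow (mul_ne_zero hz0 (hc i)) hq0]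
    exact prod_congr rfl fun k _ => by simp only [hu]; ring
  have hK : ∏ i, ((-(z * c i)) ^ n * q ^ (-tri (n + 1))) =
      z ^ (Fintype.card ι * n) * ∏ i, ((-c i) ^ n * q ^ (-tri (n + 1))) := by
    rw [pow_mul', ← card_univ, ← prod_const, ← prod_mul_distrib]
    exact prod_congr rfl fun i _ => by ring
  have hK0 : ∏ i, ((-c i) ^ n * q ^ (-tri (n + 1))) ≠ 0 := prod_ne_zero_iff.2 fun i _ =>
    mul_ne_zero (pow_ne_zero _ (neg_ne_zero.2 (hc i))) (zpow_ne_zero _ hq0)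
  have hz1 : z ^ (Fintype.card ι * n) ≠ 0 := pow_ne_zero _ hz0
  have hmain : (∏ i, thetaFin (z * c i) q (n + 1) n)⁻¹ =
      (∏ i, ((-c i) ^ n * q ^ (-tri (n + 1)))) *
        (z ^ (Fintype.card ι * n) / ∏ a ∈ s, (1 - z * u a)) := by
    rw [hL, hK]
    generalize ∏ i, ((-c i) ^ n * q ^ (-tri (n + 1))) = K at hK0 ⊢
    field_simp
  rw [hmain, hpf, hs, sum_product, mul_sum]
  refine sum_congr rfl fun i _ => ?_
  rw [mul_sum]
  refine sum_congr rfl fun k hk => ?_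
  rw [← mul_assoc, ← mul_assoc z]
  congr 1
  have hk' := mem_Icc.1 hk
  -- The residue at (i, k) splits into the other poles of the same i, which give Pochhammer symbols
  -- in q alone, and all poles of the remaining j, which give shifted theta products in c j / c i.
  have herase : (univ ×ˢ I).erase (i, k) = (univ.erase i ×ˢ I) ∪ ({i} ×ˢ I.erase k) := by
    ext ⟨j, l⟩
    simp only [mem_erase, mem_product, mem_univ, true_and, mem_union, mem_singleton, ne_eq,
      Prod.mk.injEq]
    by_cases h : j = i <;> simp [h]
  have hdisj : Disjoint (univ.erase i ×ˢ I) ({i} ×ˢ I.erase k) := by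
    rw [disjoint_left]
    rintro ⟨j, l⟩
    simp only [mem_product, mem_erase, mem_singleton]
    tauto
  have hqk := zpow_ne_zero k hq0
  rw [herase, prod_union hdisj, prod_product, prod_product, prod_singleton]
  have hA : ∏ l ∈ I.erase k, (1 - u (i, l) / u (i, k)) =
      (-1) ^ (n + k) * q ^ (-tri (n + k + 1)) *
        (qPoch q q (n - k).toNat * qPoch q q (n + k).toNat) := by
    rw [← prod_erase_one_sub_zpow hq0 hk]
    refine prod_congr rfl fun l _ => ?_
    rw [zpow_sub₀ hq0]
    simp only [hu]
    rw [mul_div_mul_left _ _ (hc i)]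
  have hB : ∀ j, ∏ l ∈ I, (1 - u (j, l) / u (i, k)) =
      (-(c j / c i * q ^ (-k))) ^ n * q ^ (-tri (n + 1)) * ((-(c j / c i)) ^ k *
        q ^ (-tri (k + 1)) * thetaFin (c j / c i) q (n + 1 - k).toNat (n + k).toNat) := by
    intro j
    have h0 : c j / c i ≠ 0 := div_ne_zero (hc j) (hc i)
    rw [← thetaFin_mul_zpow h0 hq0 (a := n + 1) (b := n)
      (by push_cast; omega) (by omega),
      ← prod_Icc_one_sub_mul_zpow (mul_ne_zero h0 (zpow_ne_zero _ hq0)) hq0]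
    refine prod_congr rfl fun l _ => ?_
    simp only [hu]
    rw [zpow_neg]
    have := hc i
    field_simp
  rw [hA, prod_congr rfl fun j _ => hB j, thetaCoeff,
    ← mul_prod_erase univ (fun i => (-c i) ^ n * q ^ (-tri (n + 1))) (mem_univ i)]
  have hu1 : u (i, k) ^ (Fintype.card ι * n) =
      (c i * q ^ k) ^ n * ∏ j ∈ univ.erase i, (c i * q ^ k) ^ n := by
    rw [mul_prod_erase univ (fun _ => (c i * q ^ k) ^ n) (mem_univ i), prod_const, card_univ,
      ← pow_mul, mul_comm n]
  have hdiag : (-c i) ^ n * q ^ (-tri (n + 1)) * (((c i * q ^ k) ^ n)⁻¹ *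
      ((-1) ^ (n + k) * q ^ (-tri (n + k + 1)))⁻¹) = (-1) ^ k * q ^ tri (k + 1) := by
    have h1 : tri (n + k + 1) = tri (n + 1) + tri (k + 1) + n * k := by
      linarith [two_mul_tri (n + k + 1), two_mul_tri (n + 1), two_mul_tri (k + 1)]
    have h2 : (-1 : ℂ) ^ k * (-1) ^ k = 1 := by
      rw [← mul_zpow]; norm_num
    rw [h1, zpow_neg q (tri _ + _ + _), zpow_add₀ hq0, zpow_add₀ hq0, zpow_neg, mul_pow,
      ← zpow_natCast (q ^ k), ← zpow_mul, neg_pow, zpow_add₀ (by norm_num), mul_comm k n,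
      zpow_natCast (-1 : ℂ)]
    have h3 := hc i
    have h4 := zpow_ne_zero (n * k) hq0
    have h5 := zpow_ne_zero (tri (n + 1)) hq0
    have h6 : (-1 : ℂ) ^ k ≠ 0 := zpow_ne_zero _ (by norm_num)
    field_simp
    linear_combination -h2
  have hoff : ∀ j, (-c j) ^ n * q ^ (-tri (n + 1)) * (((c i * q ^ k) ^ n)⁻¹ *
      ((-(c j / c i * q ^ (-k))) ^ n * q ^ (-tri (n + 1)) * ((-(c j / c i)) ^ k *
        q ^ (-tri (k + 1))))⁻¹) = (-(c i / c j)) ^ k * q ^ tri (k + 1) := by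
    intro j
    have h1 := hc i
    have h2 := hc j
    have h3 : -(c i / c j) = (-(c j / c i))⁻¹ := by field_simp
    have h4 : -(c j / c i) ≠ 0 := neg_ne_zero.2 (div_ne_zero h2 h1)
    have h5 := zpow_ne_zero k h4
    have h6 : -(c j / c i * q ^ (-k)) = -c j * (c i * q ^ k)⁻¹ := by
      rw [zpow_neg]; field_simp
    rw [h3, inv_zpow, h6, mul_pow (-c j), zpow_neg q (tri (k + 1)), inv_pow]
    have h7 := zpow_ne_zero (-tri (n + 1)) hq0
    have h8 : (-c j) ^ n ≠ 0 := pow_ne_zero _ (neg_ne_zero.2 h2)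
    have h9 : (c i * q ^ k) ^ n ≠ 0 := pow_ne_zero _ (mul_ne_zero h1 hqk)
    field_simp
  rw [hu1, ← hdiag]
  have hoff' : ∏ j ∈ univ.erase i, ((-(c i / c j)) ^ k * q ^ tri (k + 1) *
      (thetaFin (c j / c i) q (n + 1 - k).toNat (n + k).toNat)⁻¹) =
      (∏ j ∈ univ.erase i, (-c j) ^ n * q ^ (-tri (n + 1))) *
      ((∏ j ∈ univ.erase i, (c i * q ^ k) ^ n)⁻¹ * (∏ j ∈ univ.erase i,
        ((-(c j / c i * q ^ (-k))) ^ n * q ^ (-tri (n + 1)) * ((-(c j / c i)) ^ k *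
        q ^ (-tri (k + 1)) * thetaFin (c j / c i) q (n + 1 - k).toNat (n + k).toNat)))⁻¹) := by
    rw [← prod_inv_distrib, ← prod_inv_distrib, ← prod_mul_distrib, ← prod_mul_distrib]
    refine prod_congr rfl fun j _ => ?_
    rw [← hoff j]
    simp only [mul_inv]
    ring
  rw [hoff']
  simp only [mul_inv]
  ring

/-! ### Dominated convergence and bounds for bilateral sums -/

/-- Tannery's theorem for symmetric truncations: extended by zero, the truncated sums become series
dominated by C times the summable majorant. -/
lemma tendsto_sum_Icc_mul {a w : ℤ → ℂ} {W : ℕ → ℤ → ℂ} {C : ℝ} (ha : Summable fun k => ‖a k‖)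
    (hW : ∀ (n : ℕ) k, k ∈ Icc (-n : ℤ) n → ‖W n k‖ ≤ C)
    (hw : ∀ k, Tendsto (fun n => W n k) atTop (𝓝 (w k))) :
    Tendsto (fun n : ℕ => ∑ k ∈ Icc (-n : ℤ) n, a k * W n k) atTop (𝓝 (∑' k, a k * w k)) := by
  have h1 : ∀ n : ℕ, ∑ k ∈ Icc (-n : ℤ) n, a k * W n k =
      ∑' k : ℤ, if k ∈ Icc (-n : ℤ) n then a k * W n k else 0 := by
    intro n
    rw [tsum_eq_sum (s := Icc (-n : ℤ) n) (fun k hk => if_neg hk)]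
    exact sum_congr rfl fun k hk => (if_pos hk).symm
  simp_rw [h1]
  refine tendsto_tsum_of_dominated_convergence (bound := fun k => ‖a k‖ * |C|)
    (ha.mul_right _) (fun k => ?_) (Eventually.of_forall fun n k => ?_)
  · refine Tendsto.congr' ?_ ((hw k).const_mul (a k))
    filter_upwards [eventually_ge_atTop k.natAbs] with n hn
    rw [if_pos]
    rw [mem_Icc]; omega
  · split_ifs with h
    · rw [norm_mul]
      exact mul_le_mul_of_nonneg_left ((hW n k h).trans (le_abs_self _)) (norm_nonneg _)
    · rw [norm_zero]; positivity

/-- Only finitely many x q^k have norm near 1. The weight 1 + ‖x q^k‖ on the left makes the bound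
survive a small perturbation of x uniformly in k, which the limits at a pole require. -/
lemma exists_le_norm_one_sub_zpow {x q : ℂ} (hx : x ≠ 0) (hq0 : q ≠ 0) (hq : ‖q‖ < 1) :
    ∃ δ : ℝ, 0 < δ ∧ ∀ k : ℤ, 1 - x * q ^ k ≠ 0 → δ * (1 + ‖x * q ^ k‖) ≤ ‖1 - x * q ^ k‖ := by
  have hx' : 0 < ‖x‖ := norm_pos_iff.2 hx
  have hq0' : 0 < ‖q‖ := norm_pos_iff.2 hq0
  obtain ⟨N, hN⟩ := exists_pow_lt_of_lt_one (show 0 < min (1 / (2 * ‖x‖)) (‖x‖ / 2) by positivity) hq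
  rw [lt_min_iff] at hN
  obtain ⟨h1, h2⟩ := hN
  set g : ℤ → ℝ := fun k => if 1 - x * q ^ k = 0 then 1 else ‖1 - x * q ^ k‖ / (1 + ‖x * q ^ k‖)
    with hg
  have hg0 : ∀ k, 0 < g k := by
    intro k
    simp only [hg]
    split_ifs with h
    · exact one_pos
    · exact div_pos (norm_pos_iff.2 h) (by positivity)
  obtain ⟨k₀, -, hk₀⟩ := exists_min_image (Icc (-N : ℤ) N) g ⟨0, by simp⟩
  -- The constant 1/3 serves the tails: if ‖y‖ ≥ 2 or ‖y‖ ≤ 1/2 then ‖1 - y‖ ≥ (1 + ‖y‖)/3. The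
  -- minimum over the finite middle range is positive because `g` takes the value 1 at a possible
  -- zero.
  refine ⟨min (1 / 3) (g k₀), lt_min (by norm_num) (hg0 _), fun k hk => ?_⟩
  by_cases hkN : k ∈ Icc (-N : ℤ) N
  · have h3 := hk₀ k hkN
    simp only [hg] at h3
    rw [if_neg hk] at h3
    rw [← le_div_iff₀ (by positivity)]
    exact (min_le_right _ _).trans h3
  refine (mul_le_mul_of_nonneg_right (min_le_left _ _) (by positivity)).trans ?_
  have hn : ‖x * q ^ k‖ = ‖x‖ * ‖q‖ ^ k := by rw [norm_mul, norm_zpow]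
  rw [mem_Icc, not_and_or, not_le, not_le] at hkN
  rcases hkN with h | h
  · have h4 : ‖q‖ ^ (-N : ℤ) ≤ ‖q‖ ^ k := zpow_le_zpow_right_of_le_one₀ hq0' hq.le (by omega)
    rw [zpow_neg, zpow_natCast] at h4
    have h5 : 2 / ‖x‖ ≤ (‖q‖ ^ N)⁻¹ := by
      rw [le_inv_comm₀ (by positivity) (by positivity), inv_div]; exact h2.le
    have h6 : 2 ≤ ‖x‖ * ‖q‖ ^ k := by
      have := h5.trans h4
      rw [div_le_iff₀ hx'] at this
      linarith
    have h7 := norm_sub_norm_le (x * q ^ k) 1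
    rw [norm_sub_rev, norm_one] at h7
    rw [← hn] at h6
    linarith
  · have h4 : ‖q‖ ^ k ≤ ‖q‖ ^ (N : ℤ) := zpow_le_zpow_right_of_le_one₀ hq0' hq.le (by omega)
    rw [zpow_natCast] at h4
    have h6 : ‖x‖ * ‖q‖ ^ k ≤ 1 / 2 := by
      have := h4.trans h1.le
      rw [le_div_iff₀ (by positivity)] at this
      linarith
    have h7 := norm_sub_norm_le 1 (x * q ^ k)
    rw [norm_one] at h7
    rw [← hn] at h6
    linarith

lemma exists_norm_inv_one_sub_zpow_le {x q : ℂ} (hx : x ≠ 0) (hq0 : q ≠ 0) (hq : ‖q‖ < 1) :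
    ∃ C : ℝ, 0 < C ∧ ∀ k : ℤ, ‖(1 - x * q ^ k)⁻¹‖ ≤ C := by
  obtain ⟨δ, hδ, h⟩ := exists_le_norm_one_sub_zpow hx hq0 hq
  refine ⟨δ⁻¹, inv_pos.2 hδ, fun k => ?_⟩
  by_cases hk : 1 - x * q ^ k = 0
  · rw [hk, inv_zero, norm_zero]; positivity
  · rw [norm_inv]
    apply inv_anti₀ hδ
    refine le_trans ?_ (h k hk)
    have := norm_nonneg (x * q ^ k)
    nlinarith

lemma summable_norm_zpow_tri {q y : ℂ} (hq0 : q ≠ 0) (hq : ‖q‖ < 1) (hy : y ≠ 0) {s : ℕ}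
    (hs : s ≠ 0) : Summable fun k : ℤ => ‖(-1) ^ k * q ^ (s * tri k) * y ^ k‖ := by
  refine (summable_zpow_tri (r := ‖q‖ ^ s) (y := ‖y‖) (by positivity)
    (pow_lt_one₀ (norm_nonneg _) hq hs) (by positivity)).congr fun k => ?_
  rw [norm_mul, norm_mul, norm_zpow, norm_zpow, norm_zpow, norm_neg, norm_one, one_zpow, one_mul,
    zpow_mul, zpow_natCast]

lemma summable_norm_tri {q y : ℂ} (hq0 : q ≠ 0) (hq : ‖q‖ < 1) (hy : y ≠ 0) :
    Summable fun k : ℤ => ‖(-1) ^ k * q ^ tri k * y ^ k‖ := by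
  simpa using summable_norm_zpow_tri hq0 hq hy one_ne_zero

/-! ### The q-binomial theorem and the Jacobi triple product -/

/-- Gaussian binomial coefficients. -/
noncomputable def gaussBinom (q : ℂ) : ℕ → ℕ → ℂ
  | _, 0 => 1
  | 0, _ + 1 => 0
  | n + 1, m + 1 => gaussBinom q n m + q ^ (m + 1) * gaussBinom q n (m + 1)

@[simp] lemma gaussBinom_zero_right (q : ℂ) (n : ℕ) : gaussBinom q n 0 = 1 := by
  cases n <;> simp [gaussBinom]

lemma gaussBinom_eq_zero (q : ℂ) {n m : ℕ} (h : n < m) : gaussBinom q n m = 0 := by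
  induction n generalizing m with
  | zero => cases m with
    | zero => omega
    | succ m => simp [gaussBinom]
  | succ n ih => cases m with
    | zero => omega
    | succ m => rw [gaussBinom, ih (by omega), ih (by omega)]; simp

lemma gaussBinom_self (q : ℂ) (n : ℕ) : gaussBinom q n n = 1 := by
  induction n with
  | zero => simp
  | succ n ih => rw [gaussBinom, ih, gaussBinom_eq_zero q (by omega)]; simp

lemma gaussBinom_mul (q : ℂ) (m l : ℕ) :
    gaussBinom q (m + l) m * (qPoch q q m * qPoch q q l) = qPoch q q (m + l) := by
  induction hN : m + l generalizing m l with
  | zero =>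
    obtain ⟨rfl, rfl⟩ : m = 0 ∧ l = 0 := by omega
    simp
  | succ N ih =>
    cases m with
    | zero => simp at hN; simp [hN]
    | succ m =>
      cases l with
      | zero =>
        obtain rfl : m = N := by omega
        rw [gaussBinom_self]; simp
      | succ l =>
        have h1 := ih m (l + 1) (by omega)
        have h2 := ih (m + 1) l (by omega)
        rw [gaussBinom, qPoch_succ q q N, ← (show m + (l + 1) = N by omega)] 
        rw [← (show m + (l + 1) = N by omega)] at h1 h2
        rw [qPoch_succ q q m, qPoch_succ q q l] at *
        rw [show m + (l + 1) = m + 1 + l by omega] at *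
        have h3 : q ^ (m + 1 + l) = q ^ m * q ^ l * q := by ring
        rw [h3]
        linear_combination (1 - q ^ m * q) * h1 + q ^ (m + 1) * (1 - q ^ l * q) * h2

/-- The finite q-binomial theorem, by induction from (y;q)_(n+1) = (1 - y)(qy;q)_n and the q-Pascal
rule. -/
lemma qPoch_eq_sum (y q : ℂ) (n : ℕ) :
    qPoch y q n = ∑ m ∈ range (n + 1),
      (-1) ^ m * q ^ (m * (m - 1) / 2) * gaussBinom q n m * y ^ m := by
  induction n generalizing y with
  | zero => simp
  | succ n ih =>
    rw [qPoch_succ', ih, sum_range_succ' _ (n + 1)]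
    simp only [gaussBinom]
    have h1 : ∀ m : ℕ, (m + 1) * (m + 1 - 1) / 2 = m * (m - 1) / 2 + m := fun m =>
      Nat.triangle_succ m
    simp only [h1]
    rw [sub_mul, one_mul, sum_range_succ' _ n, sum_congr rfl fun m _ => show
      (-1 : ℂ) ^ (m + 1) * q ^ (m * (m - 1) / 2 + m) * (gaussBinom q n m +
        q ^ (m + 1) * gaussBinom q n (m + 1)) * y ^ (m + 1) =
      (-1) ^ (m + 1) * q ^ (m * (m - 1) / 2 + m) * gaussBinom q n (m + 1) * (q * y) ^ (m + 1) -
      y * ((-1) ^ m * q ^ (m * (m - 1) / 2) * gaussBinom q n m * (q * y) ^ m) by ring]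
    rw [sum_sub_distrib, ← mul_sum, sum_range_succ (fun m => (-1 : ℂ) ^ (m + 1) *
      q ^ (m * (m - 1) / 2 + m) * gaussBinom q n (m + 1) * (q * y) ^ (m + 1)) n,
      gaussBinom_eq_zero q (Nat.lt_succ_self n), sum_range_succ' (fun m => (-1 : ℂ) ^ m *
      q ^ (m * (m - 1) / 2) * gaussBinom q n m * (q * y) ^ m) n]
    simp only [h1]
    simp
    ring

lemma tendsto_toNat_add_atTop (k : ℤ) : Tendsto (fun n : ℕ => (n + k).toNat) atTop atTop :=
  tendsto_atTop.2 fun b => by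
    filter_upwards [eventually_ge_atTop (b + k.natAbs)] with n hn
    omega

lemma tendsto_toNat_sub_atTop (k : ℤ) : Tendsto (fun n : ℕ => (n - k).toNat) atTop atTop := by
  simpa [sub_eq_add_neg] using tendsto_toNat_add_atTop (-k)

lemma qPochInf_self_ne_zero {q : ℂ} (hq : ‖q‖ < 1) : qPochInf q q ≠ 0 :=
  qPochInf_ne_zero hq (one_sub_pow_mul_ne_zero hq hq)

lemma qPoch_self_ne_zero {q : ℂ} (hq : ‖q‖ < 1) (n : ℕ) : qPoch q q n ≠ 0 :=
  qPoch_ne_zero (one_sub_pow_mul_ne_zero hq hq) n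

/-- Finite form of the triple product: the q-binomial theorem for the 2n factors of (x q^(-n);
q)_(2n), recentred at the middle index. -/
lemma thetaFin_eq_sum {x q : ℂ} (hx : x ≠ 0) (hq : q ≠ 0) (n : ℕ) :
    thetaFin x q n n = ∑ k ∈ Icc (-n : ℤ) n,
      ((-1) ^ k * q ^ tri k * x ^ k) * gaussBinom q (2 * n) (n + k).toNat := by
  have h := thetaFin_div_pow hx hq n n 0
  rw [zero_add] at h
  have h1 : thetaFin x q n n = ((-x) ^ n)⁻¹ * q ^ (tri (n + 1)) *
      thetaFin (x * q ^ (-n : ℤ)) q (n + n) 0 := by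
    rw [h, zpow_neg]
    have := zpow_ne_zero (tri (n + 1)) hq
    have : (-x) ^ n ≠ 0 := pow_ne_zero _ (neg_ne_zero.2 hx)
    field_simp
  rw [h1, thetaFin, qPoch_zero, mul_one, qPoch_eq_sum, mul_sum, ← two_mul]
  refine sum_nbij' (fun i => (i : ℤ) - n) (fun l => (l + n).toNat) ?_ ?_ ?_ ?_ ?_
  any_goals (intro i hi; simp only [mem_range, mem_Icc] at *; omega)
  intro m hm
  have h2 : (n + ((m : ℤ) - n)).toNat = m := by omega
  have h3 : ((m * (m - 1) / 2 : ℕ) : ℤ) = tri m := by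
    have := Nat.triangle_succ
    cases m with
    | zero => simp
    | succ m => rw [tri]; push_cast; simp
  rw [h2, mul_pow, ← zpow_natCast q (m * (m - 1) / 2), h3, ← zpow_natCast (q ^ (-n : ℤ)), ← zpow_mul]
  have h4 : tri (m - n) = tri (n + 1) + tri m + -n * m := by
    linarith [two_mul_tri (m - n), two_mul_tri m, two_mul_tri (n + 1)]
  rw [h4, zpow_add₀ hq, zpow_add₀ hq, zpow_sub₀ hx, zpow_sub₀ (by norm_num), neg_pow x]
  simp only [zpow_natCast]
  have h5 : (-1 : ℂ) ^ n ≠ 0 := pow_ne_zero _ (by norm_num)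
  field_simp

lemma tendsto_inv_qPoch_mul {q : ℂ} (hq : ‖q‖ < 1) (k : ℤ) :
    Tendsto (fun n : ℕ => (qPoch q q (n - k).toNat * qPoch q q (n + k).toNat)⁻¹) atTop
      (𝓝 (qPochInf q q * qPochInf q q)⁻¹) :=
  (((tendsto_qPoch hq q).comp (tendsto_toNat_sub_atTop k)).mul
    ((tendsto_qPoch hq q).comp (tendsto_toNat_add_atTop k))).inv₀
    (mul_ne_zero (qPochInf_self_ne_zero hq) (qPochInf_self_ne_zero hq))

lemma gaussBinom_eq {q : ℂ} (hq : ‖q‖ < 1) {n : ℕ} {k : ℤ} (hk : k ∈ Icc (-n : ℤ) n) :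
    gaussBinom q (2 * n) (n + k).toNat =
      qPoch q q (2 * n) * (qPoch q q (n - k).toNat * qPoch q q (n + k).toNat)⁻¹ := by
  rw [mem_Icc] at hk
  have h := gaussBinom_mul q (n + k).toNat (n - k).toNat
  rw [show (n + k).toNat + (n - k).toNat = 2 * n by omega] at h
  have h1 := qPoch_self_ne_zero hq (n + k).toNat
  have h2 := qPoch_self_ne_zero hq (n - k).toNat
  rw [← h]
  field_simp

lemma tendsto_thetaFin {q : ℂ} (hq : ‖q‖ < 1) (x : ℂ) {a b : ℕ → ℕ} (ha : Tendsto a atTop atTop)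
    (hb : Tendsto b atTop atTop) : Tendsto (fun n => thetaFin x q (a n) (b n)) atTop
      (𝓝 (qPochInf x q * qPochInf (q / x) q)) :=
  ((tendsto_qPoch hq x).comp ha).mul ((tendsto_qPoch hq _).comp hb)

/-- The **Jacobi triple product** identity. -/
theorem jTheta_eq_tsum {x q : ℂ} (hx : x ≠ 0) (hq0 : q ≠ 0) (hq : ‖q‖ < 1) :
    jTheta x q = ∑' k : ℤ, (-1) ^ k * q ^ tri k * x ^ k := by
  obtain ⟨C, hC0, hC⟩ := exists_norm_inv_qPoch_le hq (one_sub_pow_mul_ne_zero hq hq)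
  have h1 : Tendsto (fun n : ℕ => ∑ k ∈ Icc (-n : ℤ) n, ((-1) ^ k * q ^ tri k * x ^ k) *
      (qPoch q q (n - k).toNat * qPoch q q (n + k).toNat)⁻¹) atTop
      (𝓝 (∑' k : ℤ, ((-1) ^ k * q ^ tri k * x ^ k) * (qPochInf q q * qPochInf q q)⁻¹)) := by
    refine tendsto_sum_Icc_mul (C := C * C) (summable_norm_tri hq0 hq hx) (fun n k _ => ?_)
      (tendsto_inv_qPoch_mul hq)
    rw [mul_inv, norm_mul]
    exact mul_le_mul (hC _) (hC _) (norm_nonneg _) hC0.le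
  -- The central Gaussian binomial is (q;q)_(2n) times the reciprocal in `h1`. Each coefficient thus
  -- tends to 1/(q;q)_∞, which the third factor of `jTheta` cancels.
  have h2 := ((tendsto_qPoch hq q).comp
    (tendsto_id.const_mul_atTop' (two_pos : (0 : ℕ) < 2))).mul h1
  have h3 := tendsto_nhds_unique (tendsto_thetaFin hq x tendsto_id tendsto_id)
    (h2.congr fun n => by
      simp only [Function.comp, id]
      rw [thetaFin_eq_sum hx hq0, mul_sum]
      refine sum_congr rfl fun k hk => ?_
      rw [gaussBinom_eq hq hk]
      ring)
  have h4 := qPochInf_self_ne_zero hq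
  rw [jTheta, h3, tsum_mul_right]
  field_simp

lemma qPochInf_eq_prod {q : ℂ} (hq : ‖q‖ < 1) (x : ℂ) {m : ℕ} (hm : m ≠ 0) :
    qPochInf x q = ∏ r ∈ range m, qPochInf (q ^ r * x) (q ^ m) := by
  have h1 : ∀ n, qPoch x q (m * n) = ∏ r ∈ range m, qPoch (q ^ r * x) (q ^ m) n := by
    intro n
    induction n with
    | zero => simp
    | succ n ih =>
      simp_rw [qPoch_succ, prod_mul_distrib, ← ih]
      rw [mul_add, mul_one, qPoch, prod_range_add]
      congr 1
      exact prod_congr rfl fun i _ => by rw [← pow_mul, ← mul_assoc, ← pow_add]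
  have hqm : ‖q ^ m‖ < 1 := by rw [norm_pow]; exact pow_lt_one₀ (norm_nonneg _) hq hm
  refine tendsto_nhds_unique ((tendsto_qPoch hq x).comp
    (tendsto_id.const_mul_atTop' (Nat.pos_of_ne_zero hm))) ?_
  refine Tendsto.congr (fun n => (h1 n).symm) ?_
  exact tendsto_finsetProd _ fun r _ => tendsto_qPoch hqm _

lemma jTheta_self_cube {q : ℂ} (hq0 : q ≠ 0) (hq : ‖q‖ < 1) : jTheta q (q ^ 3) = qPochInf q q := by
  rw [qPochInf_eq_prod hq q (m := 3) (by norm_num), jTheta]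
  simp only [prod_range_succ, prod_range_zero, one_mul, pow_zero, pow_one]
  congr 2
  · congr 2; field_simp

/-- Euler's pentagonal number theorem. -/
lemma tsum_pentagonal {q : ℂ} (hq0 : q ≠ 0) (hq : ‖q‖ < 1) :
    ∑' k : ℤ, (-1) ^ k * q ^ (3 * tri k) * q ^ k = qPochInf q q := by
  rw [← jTheta_self_cube hq0 hq, jTheta_eq_tsum hq0 (pow_ne_zero _ hq0)
    (by rw [norm_pow]; exact pow_lt_one₀ (norm_nonneg _) hq (by norm_num))]
  refine tsum_congr fun k => ?_
  rw [zpow_mul]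
  norm_cast

lemma tsum_pentagonal_two {q : ℂ} (hq0 : q ≠ 0) (hq : ‖q‖ < 1) :
    ∑' k : ℤ, (-1) ^ k * q ^ (3 * tri k) * (q ^ 2) ^ k = qPochInf q q := by
  rw [← tsum_pentagonal hq0 hq, ← (Equiv.neg ℤ).tsum_eq]
  refine tsum_congr fun k => ?_
  simp only [Equiv.neg_apply]
  rw [tri_neg, mul_add, zpow_add₀ hq0, zpow_neg, zpow_neg, ← inv_zpow, inv_neg, inv_one,
    ← zpow_natCast q 2, ← zpow_mul, mul_assoc, mul_assoc, ← zpow_neg, ← zpow_add₀ hq0]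
  rw [mul_assoc]
  congr 3
  push_cast
  ring

/-! ### Level three Lambert series and the universal mock theta function -/

/-- `∑ (-1) ^ k q ^ (3 k (k - 1) / 2) y ^ k / (1 - x q ^ k)` over the integers. -/
noncomputable def lam (x y q : ℂ) : ℂ :=
  ∑' k : ℤ, (-1) ^ k * q ^ (3 * tri k) * y ^ k * (1 - x * q ^ k)⁻¹

lemma summable_norm_mul_inv {x q : ℂ} (hq0 : q ≠ 0) (hq : ‖q‖ < 1) (hx : x ≠ 0) {a : ℤ → ℂ}
    (ha : Summable fun k => ‖a k‖) : Summable fun k : ℤ => ‖a k * (1 - x * q ^ k)⁻¹‖ := by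
  obtain ⟨C, hC0, hC⟩ := exists_norm_inv_one_sub_zpow_le hx hq0 hq
  refine Summable.of_nonneg_of_le (fun _ => norm_nonneg _) (fun k => ?_) (ha.mul_right C)
  rw [norm_mul]
  exact mul_le_mul_of_nonneg_left (hC k) (norm_nonneg _)

lemma summable_lam {x y q : ℂ} (hq0 : q ≠ 0) (hq : ‖q‖ < 1) (hx : x ≠ 0) (hy : y ≠ 0) :
    Summable fun k : ℤ => (-1) ^ k * q ^ (3 * tri k) * y ^ k * (1 - x * q ^ k)⁻¹ :=
  (summable_norm_mul_inv hq0 hq hx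
    (by simpa using summable_norm_zpow_tri hq0 hq hy (s := 3) (by norm_num))).of_norm

/-- Termwise, y^k - x (qy)^k = y^k (1 - x q^k) cancels the denominator. Hence the step y ↦ qy costs
only a theta series. -/
lemma lam_sub_mul_lam {x y q : ℂ} (hq0 : q ≠ 0) (hq : ‖q‖ < 1) (hx : x ≠ 0) (hy : y ≠ 0)
    (h : ∀ k : ℤ, 1 - x * q ^ k ≠ 0) :
    lam x y q - x * lam x (q * y) q = ∑' k : ℤ, (-1) ^ k * q ^ (3 * tri k) * y ^ k := by
  rw [lam, lam, ← tsum_mul_left, ← (summable_lam hq0 hq hx hy).tsum_sub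
    ((summable_lam hq0 hq hx (mul_ne_zero hq0 hy)).mul_left x)]
  refine tsum_congr fun k => ?_
  have := h k
  rw [mul_zpow]
  field_simp

lemma norm_cauchyTerm_le {q : ℂ} (hq : ‖q‖ < 1) {C : ℝ}
    (hC : ∀ n, ‖(qPoch q q n)⁻¹‖ ≤ C) (c m : ℕ) :
    ‖q ^ (m * (m + c)) * (qPoch q q m * qPoch q q (m + c))⁻¹‖ ≤ ‖q‖ ^ m * (C * C) := by
  rw [norm_mul, mul_inv, norm_mul, norm_pow]
  have hC0 : 0 ≤ C := (norm_nonneg _).trans (hC 0)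
  refine mul_le_mul (pow_le_pow_of_le_one (norm_nonneg _) hq.le ?_)
    (mul_le_mul (hC _) (hC _) (norm_nonneg _) hC0) (by positivity) (by positivity)
  cases m with
  | zero => simp
  | succ m => nlinarith

/-- Cauchy's identity for Durfee rectangles. -/
lemma tsum_durfee {q : ℂ} (hq : ‖q‖ < 1) (c : ℕ) :
    ∑' m : ℕ, q ^ (m * (m + c)) * (qPoch q q m * qPoch q q (m + c))⁻¹ = (qPochInf q q)⁻¹ := by
  obtain ⟨C, hC0, hC⟩ := exists_norm_inv_qPoch_le hq (one_sub_pow_mul_ne_zero hq hq)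
  set t : ℕ → ℕ → ℂ := fun c m => q ^ (m * (m + c)) * (qPoch q q m * qPoch q q (m + c))⁻¹ with ht
  have hgeo : Summable fun m : ℕ => ‖q‖ ^ m * (C * C) :=
    (summable_geometric_of_lt_one (norm_nonneg _) hq).mul_right _
  have hs : ∀ c, Summable (t c) := fun c =>
    Summable.of_norm_bounded hgeo (norm_cauchyTerm_le hq hC c)
  set F : ℕ → ℂ := fun c => ∑' m, t c m with hF
  have hFB : ∀ c, ‖F c‖ ≤ ∑' m : ℕ, ‖q‖ ^ m * (C * C) := fun c =>
    tsum_of_norm_bounded hgeo.hasSum (norm_cauchyTerm_le hq hC c)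
  set B := ∑' m : ℕ, ‖q‖ ^ m * (C * C)
  have h0 := fun n => qPoch_self_ne_zero hq n
  -- A telescoping rearrangement: both differences are compared with the auxiliary terms `A`, which
  -- vanish at m = 0 and may therefore be shifted by one.
  have hrec : ∀ c, F c - F (c + 1) = -q ^ (c + 1) * (F (c + 1) - F (c + 2)) := by
    intro c
    set A : ℕ → ℂ := fun m => q ^ (m * (m + c)) * (1 - q ^ m) *
      (qPoch q q m * qPoch q q (m + c + 1))⁻¹ with hA
    have hA' : ∀ m, A (m + 1) = q ^ ((m + 1) * (m + 1 + c)) *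
        (qPoch q q m * qPoch q q (m + c + 2))⁻¹ := by
      intro m
      simp only [hA]
      have h1 := h0 (m + 1)
      rw [show m + 1 + c + 1 = m + c + 2 by ring]
      rw [qPoch_succ] at h1 ⊢
      have h2 := right_ne_zero_of_mul h1
      have h3 := h0 m
      rw [← pow_succ] at h2 ⊢
      field_simp
    have hstep : ∀ m, t c m - t (c + 1) m = A m - q ^ (c + 1) * t (c + 1) m := by
      intro m
      simp only [ht, hA]
      rw [← add_assoc, qPoch_succ q q (m + c), ← pow_succ]
      have h1 := h0 (m + c + 1)
      rw [qPoch_succ, ← pow_succ] at h1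
      have h2 := right_ne_zero_of_mul h1
      have h3 := h0 (m + c)
      have h4 := h0 m
      have h5 : q ^ (m + c + 1) = q ^ m * q ^ (c + 1) := by ring
      have h6 : q ^ (m * (m + c + 1)) = q ^ (m * (m + c)) * q ^ m := by ring
      rw [h6]
      field_simp
      rw [h5]
      ring
    have hAs : Summable A := by
      have := ((hs c).sub (hs (c + 1))).add ((hs (c + 1)).mul_left (q ^ (c + 1)))
      refine this.congr fun m => ?_
      rw [hstep]; ring
    have hA0 : A 0 = 0 := by simp [hA]
    have hAsum : ∑' m, A m = ∑' m, A (m + 1) := by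
      rw [hAs.tsum_eq_zero_add, hA0, zero_add]
    have hstep2 : ∀ m, A (m + 1) - q ^ (c + 1) * t (c + 1) m =
        -q ^ (c + 1) * (t (c + 1) m - t (c + 2) m) := by
      intro m
      rw [hA']
      simp only [ht]
      rw [← add_assoc, ← add_assoc, qPoch_succ q q (m + c + 1), ← pow_succ]
      have h1 := h0 (m + c + 1 + 1)
      rw [qPoch_succ, ← pow_succ] at h1
      have h2 := right_ne_zero_of_mul h1
      have h3 := h0 (m + c + 1)
      have h4 := h0 m
      have h5 : q ^ (m + c + 1 + 1) = q ^ m * q ^ (c + 2) := by ring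
      have h6 : q ^ (m * (m + c + 1)) = q ^ (m * (m + c)) * q ^ m := by ring
      have h7 : q ^ ((m + 1) * (m + 1 + c)) = q ^ (m * (m + c)) * q ^ m * q ^ (c + 1) * q ^ m := by
        ring
      have h8 : q ^ (m * (m + c + 2)) = q ^ (m * (m + c)) * q ^ m * q ^ m := by ring
      rw [h6, h7, h8]
      field_simp
      ring
    simp only [hF]
    rw [← (hs c).tsum_sub (hs (c + 1)), tsum_congr hstep, hAs.tsum_sub ((hs _).mul_left _), hAsum,
      ← ((summable_nat_add_iff 1).2 hAs).tsum_sub ((hs _).mul_left _), tsum_congr hstep2,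
      tsum_mul_left, (hs _).tsum_sub (hs _)]
  -- Iterating the recurrence bounds F c - F (c+1) by ‖q‖^N times a bounded quantity for every N, so
  -- F is constant in c. Its value is the limit c → ∞, where only the term m = 0 survives.
  have hd : ∀ N c, ‖F c - F (c + 1)‖ ≤ ‖q‖ ^ N * ‖F (c + N) - F (c + N + 1)‖ := by
    intro N
    induction N with
    | zero => simp
    | succ N ih =>
      intro c
      refine (ih c).trans ?_
      rw [hrec (c + N), norm_mul, norm_neg, norm_pow, pow_succ ‖q‖ N, mul_assoc]
      refine mul_le_mul_of_nonneg_left (mul_le_mul_of_nonneg_right ?_ (norm_nonneg _))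
        (by positivity)
      exact pow_le_of_le_one (norm_nonneg _) hq.le (by omega)
  have hconst : ∀ c, F c = F (c + 1) := by
    intro c
    have h1 : ∀ N, ‖F c - F (c + 1)‖ ≤ ‖q‖ ^ N * (B + B) := fun N =>
      (hd N c).trans (mul_le_mul_of_nonneg_left ((norm_sub_le _ _).trans
        (add_le_add (hFB _) (hFB _))) (by positivity))
    have h2 : Tendsto (fun N => ‖q‖ ^ N * (B + B)) atTop (𝓝 0) := by
      simpa using (tendsto_pow_atTop_nhds_zero_of_lt_one (norm_nonneg _) hq).mul_const (B + B)
    have h3 := ge_of_tendsto' h2 h1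
    exact sub_eq_zero.1 (norm_le_zero_iff.1 h3)
  have hlim : Tendsto F atTop (𝓝 (∑' m : ℕ, if m = 0 then (qPochInf q q)⁻¹ else 0)) := by
    refine tendsto_tsum_of_dominated_convergence hgeo (fun m => ?_)
      (Eventually.of_forall fun c m => norm_cauchyTerm_le hq hC c m)
    have hl := ((tendsto_qPoch hq q).comp (tendsto_add_atTop_nat m)).inv₀
      (qPochInf_self_ne_zero hq)
    cases m with
    | zero => simpa [ht, Function.comp_def] using hl
    | succ m =>
      have h1 : Tendsto (fun c : ℕ => q ^ ((m + 1) * (m + 1 + c))) atTop (𝓝 0) := by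
        refine (tendsto_pow_atTop_nhds_zero_of_norm_lt_one hq).comp
          (tendsto_atTop_mono (fun c => ?_) tendsto_id)
        simp only [id]; nlinarith
      have h2 := h1.mul (hl.const_mul (qPoch q q (m + 1))⁻¹)
      rw [zero_mul] at h2
      simp only [Nat.add_eq_zero_iff, one_ne_zero, and_false, if_false]
      refine h2.congr fun c => ?_
      simp only [ht, Function.comp, mul_inv]
      rw [add_comm c]
  have hall : ∀ N, F c = F (c + N) := by
    intro N
    induction N with
    | zero => rfl
    | succ N ih => rw [ih, hconst (c + N)]; rfl
  rw [tsum_ite_eq] at hlim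
  have h1 : Tendsto (fun N => F (c + N)) atTop (𝓝 (qPochInf q q)⁻¹) := by
    simpa [add_comm, Function.comp_def] using hlim.comp (tendsto_add_atTop_nat c)
  exact tendsto_nhds_unique (tendsto_const_nhds.congr hall) h1

lemma inv_thetaFin {x q : ℂ} (hx : x ≠ 0) (hq0 : q ≠ 0) (hq : ‖q‖ < 1)
    (h : ∀ k : ℤ, 1 - x * q ^ k ≠ 0) (n : ℕ) :
    (thetaFin x q (n + 1) n)⁻¹ = ∑ k ∈ Icc (-n : ℤ) n, (-1) ^ k * q ^ tri (k + 1) *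
      (qPoch q q (n - k).toNat * qPoch q q (n + k).toNat)⁻¹ * (1 - x * q ^ k)⁻¹ := by
  have := inv_prod_thetaFin (ι := Unit) (c := fun _ => 1) hq0 hq (fun _ => one_ne_zero)
    (fun i j hij => (hij rfl).elim) hx (fun _ k => by simpa using h k) n
  simpa [thetaCoeff] using this

lemma summable_norm_tri_succ {q : ℂ} (hq0 : q ≠ 0) (hq : ‖q‖ < 1) :
    Summable fun k : ℤ => ‖(-1) ^ k * q ^ tri (k + 1)‖ := by
  refine (summable_norm_tri hq0 hq hq0).congr fun k => ?_
  rw [tri_add_one, zpow_add₀ hq0, mul_assoc]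

/-- Expand each summand in partial fractions and exchange the sums. For fixed k the inner sum runs
over n ≥ |k|; putting n = m + |k| turns it into q^(k²) times a Durfee rectangle sum of width 2|k|,
whose value does not depend on k. -/
theorem tsum_eulerian_eq_lam {x q : ℂ} (hx : x ≠ 0) (hq0 : q ≠ 0) (hq : ‖q‖ < 1)
    (h : ∀ k : ℤ, 1 - x * q ^ k ≠ 0) :
    ∑' n : ℕ, q ^ (n ^ 2) / (qPoch x q (n + 1) * qPoch (q / x) q n) =
      lam x (q ^ 2) q / qPochInf q q := by
  obtain ⟨C, hC0, hC⟩ := exists_norm_inv_qPoch_le hq (one_sub_pow_mul_ne_zero hq hq)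
  set a : ℤ → ℂ := fun k => (-1) ^ k * q ^ tri (k + 1) * (1 - x * q ^ k)⁻¹ with ha
  have has : Summable fun k => ‖a k‖ := summable_norm_mul_inv hq0 hq hx (summable_norm_tri_succ hq0 hq)
  set f : ℕ → ℤ → ℂ := fun n k => if k ∈ Icc (-n : ℤ) n then
    a k * (q ^ (n ^ 2) * (qPoch q q (n - k).toNat * qPoch q q (n + k).toNat)⁻¹) else 0 with hf
  have hterm : ∀ n : ℕ, q ^ (n ^ 2) / (qPoch x q (n + 1) * qPoch (q / x) q n) = ∑' k, f n k := by
    intro n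
    rw [div_eq_mul_inv, ← thetaFin, inv_thetaFin hx hq0 hq h, mul_sum,
      tsum_eq_sum (s := Icc (-n : ℤ) n) (fun k hk => if_neg hk)]
    refine sum_congr rfl fun k hk => ?_
    simp only [ha]
    rw [if_pos hk]
    ring
  have hfs : Summable (Function.uncurry f) := by
    have hb : Summable fun p : ℕ × ℤ => (‖q‖ ^ p.1 * (C * C)) * ‖a p.2‖ :=
      ((summable_geometric_of_lt_one (norm_nonneg _) hq).mul_right _).mul_of_nonneg has
        (fun n => by positivity) (fun k => norm_nonneg _)
    refine Summable.of_norm_bounded hb ?_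
    rintro ⟨n, k⟩
    simp only [Function.uncurry, hf]
    split_ifs
    · rw [norm_mul, mul_comm, norm_mul, norm_pow, mul_inv, norm_mul]
      refine mul_le_mul_of_nonneg_right (mul_le_mul ?_ (mul_le_mul (hC _) (hC _) (norm_nonneg _)
        hC0.le) (by positivity) (by positivity)) (norm_nonneg _)
      exact pow_le_pow_of_le_one (norm_nonneg _) hq.le (Nat.le_self_pow two_ne_zero n)
    · rw [norm_zero]; positivity
  rw [tsum_congr hterm, ← hfs.tsum_comm, lam, ← tsum_div_const]
  refine tsum_congr fun k => ?_
  have hinj : Function.Injective fun m : ℕ => m + k.natAbs := add_left_injective _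
  rw [← hinj.tsum_eq]
  · have h1 : ∀ m : ℕ, f (m + k.natAbs) k = a k * q ^ (k.natAbs ^ 2) *
        (q ^ (m * (m + 2 * k.natAbs)) * (qPoch q q m * qPoch q q (m + 2 * k.natAbs))⁻¹) := by
      intro m
      simp only [hf]
      rw [if_pos (by rw [mem_Icc]; omega)]
      have h2 : qPoch q q (↑(m + k.natAbs) - k).toNat * qPoch q q (↑(m + k.natAbs) + k).toNat =
          qPoch q q m * qPoch q q (m + 2 * k.natAbs) := by
        rcases le_total 0 k with hk | hk
        · rw [show (↑(m + k.natAbs) - k).toNat = m by omega,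
            show (↑(m + k.natAbs) + k).toNat = m + 2 * k.natAbs by omega]
        · rw [show (↑(m + k.natAbs) + k).toNat = m by omega,
            show (↑(m + k.natAbs) - k).toNat = m + 2 * k.natAbs by omega, mul_comm]
      rw [h2]
      ring
    rw [tsum_congr h1, tsum_mul_left, tsum_durfee hq]
    simp only [ha]
    have h3 : q ^ tri (k + 1) * q ^ (k.natAbs ^ 2) = q ^ (3 * tri k) * (q ^ 2) ^ k := by
      rw [← zpow_natCast q (k.natAbs ^ 2), ← zpow_natCast q 2, ← zpow_mul, ← zpow_add₀ hq0,
        ← zpow_add₀ hq0]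
      congr 1
      push_cast
      rw [sq_abs, tri_add_one]
      linarith [two_mul_tri k]
    rw [div_eq_mul_inv]
    linear_combination ((-1) ^ k * (1 - x * q ^ k)⁻¹ * (qPochInf q q)⁻¹) * h3
  · intro n hn
    simp only [Function.mem_support, hf, ne_eq, ite_eq_right_iff, Classical.not_imp, mem_Icc] at hn
    exact ⟨n - k.natAbs, by simp only; omega⟩

/-- The step from y = q² to y = q³ costs the pentagonal series (q;q)_∞. After division this is
precisely the -1, and x⁻¹ is the other normalisation, in the definition of g. -/
theorem gMock_eq_lam {x q : ℂ} (hx : x ≠ 0) (hq0 : q ≠ 0) (hq : ‖q‖ < 1)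
    (h : ∀ k : ℤ, 1 - x * q ^ k ≠ 0) : gMock x q = lam x (q ^ 3) q / qPochInf q q := by
  have h1 := lam_sub_mul_lam hq0 hq hx (pow_ne_zero 2 hq0) h
  rw [tsum_pentagonal_two hq0 hq, ← pow_succ'] at h1
  have h2 := qPochInf_self_ne_zero hq
  rw [gMock, tsum_eulerian_eq_lam hx hq0 hq h, ← h1]
  rw [← h1] at h2
  field_simp
  ring

/-! ### Theta functional equations, infinite partial fractions, the addition formula -/

lemma one_sub_pow_mul_ne_zero_of_zpow {x q : ℂ} (h : ∀ k : ℤ, 1 - x * q ^ k ≠ 0) (i : ℕ) :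
    1 - q ^ i * x ≠ 0 := by
  simpa [mul_comm] using h i

lemma one_sub_pow_mul_div_ne_zero {x q : ℂ} (hx : x ≠ 0) (hq0 : q ≠ 0)
    (h : ∀ k : ℤ, 1 - x * q ^ k ≠ 0) (i : ℕ) : 1 - q ^ i * (q / x) ≠ 0 := by
  intro hi
  apply h (-(i + 1 : ℕ))
  rw [zpow_neg, zpow_natCast, pow_succ]
  have h1 : x = q ^ i * q := by
    have := sub_eq_zero.1 hi
    field_simp at this
    rw [this]
  rw [h1, mul_inv_cancel₀ (mul_ne_zero (pow_ne_zero _ hq0) hq0), sub_self]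

lemma theta_ne_zero {x q : ℂ} (hx : x ≠ 0) (hq0 : q ≠ 0) (hq : ‖q‖ < 1)
    (h : ∀ k : ℤ, 1 - x * q ^ k ≠ 0) : qPochInf x q * qPochInf (q / x) q ≠ 0 :=
  mul_ne_zero (qPochInf_ne_zero hq (one_sub_pow_mul_ne_zero_of_zpow h))
    (qPochInf_ne_zero hq (one_sub_pow_mul_div_ne_zero hx hq0 h))

lemma jTheta_ne_zero {x q : ℂ} (hx : x ≠ 0) (hq0 : q ≠ 0) (hq : ‖q‖ < 1)
    (h : ∀ k : ℤ, 1 - x * q ^ k ≠ 0) : jTheta x q ≠ 0 :=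
  mul_ne_zero (theta_ne_zero hx hq0 hq h) (qPochInf_self_ne_zero hq)

lemma jTheta_inv {x q : ℂ} (hx : x ≠ 0) (hq : ‖q‖ < 1) :
    jTheta x⁻¹ q = -x⁻¹ * jTheta x q := by
  rw [jTheta, jTheta, qPochInf_eq hq x⁻¹, qPochInf_eq hq x, div_inv_eq_mul, div_eq_mul_inv]
  field_simp
  ring

lemma jTheta_mul_q {x q : ℂ} (hx : x ≠ 0) (hq0 : q ≠ 0) (hq : ‖q‖ < 1) :
    jTheta (x * q) q = -x⁻¹ * jTheta x q := by
  rw [jTheta, jTheta, qPochInf_eq hq x, show q / (x * q) = x⁻¹ by field_simp,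
    qPochInf_eq hq x⁻¹, mul_comm x q, ← div_eq_mul_inv]
  field_simp
  ring

lemma jTheta_q_div {x q : ℂ} (hx : x ≠ 0) (hq0 : q ≠ 0) : jTheta (q / x) q = jTheta x q := by
  rw [jTheta, jTheta, show q / (q / x) = x by field_simp]
  ring

lemma exists_norm_inv_thetaFin_le {x q : ℂ} (hx : x ≠ 0) (hq0 : q ≠ 0) (hq : ‖q‖ < 1)
    (h : ∀ k : ℤ, 1 - x * q ^ k ≠ 0) : ∃ C : ℝ, ∀ a b, ‖(thetaFin x q a b)⁻¹‖ ≤ C := by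
  obtain ⟨C, hC0, hC⟩ := exists_norm_inv_qPoch_le hq (one_sub_pow_mul_ne_zero_of_zpow h)
  obtain ⟨D, hD0, hD⟩ := exists_norm_inv_qPoch_le hq (one_sub_pow_mul_div_ne_zero hx hq0 h)
  refine ⟨C * D, fun a b => ?_⟩
  rw [thetaFin, mul_inv, norm_mul]
  exact mul_le_mul (hC _) (hD _) (norm_nonneg _) hC0.le

/-- Partial fraction expansion of the reciprocal of a product of theta functions. -/
theorem inv_prod_theta {ι : Type*} [Fintype ι] [Nonempty ι] [DecidableEq ι] {c : ι → ℂ} {q z : ℂ}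
    (hq0 : q ≠ 0) (hq : ‖q‖ < 1) (hc : ∀ i, c i ≠ 0)
    (hcc : ∀ i j, i ≠ j → ∀ k : ℤ, c i ≠ c j * q ^ k) (hz0 : z ≠ 0)
    (hz : ∀ i (k : ℤ), 1 - z * c i * q ^ k ≠ 0) :
    (∏ i, (qPochInf (z * c i) q * qPochInf (q / (z * c i)) q))⁻¹ =
      ∑ i, (∑' k : ℤ, (-1) ^ k * q ^ tri (k + 1) *
        (∏ j ∈ univ.erase i, (-(c i / c j)) ^ k * q ^ tri (k + 1)) * (1 - z * c i * q ^ k)⁻¹) *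
        ((qPochInf q q * qPochInf q q)⁻¹ * ∏ j ∈ univ.erase i,
          (qPochInf (c j / c i) q * qPochInf (q / (c j / c i)) q)⁻¹) := by
  have hji : ∀ i j, j ≠ i → ∀ k : ℤ, 1 - c j / c i * q ^ k ≠ 0 := by
    intro i j hij k h
    apply hcc i j (Ne.symm hij) k
    have := sub_eq_zero.1 h
    have hci := hc i
    field_simp at this
    exact this
  -- Both sides are limits as n → ∞ of the finite expansion `inv_prod_thetaFin`; Tannery's theorem
  -- applies to each of the finitely many families of poles.
  have hlim := (tendsto_finsetProd univ fun i _ =>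
    tendsto_thetaFin hq (z * c i) (tendsto_add_atTop_nat 1) tendsto_id).inv₀
      (prod_ne_zero_iff.2 fun i _ => theta_ne_zero (mul_ne_zero hz0 (hc i)) hq0 hq (hz i))
  simp only [id] at hlim
  refine tendsto_nhds_unique hlim ?_
  simp_rw [inv_prod_thetaFin hq0 hq hc hcc hz0 hz]
  refine tendsto_finsetSum _ fun i _ => ?_
  rw [← tsum_mul_right]
  obtain ⟨C, hC0, hC⟩ := exists_norm_inv_qPoch_le hq (one_sub_pow_mul_ne_zero hq hq)
  have hD : ∀ j, ∃ D : ℝ, j ≠ i → ∀ a b, ‖(thetaFin (c j / c i) q a b)⁻¹‖ ≤ D := by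
    intro j
    by_cases hj : j = i
    · exact ⟨0, fun h => (h hj).elim⟩
    · obtain ⟨D, hD⟩ := exists_norm_inv_thetaFin_le (div_ne_zero (hc j) (hc i)) hq0 hq (hji i j hj)
      exact ⟨D, fun _ => hD⟩
  choose D hD using hD
  have hsum : Summable fun k : ℤ => ‖(-1) ^ k * q ^ tri (k + 1) *
      (∏ j ∈ univ.erase i, (-(c i / c j)) ^ k * q ^ tri (k + 1)) * (1 - z * c i * q ^ k)⁻¹‖ := by
    refine summable_norm_mul_inv hq0 hq (mul_ne_zero hz0 (hc i)) ?_
    have hy : q ^ Fintype.card ι * ∏ j ∈ univ.erase i, (-(c i / c j)) ≠ 0 :=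
      mul_ne_zero (pow_ne_zero _ hq0) (prod_ne_zero_iff.2 fun j _ =>
        neg_ne_zero.2 (div_ne_zero (hc i) (hc j)))
    refine (summable_norm_zpow_tri hq0 hq hy (s := Fintype.card ι) Fintype.card_ne_zero).congr
      fun k => congrArg _ ?_
    rw [prod_mul_distrib, prod_const, card_erase_of_mem (mem_univ i), card_univ, mul_zpow,
      ← prod_zpow]
    have h1 : q ^ tri (k + 1) * (q ^ tri (k + 1)) ^ (Fintype.card ι - 1) =
        q ^ (Fintype.card ι * tri k) * (q ^ Fintype.card ι) ^ k := by
      rw [← pow_succ', Nat.sub_add_cancel Fintype.card_pos, ← zpow_natCast, ← zpow_mul,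
        ← zpow_natCast q, ← zpow_mul, ← zpow_add₀ hq0, tri_add_one]
      congr 1; ring
    linear_combination (-(-1) ^ k * ∏ j ∈ univ.erase i, (-(c i / c j)) ^ k) * h1
  have := tendsto_sum_Icc_mul (w := fun _ => (qPochInf q q * qPochInf q q)⁻¹ *
      ∏ j ∈ univ.erase i, (qPochInf (c j / c i) q * qPochInf (q / (c j / c i)) q)⁻¹)
    (W := fun n k => (qPoch q q (n - k).toNat * qPoch q q (n + k).toNat)⁻¹ *
      ∏ j ∈ univ.erase i, (thetaFin (c j / c i) q (n + 1 - k).toNat (n + k).toNat)⁻¹)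
    (C := (C * C) * ∏ j ∈ univ.erase i, D j) hsum ?_ ?_
  · refine this.congr fun n => sum_congr rfl fun k _ => ?_
    rw [thetaCoeff, prod_mul_distrib (g := fun j =>
      (thetaFin (c j / c i) q (n + 1 - k).toNat (n + k).toNat)⁻¹)]
    ring
  · intro n k _
    rw [norm_mul, mul_inv, norm_mul, norm_prod]
    refine mul_le_mul (mul_le_mul (hC _) (hC _) (norm_nonneg _) hC0.le)
      (prod_le_prod (fun _ _ => norm_nonneg _) fun j hj => hD j (ne_of_mem_erase hj) _ _)
      (prod_nonneg fun _ _ => norm_nonneg _) (by positivity)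
  · intro k
    refine (tendsto_inv_qPoch_mul hq k).mul (tendsto_finsetProd _ fun j hj => ?_)
    have hj' := ne_of_mem_erase hj
    refine (tendsto_thetaFin hq _ ?_ (tendsto_toNat_add_atTop k)).inv₀
      (theta_ne_zero (div_ne_zero (hc j) (hc i)) hq0 hq (hji i j hj'))
    simpa [sub_eq_add_neg, add_assoc] using tendsto_toNat_add_atTop (1 - k)

/-- The addition formula for level three Lambert series. -/
theorem lam_add_lam {x Z q : ℂ} (hq0 : q ≠ 0) (hq : ‖q‖ < 1) (hx0 : x ≠ 0) (hZ0 : Z ≠ 0)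
    (hZ : ∀ k : ℤ, 1 - Z * q ^ k ≠ 0) (hZ2 : ∀ k : ℤ, 1 - Z ^ 2 * q ^ k ≠ 0)
    (h1 : ∀ k : ℤ, 1 - x / Z * q ^ k ≠ 0) (h2 : ∀ k : ℤ, 1 - x * q ^ k ≠ 0)
    (h3 : ∀ k : ℤ, 1 - x * Z * q ^ k ≠ 0) :
    lam (x / Z) (q ^ 3 / Z ^ 3) q + Z ^ 3 * lam (x * Z) (q ^ 3 * Z ^ 3) q =
      Z * (jTheta (Z ^ 2) q / jTheta Z q) * lam x (q ^ 3) q +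
        qPochInf q q ^ 3 * (jTheta Z q * jTheta (Z ^ 2) q) /
          (jTheta (x / Z) q * jTheta x q * jTheta (x * Z) q) := by
  have hcc : ∀ i j : Fin 3, i ≠ j → ∀ k : ℤ, ![Z⁻¹, 1, Z] i ≠ ![Z⁻¹, 1, Z] j * q ^ k := by
    have e1 : ∀ k : ℤ, 1 ≠ Z * q ^ k := fun k h => hZ k (by rw [← h, sub_self])
    have e2 : ∀ k : ℤ, 1 ≠ Z ^ 2 * q ^ k := fun k h => hZ2 k (by rw [← h, sub_self])
    have e3 : ∀ k : ℤ, q ^ k ≠ Z := fun k h => e1 (-k) (by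
      rw [← h, ← zpow_add₀ hq0, add_neg_cancel, zpow_zero])
    have e4 : ∀ k : ℤ, q ^ k ≠ Z ^ 2 := fun k h => e2 (-k) (by
      rw [← h, ← zpow_add₀ hq0, add_neg_cancel, zpow_zero])
    intro i j hij k
    fin_cases i <;> fin_cases j <;> simp at hij ⊢ <;> intro h
    · field_simp at h; exact e1 k (by rw [← h])
    · field_simp at h; exact e2 k (by rw [← h])
    · field_simp at h; exact e3 k h.symm
    · exact e1 k h
    · field_simp at h; exact e4 k h.symm
    · exact e3 k h.symm
  -- Three families of poles, for 1/(j(x/Z) j(x) j(xZ)). Each contributes one `lam` with a constant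
  -- theta coefficient; clearing these coefficients gives the addition formula.
  have key := inv_prod_theta (ι := Fin 3) (c := ![Z⁻¹, 1, Z]) (z := x) hq0 hq
    (by intro i; fin_cases i <;> simp [hZ0]) hcc hx0 (by
      intro i
      fin_cases i
      · simpa [div_eq_mul_inv] using h1
      · simpa using h2
      · simpa using h3)
  have u0 : univ.erase (0 : Fin 3) = {1, 2} := by decide
  have u1 : univ.erase (1 : Fin 3) = {0, 2} := by decide
  have u2 : univ.erase (2 : Fin 3) = {0, 1} := by decide
  have d12 : (1 : Fin 3) ≠ 2 := by decide
  have d02 : (0 : Fin 3) ≠ 2 := by decide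
  have d01 : (0 : Fin 3) ≠ 1 := by decide
  rw [Fin.sum_univ_three, Fin.prod_univ_three, u0, u1, u2] at key
  simp only [prod_pair d12, prod_pair d02, prod_pair d01] at key
  simp only [Matrix.cons_val_zero, Matrix.cons_val_one, Matrix.cons_val] at key
  have hJ := qPochInf_self_ne_zero hq
  have hth : ∀ y, qPochInf y q * qPochInf (q / y) q = jTheta y q / qPochInf q q := by
    intro y; rw [jTheta]; field_simp
  simp only [hth] at key
  have t3 : ∀ k : ℤ, q ^ (3 * tri k) * (q ^ 3) ^ k =
      q ^ tri (k + 1) * (q ^ tri (k + 1) * q ^ tri (k + 1)) := by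
    intro k
    rw [← zpow_add₀ hq0, ← zpow_add₀ hq0, ← zpow_natCast q 3, ← zpow_mul, ← zpow_add₀ hq0,
      tri_add_one]
    congr 1; push_cast; ring
  have hm : ∀ k : ℤ, (-1 : ℂ) ^ k * (-1) ^ k = 1 := fun k => by rw [← mul_zpow]; norm_num
  have s1 : ∑' k : ℤ, (-1) ^ k * q ^ tri (k + 1) * ((-(Z⁻¹ / 1)) ^ k * q ^ tri (k + 1) *
      ((-(Z⁻¹ / Z)) ^ k * q ^ tri (k + 1))) * (1 - x * Z⁻¹ * q ^ k)⁻¹ =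
      lam (x / Z) (q ^ 3 / Z ^ 3) q := by
    refine tsum_congr fun k => ?_
    rw [div_zpow, show -(Z⁻¹ / 1) = -1 * Z⁻¹ by ring, show -(Z⁻¹ / Z) = -1 * (Z⁻¹ * Z⁻¹) by
      field_simp, mul_zpow, mul_zpow (-1 : ℂ) (Z⁻¹ * Z⁻¹), mul_zpow, div_eq_mul_inv x,
      show ((Z ^ 3) ^ k) = Z ^ k * Z ^ k * Z ^ k by rw [← mul_zpow, ← mul_zpow]; ring_nf,
      inv_zpow]
    have := zpow_ne_zero k hZ0
    rw [show (-1 : ℂ) ^ k * q ^ (3 * tri k) * ((q ^ 3) ^ k / (Z ^ k * Z ^ k * Z ^ k)) =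
      (-1 : ℂ) ^ k * (q ^ (3 * tri k) * (q ^ 3) ^ k) / (Z ^ k * Z ^ k * Z ^ k) by ring, t3]
    generalize (1 - x * Z⁻¹ * q ^ k)⁻¹ = d
    field_simp
    linear_combination d * hm k
  have s2 : ∑' k : ℤ, (-1) ^ k * q ^ tri (k + 1) * ((-(1 / Z⁻¹)) ^ k * q ^ tri (k + 1) *
      ((-(1 / Z)) ^ k * q ^ tri (k + 1))) * (1 - x * 1 * q ^ k)⁻¹ = lam x (q ^ 3) q := by
    refine tsum_congr fun k => ?_
    rw [mul_assoc ((-1 : ℂ) ^ k) (q ^ (3 * tri k)), t3, show -(1 / Z⁻¹) = -1 * Z by simp,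
      show -(1 / Z) = -1 * Z⁻¹ by field_simp, mul_zpow, mul_zpow (-1 : ℂ) Z⁻¹, inv_zpow]
    have := zpow_ne_zero k hZ0
    rw [mul_one]
    generalize (1 - x * q ^ k)⁻¹ = d
    field_simp
    linear_combination d * hm k
  have s3 : ∑' k : ℤ, (-1) ^ k * q ^ tri (k + 1) * ((-(Z / Z⁻¹)) ^ k * q ^ tri (k + 1) *
      ((-(Z / 1)) ^ k * q ^ tri (k + 1))) * (1 - x * Z * q ^ k)⁻¹ =
      lam (x * Z) (q ^ 3 * Z ^ 3) q := by
    refine tsum_congr fun k => ?_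
    rw [mul_zpow (q ^ 3), ← mul_assoc _ ((q ^ 3) ^ k), mul_assoc ((-1 : ℂ) ^ k) (q ^ (3 * tri k)),
      t3, show -(Z / Z⁻¹) = -1 * (Z * Z) by field_simp, show -(Z / 1) = -1 * Z by ring,
      mul_zpow, mul_zpow (-1 : ℂ) Z, mul_zpow Z Z,
      show ((Z ^ 3) ^ k) = Z ^ k * Z ^ k * Z ^ k by rw [← mul_zpow, ← mul_zpow]; ring_nf]
    have := zpow_ne_zero k hZ0
    linear_combination ((-1) ^ k * q ^ tri (k + 1) * (Z ^ k * Z ^ k * q ^ tri (k + 1) *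
      (Z ^ k * q ^ tri (k + 1))) * (1 - x * Z * q ^ k)⁻¹) * hm k
  rw [s1, s2, s3] at key
  have a1 : 1 / Z⁻¹ = Z := by simp
  have a2 : Z / Z⁻¹ = Z ^ 2 := by field_simp
  have a3 : Z⁻¹ / Z = (Z ^ 2)⁻¹ := by field_simp
  rw [a1, a2, a3, div_one, div_one, one_div, jTheta_inv hZ0 hq,
    jTheta_inv (pow_ne_zero 2 hZ0) hq, mul_one, ← div_eq_mul_inv x Z] at key
  have n1 := jTheta_ne_zero hZ0 hq0 hq hZ
  have n2 := jTheta_ne_zero (pow_ne_zero 2 hZ0) hq0 hq hZ2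
  have n3 := jTheta_ne_zero (div_ne_zero hx0 hZ0) hq0 hq h1
  have n4 := jTheta_ne_zero hx0 hq0 hq h2
  have n5 := jTheta_ne_zero (mul_ne_zero hx0 hZ0) hq0 hq h3
  generalize jTheta (x / Z) q = A at *
  generalize jTheta (x * Z) q = B at *
  generalize jTheta x q = D at *
  generalize jTheta Z q = E at *
  generalize jTheta (Z ^ 2) q = F at *
  generalize qPochInf q q = J at *
  generalize lam (x / Z) (q ^ 3 / Z ^ 3) q = L1 at *
  generalize lam x (q ^ 3) q = L2 at *
  generalize lam (x * Z) (q ^ 3 * Z ^ 3) q = L3 at *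
  field_simp at key ⊢
  linear_combination -key

/-! ### Logarithmic derivatives of theta functions and the Weierstrass relation -/

lemma differentiable_qPochInf {q : ℂ} (hq : ‖q‖ < 1) : Differentiable ℂ fun x => qPochInf x q := by
  have h : MultipliableLocallyUniformlyOn (fun (n : ℕ) (x : ℂ) => 1 - q ^ n * x) Set.univ := by
    use fun x => ∏' n : ℕ, (1 - q ^ n * x)
    simp_rw [sub_eq_add_neg]
    apply hasProdLocallyUniformlyOn_of_forall_compact isOpen_univ
    intro K _ hcK
    obtain ⟨R, hR⟩ := hcK.isBounded.exists_norm_le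
    refine ((summable_geometric_of_lt_one (norm_nonneg _) hq).mul_right R)
      |>.hasProdUniformlyOn_nat_one_add hcK (.of_forall fun n x hx => ?_) (fun _ => by fun_prop)
    rw [norm_neg, norm_mul, norm_pow]
    exact mul_le_mul_of_nonneg_left (hR x hx) (by positivity)
  have := h.hasProdLocallyUniformlyOn.differentiableOn
    (.of_forall fun _ => by simpa [Finset.prod_fn] using
      DifferentiableOn.finsetProd (fun _ _ => by fun_prop)) isOpen_univ
  exact differentiableOn_univ.1 this

lemma differentiableAt_jTheta {x q : ℂ} (hx : x ≠ 0) (hq : ‖q‖ < 1) :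
    DifferentiableAt ℂ (fun y => jTheta y q) x := by
  have h1 := differentiable_qPochInf hq
  have h2 : DifferentiableAt ℂ (fun y => qPochInf (q / y) q) x :=
    (h1 (q / x)).comp x (by fun_prop (disch := exact hx))
  exact ((h1 x).mul h2).mul_const _

/-- The cofactor `(q w; q)_∞ (q / w; q)_∞ (q; q)_∞` of `1 - w` in `j(w; q)`. -/
noncomputable def jReduced (w q : ℂ) : ℂ :=
  qPochInf (q * w) q * qPochInf (q / w) q * qPochInf q q

lemma jTheta_eq_mul_jReduced {q : ℂ} (hq : ‖q‖ < 1) (w : ℂ) :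
    jTheta w q = (1 - w) * jReduced w q := by
  rw [jTheta, jReduced, qPochInf_eq hq w]
  ring

lemma jReduced_one (q : ℂ) : jReduced 1 q = qPochInf q q ^ 3 := by
  rw [jReduced, mul_one, div_one]; ring

/-- The cofactor is invariant under w ↦ 1/w, so w = 1 is critical; the contributions of q w and q /
w cancel. -/
lemma hasDerivAt_jReduced_one {q : ℂ} (hq : ‖q‖ < 1) :
    HasDerivAt (fun w => jReduced w q) 0 1 := by
  have h1 : ∀ t, t = q → HasDerivAt (fun x => qPochInf x q) (deriv (fun x => qPochInf x q) q) t := by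
    rintro _ rfl
    exact (differentiable_qPochInf hq _).hasDerivAt
  have h2 : HasDerivAt (fun w : ℂ => q * w) q 1 := by
    simpa using (hasDerivAt_id (1 : ℂ)).const_mul q
  have h3 : HasDerivAt (fun w : ℂ => q / w) (-q) 1 := by
    simpa [div_eq_mul_inv] using (hasDerivAt_inv (one_ne_zero (α := ℂ))).const_mul q
  have h4 := HasDerivAt.comp (1 : ℂ) (h1 (q * 1) (mul_one q)) h2
  have h5 := HasDerivAt.comp (1 : ℂ) (h1 (q / 1) (div_one q)) h3
  refine ((h4.mul h5).mul_const (qPochInf q q)).congr_deriv ?_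
  simp only [Function.comp_apply, mul_one, div_one]
  ring

lemma hasDerivAt_jTheta_one {q : ℂ} (hq : ‖q‖ < 1) :
    HasDerivAt (fun w => jTheta w q) (-qPochInf q q ^ 3) 1 := by
  have h := ((hasDerivAt_id (1 : ℂ)).const_sub 1).mul (hasDerivAt_jReduced_one hq)
  refine (h.congr_of_eventuallyEq (Eventually.of_forall fun w => ?_)).congr_deriv ?_
  · exact jTheta_eq_mul_jReduced hq w
  · simp [jReduced_one]

lemma jTheta_one {q : ℂ} (hq : ‖q‖ < 1) : jTheta 1 q = 0 := by
  rw [jTheta_eq_mul_jReduced hq]; ring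

/-- The logarithmic derivative `x j'(x) / j(x)` of the theta function. -/
noncomputable def ell (x q : ℂ) : ℂ := x * deriv (fun y => jTheta y q) x / jTheta x q

lemma hasDerivAt_jTheta {x q : ℂ} (hx : x ≠ 0) (hq : ‖q‖ < 1) (hj : jTheta x q ≠ 0) :
    HasDerivAt (fun y => jTheta y q) (ell x q / x * jTheta x q) x := by
  refine (differentiableAt_jTheta hx hq).hasDerivAt.congr_deriv ?_
  unfold ell
  field_simp

lemma hasDerivAt_jTheta_mul {x c q : ℂ} (hx : x ≠ 0) (hc : c ≠ 0) (hq : ‖q‖ < 1)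
    (hj : jTheta (c * x) q ≠ 0) :
    HasDerivAt (fun y => jTheta (c * y) q) (ell (c * x) q / x * jTheta (c * x) q) x := by
  have h := HasDerivAt.comp x (hasDerivAt_jTheta (mul_ne_zero hc hx) hq hj)
    ((hasDerivAt_id x).const_mul c)
  refine h.congr_deriv ?_
  field_simp

lemma hasDerivAt_jTheta_div {x c q : ℂ} (hx : x ≠ 0) (hc : c ≠ 0) (hq : ‖q‖ < 1)
    (hj : jTheta (c / x) q ≠ 0) :
    HasDerivAt (fun y => jTheta (c / y) q) (-(ell (c / x) q / x * jTheta (c / x) q)) x := by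
  have h := HasDerivAt.comp x (hasDerivAt_jTheta (div_ne_zero hc hx) hq hj)
    ((hasDerivAt_inv hx).const_mul c)
  refine h.congr_deriv ?_
  field_simp

/-- Differentiate the functional equation and divide by it. Only b = 0 (reflection in q) and b = -1
(inversion) are used. -/
lemma ell_div {x c q : ℂ} (hx : x ≠ 0) (hc : c ≠ 0) (hq : ‖q‖ < 1) (hj : jTheta x q ≠ 0) {a b : ℂ}
    (ha : a ≠ 0) (hj' : jTheta (c / x) q ≠ 0)
    (h : ∀ y, y ≠ 0 → jTheta (c / y) q = a * y ^ b * jTheta y q) (hb : b = 0 ∨ b = -1) :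
    ell (c / x) q = -b - ell x q := by
  have h1 := hasDerivAt_jTheta_div hx hc hq hj'
  have hev : (fun y => jTheta (c / y) q) =ᶠ[𝓝 x] fun y => a * y ^ b * jTheta y q := by
    filter_upwards [isOpen_ne.mem_nhds hx] with y hy using h y hy
  have h0 := h x hx
  rcases hb with rfl | rfl
  · simp only [Complex.cpow_zero, mul_one] at h0 hev
    have h2 := ((hasDerivAt_jTheta hx hq hj).const_mul a).congr_of_eventuallyEq hev
    have h3 := h1.unique h2
    rw [h0] at h3
    field_simp at h3
    linear_combination -h3
  · simp only [Complex.cpow_neg_one] at h0 hev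
    have h2 := (((hasDerivAt_inv hx).const_mul a).mul
      (hasDerivAt_jTheta hx hq hj)).congr_of_eventuallyEq hev
    have h3 := h1.unique h2
    rw [h0] at h3
    field_simp at h3
    linear_combination -h3

lemma ell_inv {x q : ℂ} (hx : x ≠ 0) (hq : ‖q‖ < 1) (hj : jTheta x q ≠ 0) :
    ell x⁻¹ q = 1 - ell x q := by
  have h := ell_div (c := 1) hx one_ne_zero hq hj (a := -1) (b := -1) (by norm_num)
    (by rw [one_div, jTheta_inv hx hq]; exact mul_ne_zero (neg_ne_zero.2 (inv_ne_zero hx)) hj)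
    (fun y hy => by rw [one_div, jTheta_inv hy hq, Complex.cpow_neg_one]; ring) (Or.inr rfl)
  rw [one_div] at h
  rw [h]; ring

lemma ell_q_div {x q : ℂ} (hx : x ≠ 0) (hq0 : q ≠ 0) (hq : ‖q‖ < 1) (hj : jTheta x q ≠ 0) :
    ell (q / x) q = -ell x q := by
  have h := ell_div (c := q) hx hq0 hq hj (a := 1) (b := 0) (by norm_num)
    (by rwa [jTheta_q_div hx hq0])
    (fun y hy => by rw [jTheta_q_div hy hq0]; simp) (Or.inl rfl)
  rw [h]; ring

lemma ell_q_mul {x q : ℂ} (hx : x ≠ 0) (hq0 : q ≠ 0) (hq : ‖q‖ < 1) (hj : jTheta x q ≠ 0) :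
    ell (q * x) q = ell x q - 1 := by
  have h := ell_q_div (inv_ne_zero hx) hq0 hq (by
    rw [jTheta_inv hx hq]; exact mul_ne_zero (neg_ne_zero.2 (inv_ne_zero hx)) hj)
  rw [ell_inv hx hq hj, div_inv_eq_mul] at h
  rw [h]; ring

/-- The even component `∑ q ^ (i ^ 2) x ^ (2 i)`. -/
noncomputable def thetaA (x q : ℂ) : ℂ := ∑' i : ℤ, q ^ (i ^ 2) * x ^ (2 * i)

/-- The odd component `∑ q ^ (i ^ 2 - i) x ^ (2 i - 1)`. -/
noncomputable def thetaB (x q : ℂ) : ℂ := ∑' i : ℤ, q ^ (i ^ 2 - i) * x ^ (2 * i - 1)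

lemma summable_norm_sq {x q : ℂ} (hx : x ≠ 0) (hq0 : q ≠ 0) (hq : ‖q‖ < 1) (c e : ℤ) :
    Summable fun i : ℤ => ‖q ^ (i ^ 2 + c * i) * x ^ (2 * i + e)‖ := by
  have hy : -(q ^ (1 + c) * x ^ 2) ≠ 0 :=
    neg_ne_zero.2 (mul_ne_zero (zpow_ne_zero _ hq0) (pow_ne_zero _ hx))
  refine ((summable_norm_zpow_tri hq0 hq hy two_ne_zero).mul_right ‖x ^ e‖).congr fun i => ?_
  rw [← norm_mul, neg_eq_neg_one_mul (q ^ (1 + c) * x ^ 2), mul_zpow, mul_zpow]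
  have h1 : (-1 : ℂ) ^ i * (-1) ^ i = 1 := by rw [← mul_zpow]; norm_num
  have h2 : q ^ (i ^ 2 + c * i) = q ^ ((2 : ℕ) * tri i) * (q ^ (1 + c)) ^ i := by
    rw [← zpow_mul, ← zpow_add₀ hq0]
    congr 1
    push_cast
    rw [two_mul_tri]; ring
  have h3 : x ^ (2 * i) = (x ^ 2) ^ i := by rw [zpow_mul]; norm_cast
  rw [h2, zpow_add₀ hx, h3]
  congr 1
  linear_combination (q ^ ((2 : ℕ) * tri i) * (q ^ (1 + c)) ^ i * (x ^ 2) ^ i * x ^ e) * h1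

/-- Multiply the two triple product series and sort index pairs (m, n) by the parity of m + n. In
the coordinates (m + n)/2 and (m - n)/2, adjusted by halves when odd, the variables x and y
separate. The resulting 2 × 2 determinant makes the Weierstrass relation a Plücker relation. -/
theorem jTheta_mul_jTheta {x y q : ℂ} (hx : x ≠ 0) (hy : y ≠ 0) (hq0 : q ≠ 0) (hq : ‖q‖ < 1) :
    jTheta (x * y) q * jTheta (x / y) q =
      x * (thetaB x q * thetaA y q - thetaA x q * thetaB y q) := by
  have hs1 := summable_norm_tri hq0 hq (mul_ne_zero hx hy)
  have hs2 := summable_norm_tri hq0 hq (div_ne_zero hx hy)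
  rw [jTheta_eq_tsum (mul_ne_zero hx hy) hq0 hq, jTheta_eq_tsum (div_ne_zero hx hy) hq0 hq,
    tsum_mul_tsum_of_summable_norm hs1 hs2]
  have hA : ∀ z : ℂ, z ≠ 0 → Summable fun i : ℤ => ‖q ^ (i ^ 2) * z ^ (2 * i)‖ := fun z hz => by
    simpa using summable_norm_sq hz hq0 hq 0 0
  have hB : ∀ z : ℂ, z ≠ 0 → Summable fun i : ℤ => ‖q ^ (i ^ 2 - i) * z ^ (2 * i - 1)‖ :=
    fun z hz => by simpa [sub_eq_add_neg] using summable_norm_sq hz hq0 hq (-1) (-1)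
  have hBA : HasSum (fun p : ℤ × ℤ => x * ((q ^ (p.1 ^ 2 - p.1) * x ^ (2 * p.1 - 1)) *
      (q ^ (p.2 ^ 2) * y ^ (2 * p.2)))) (x * (thetaB x q * thetaA y q)) := by
    refine HasSum.mul_left x ?_
    rw [thetaB, thetaA, tsum_mul_tsum_of_summable_norm (hB x hx) (hA y hy)]
    exact (summable_mul_of_summable_norm (hB x hx) (hA y hy)).hasSum
  have hAB : HasSum (fun p : ℤ × ℤ => -x * ((q ^ (p.1 ^ 2) * x ^ (2 * p.1)) *
      (q ^ (p.2 ^ 2 - p.2) * y ^ (2 * p.2 - 1)))) (-x * (thetaA x q * thetaB y q)) := by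
    refine HasSum.mul_left (-x) ?_
    rw [thetaB, thetaA, tsum_mul_tsum_of_summable_norm (hA x hx) (hB y hy)]
    exact (summable_mul_of_summable_norm (hA x hx) (hB y hy)).hasSum
  set e : ℤ × ℤ → ℤ × ℤ := fun p => (p.1 + p.2, p.1 - p.2) with he
  set o : ℤ × ℤ → ℤ × ℤ := fun p => (p.1 + p.2, p.1 - p.2 + 1) with ho
  have hei : Function.Injective e := by
    rintro ⟨a, b⟩ ⟨c, d⟩ h
    simp only [he, Prod.mk.injEq] at h ⊢
    omega
  have hoi : Function.Injective o := by
    rintro ⟨a, b⟩ ⟨c, d⟩ h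
    simp only [ho, Prod.mk.injEq] at h ⊢
    omega
  have hcompl : IsCompl (Set.range e) (Set.range o) := by
    constructor
    · rw [Set.disjoint_left]
      rintro _ ⟨⟨a, b⟩, rfl⟩ ⟨⟨c, d⟩, h⟩
      simp only [he, ho, Prod.mk.injEq] at h
      omega
    · rw [codisjoint_iff, Set.top_eq_univ, Set.eq_univ_iff_forall]
      rintro ⟨m, n⟩
      rcases Int.even_or_odd' (m + n) with ⟨k, hk | hk⟩
      · exact Or.inl ⟨(k, m - k), by simp only [he, Prod.mk.injEq]; omega⟩
      · exact Or.inr ⟨(k, m - k), by simp only [ho, Prod.mk.injEq]; omega⟩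
  have hmm : ∀ k : ℤ, (-1 : ℂ) ^ (2 * k) = 1 := fun k => by rw [zpow_mul]; norm_num
  obtain ⟨F, hF⟩ : ∃ F : ℤ × ℤ → ℂ, F = fun z => (-1) ^ z.1 * q ^ tri z.1 * (x * y) ^ z.1 *
      ((-1) ^ z.2 * q ^ tri z.2 * (x / y) ^ z.2) := ⟨_, rfl⟩
  have key : HasSum F (x * (thetaB x q * thetaA y q) + -x * (thetaA x q * thetaB y q)) := by
    have hev : HasSum (F ∘ e) (x * (thetaB x q * thetaA y q)) := by
      refine (congrArg (HasSum · _) (funext ?_)).mpr hBA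
      rintro ⟨a, b⟩
      simp only [hF, he, Function.comp]
      rw [mul_zpow, div_zpow]
      have h1 : (-1 : ℂ) ^ (a + b) * (-1) ^ (a - b) = 1 := by
        rw [← zpow_add₀ (by norm_num), show a + b + (a - b) = 2 * a by ring, hmm]
      have h2 : q ^ tri (a + b) * q ^ tri (a - b) = q ^ (a ^ 2 - a) * q ^ (b ^ 2) := by
        rw [← zpow_add₀ hq0, ← zpow_add₀ hq0]
        congr 1
        linarith [two_mul_tri (a + b), two_mul_tri (a - b)]
      have h3 : x ^ (a + b) * x ^ (a - b) = x * x ^ (2 * a - 1) := by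
        rw [← zpow_add₀ hx, ← zpow_one_add₀ hx]; congr 1; ring
      have h4 : y ^ (a + b) / y ^ (a - b) = y ^ (2 * b) := by
        rw [← zpow_sub₀ hy]; congr 1; ring
      calc _ = ((-1 : ℂ) ^ (a + b) * (-1) ^ (a - b)) * (q ^ tri (a + b) * q ^ tri (a - b)) *
            (x ^ (a + b) * x ^ (a - b)) * (y ^ (a + b) / y ^ (a - b)) := by ring
        _ = _ := by rw [h1, h2, h3, h4]; ring
    have hod : HasSum (F ∘ o) (-x * (thetaA x q * thetaB y q)) := by
      refine (congrArg (HasSum · _) (funext ?_)).mpr hAB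
      rintro ⟨a, b⟩
      simp only [hF, ho, Function.comp]
      rw [mul_zpow, div_zpow]
      have h1 : (-1 : ℂ) ^ (a + b) * (-1) ^ (a - b + 1) = -1 := by
        rw [← zpow_add₀ (by norm_num), show a + b + (a - b + 1) = 2 * a + 1 by ring,
          zpow_add₀ (by norm_num), hmm]
        norm_num
      have h2 : q ^ tri (a + b) * q ^ tri (a - b + 1) = q ^ (a ^ 2) * q ^ (b ^ 2 - b) := by
        rw [← zpow_add₀ hq0, ← zpow_add₀ hq0]
        congr 1
        linarith [two_mul_tri (a + b), two_mul_tri (a - b + 1)]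
      have h3 : x ^ (a + b) * x ^ (a - b + 1) = x * x ^ (2 * a) := by
        rw [← zpow_add₀ hx, ← zpow_one_add₀ hx]; congr 1; ring
      have h4 : y ^ (a + b) / y ^ (a - b + 1) = y ^ (2 * b - 1) := by
        rw [← zpow_sub₀ hy]; congr 1; ring
      calc _ = ((-1 : ℂ) ^ (a + b) * (-1) ^ (a - b + 1)) *
            (q ^ tri (a + b) * q ^ tri (a - b + 1)) *
            (x ^ (a + b) * x ^ (a - b + 1)) * (y ^ (a + b) / y ^ (a - b + 1)) := by ring
        _ = _ := by rw [h1, h2, h3, h4]; ring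
    exact (hei.hasSum_range_iff.2 hev).add_isCompl hcompl (hoi.hasSum_range_iff.2 hod)
  rw [← hF, key.tsum_eq]
  ring

/-- Logarithmic derivative form of Weierstrass' three-term relation for theta functions. -/
theorem ell_relation {x y z q : ℂ} (hx : x ≠ 0) (hy : y ≠ 0) (hz : z ≠ 0) (hq0 : q ≠ 0)
    (hq : ‖q‖ < 1) (h1 : jTheta (y * x) q ≠ 0) (h2 : jTheta (y / x) q ≠ 0)
    (h3 : jTheta (z * x) q ≠ 0) (h4 : jTheta (z / x) q ≠ 0) :
    (ell (y * x) q - ell (y / x) q - ell (z * x) q + ell (z / x) q) *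
      (jTheta (y * x) q * jTheta (y / x) q * (jTheta (z * x) q * jTheta (z / x) q)) =
      -qPochInf q q ^ 3 * jTheta (x * x) q * (jTheta (y * z) q * jTheta (y / z) q) * (z / x) := by
  have hD := fun (a b : ℂ) (ha : a ≠ 0) (hb : b ≠ 0) => jTheta_mul_jTheta ha hb hq0 hq
  -- The three-term relation in x, y, z, w: the Plücker relation among the 2 × 2 minors of
  -- (`thetaA`, `thetaB`). It is differentiated below at w = x, where the factor j(x/w) vanishes and
  -- contributes only its derivative (q;q)_∞³ / x.
  have hpl : ∀ w, w ≠ 0 → jTheta (x * y) q * jTheta (x / y) q * (jTheta (z * w) q * jTheta (z / w) q)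
      * y - jTheta (x * z) q * jTheta (x / z) q * (jTheta (y * w) q * jTheta (y / w) q) * z +
      jTheta (x * w) q * jTheta (x / w) q * (jTheta (y * z) q * jTheta (y / z) q) * z = 0 := by
    intro w hw
    rw [hD x y hx hy, hD z w hz hw, hD x z hx hz, hD y w hy hw, hD x w hx hw, hD y z hy hz]
    ring
  have hsw : ∀ c, c ≠ 0 → jTheta (x * c) q * jTheta (x / c) q * c =
      -(jTheta (c * x) q * jTheta (c / x) q * x) := by
    intro c hc
    rw [hD x c hx hc, hD c x hc hx]; ring
  have dz := (hasDerivAt_jTheta_mul hx hz hq h3).fun_mul (hasDerivAt_jTheta_div hx hz hq h4)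
  have dy := (hasDerivAt_jTheta_mul hx hy hq h1).fun_mul (hasDerivAt_jTheta_div hx hy hq h2)
  have dq : HasDerivAt (fun w => jTheta (x / w) q) (qPochInf q q ^ 3 / x) x := by
    have h := HasDerivAt.comp x (by rw [mul_inv_cancel₀ hx]; exact hasDerivAt_jTheta_one hq)
      ((hasDerivAt_inv hx).const_mul x)
    refine h.congr_deriv ?_
    field_simp
  have dm : DifferentiableAt ℂ (fun w => jTheta (x * w) q) x :=
    (differentiableAt_jTheta (mul_ne_zero hx hx) hq).comp x (by fun_prop)
  have dx := dm.hasDerivAt.fun_mul dq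
  have dall := (((dz.const_mul (jTheta (x * y) q * jTheta (x / y) q)).mul_const y).fun_sub
    ((dy.const_mul (jTheta (x * z) q * jTheta (x / z) q)).mul_const z)).fun_add
    ((dx.mul_const (jTheta (y * z) q * jTheta (y / z) q)).mul_const z)
  have d0 : HasDerivAt (fun _ : ℂ => (0 : ℂ)) 0 x := hasDerivAt_const _ _
  have h5 := dall.unique (d0.congr_of_eventuallyEq (by
    filter_upwards [isOpen_ne.mem_nhds hx] with w hw using hpl w hw))
  simp only [div_self hx, jTheta_one hq] at h5
  have e1 := hsw y hy
  have e2 := hsw z hz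
  generalize jTheta (x * y) q = X1 at *
  generalize jTheta (x / y) q = X2 at *
  generalize jTheta (x * z) q = X3 at *
  generalize jTheta (x / z) q = X4 at *
  generalize ell (z * x) q = l1 at *
  generalize ell (z / x) q = l2 at *
  generalize ell (y * x) q = l3 at *
  generalize ell (y / x) q = l4 at *
  generalize jTheta (z * x) q = Y1 at *
  generalize jTheta (z / x) q = Y2 at *
  generalize jTheta (y * x) q = Y3 at *
  generalize jTheta (y / x) q = Y4 at *
  field_simp at h5 ⊢
  linear_combination h5 - Y1 * Y2 * (l1 - l2) * e1 + Y3 * Y4 * (l3 - l4) * e2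

/-! ### The addition formula at a pole -/

lemma eventually_le_norm_one_sub {c q : ℂ} (hc : c ≠ 0) (hq0 : q ≠ 0) (hq : ‖q‖ < 1) :
    ∃ δ : ℝ, 0 < δ ∧ ∀ᶠ w in 𝓝 (1 : ℂ), ∀ k : ℤ, 1 - c * q ^ k ≠ 0 → δ ≤ ‖1 - w * c * q ^ k‖ := by
  obtain ⟨δ, hδ, h⟩ := exists_le_norm_one_sub_zpow hc hq0 hq
  refine ⟨δ / 2, by positivity, ?_⟩
  filter_upwards [Metric.ball_mem_nhds (1 : ℂ) (show 0 < δ / 2 by positivity)] with w hw k hk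
  have h1 := h k hk
  have h2 : 1 - w * c * q ^ k = (1 - c * q ^ k) - (w - 1) * (c * q ^ k) := by ring
  have h3 := norm_sub_norm_le (1 - c * q ^ k) ((w - 1) * (c * q ^ k))
  rw [← h2, norm_mul] at h3
  rw [Metric.mem_ball, dist_eq_norm] at hw
  have h4 := norm_nonneg (c * q ^ k)
  nlinarith

lemma tendsto_tsum_mul_inv {c q : ℂ} (hc : c ≠ 0) (hq0 : q ≠ 0) (hq : ‖q‖ < 1) {a : ℤ → ℂ}
    (ha : Summable fun k => ‖a k‖) (h : ∀ k, a k = 0 ∨ 1 - c * q ^ k ≠ 0) :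
    Tendsto (fun w => ∑' k, a k * (1 - w * c * q ^ k)⁻¹) (𝓝 1)
      (𝓝 (∑' k, a k * (1 - c * q ^ k)⁻¹)) := by
  obtain ⟨δ, hδ, hev⟩ := eventually_le_norm_one_sub hc hq0 hq
  refine tendsto_tsum_of_dominated_convergence (ha.mul_right δ⁻¹) (fun k => ?_) ?_
  · rcases h k with h0 | h0
    · simp [h0]
    · refine Tendsto.const_mul _ (Tendsto.inv₀ ?_ h0)
      have : Tendsto (fun w : ℂ => 1 - w * c * q ^ k) (𝓝 1) (𝓝 (1 - 1 * c * q ^ k)) :=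
        Continuous.tendsto (by fun_prop) 1
      rwa [one_mul] at this
  · filter_upwards [hev] with w hw k
    rcases h k with h0 | h0
    · simp [h0]
    · rw [norm_mul, norm_inv]
      exact mul_le_mul_of_nonneg_left (inv_anti₀ hδ (hw k h0)) (norm_nonneg _)

lemma summable_norm_lamCoeff {y q : ℂ} (hq0 : q ≠ 0) (hq : ‖q‖ < 1) (hy : y ≠ 0) :
    Summable fun k : ℤ => ‖(-1) ^ k * q ^ (3 * tri k) * y ^ k‖ := by
  simpa using summable_norm_zpow_tri hq0 hq hy (s := 3) (by norm_num)

lemma tendsto_lam {c y q : ℂ} (hc : c ≠ 0) (hq0 : q ≠ 0) (hq : ‖q‖ < 1) (hy : y ≠ 0)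
    (h : ∀ k : ℤ, 1 - c * q ^ k ≠ 0) :
    Tendsto (fun w => lam (w * c) y q) (𝓝[≠] 1) (𝓝 (lam c y q)) :=
  (tendsto_tsum_mul_inv hc hq0 hq (summable_norm_lamCoeff hq0 hq hy)
    fun k => Or.inr (h k)).mono_left nhdsWithin_le_nhds

/-- At the pole `x = 1` the series `lam` omits the singular term. -/
lemma tendsto_lam_sub_inv {y q : ℂ} (hq0 : q ≠ 0) (hq : ‖q‖ < 1) (hy : y ≠ 0) :
    Tendsto (fun w => lam w y q - (1 - w)⁻¹) (𝓝[≠] 1) (𝓝 (lam 1 y q)) := by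
  -- The weight is set to 0 at k = 0, where `lam 1 y q` has the summand 0 as well because 0⁻¹ = 0.
  set a : ℤ → ℂ := fun k => if k = 0 then 0 else (-1) ^ k * q ^ (3 * tri k) * y ^ k with ha
  have hs : Summable fun k => ‖a k‖ := by
    refine Summable.of_nonneg_of_le (fun _ => norm_nonneg _) (fun k => ?_)
      (summable_norm_lamCoeff hq0 hq hy)
    simp only [ha]
    split_ifs
    · rw [norm_zero]; exact norm_nonneg _
    · exact le_rfl
  have h := tendsto_tsum_mul_inv one_ne_zero hq0 hq hs fun k => by
    by_cases hk : k = 0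
    · exact Or.inl (by simp [ha, hk])
    · refine Or.inr ?_
      rw [one_mul, sub_ne_zero]
      exact (zpow_ne_one_of_norm_lt_one hq hk).symm
  have h1 : ∑' k, a k * (1 - 1 * q ^ k)⁻¹ = lam 1 y q := by
    refine tsum_congr fun k => ?_
    by_cases hk : k = 0
    · simp [ha, hk]
    · simp [ha, hk]
  rw [h1] at h
  refine (h.mono_left nhdsWithin_le_nhds).congr' ?_
  filter_upwards [nhdsWithin_le_nhds (isOpen_ne.mem_nhds (one_ne_zero (α := ℂ)))] with w hw
  rw [lam, (summable_lam hq0 hq hw hy).tsum_eq_add_tsum_ite 0]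
  simp only [zpow_zero, tri_zero, mul_zero, mul_one, one_mul, add_sub_cancel_left]
  refine tsum_congr fun k => ?_
  by_cases hk : k = 0
  · simp [ha, hk]
  · simp [ha, hk]

/-- The limiting case of `lam_add_lam` in which the first series has a pole. -/
theorem lam_one_add_lam {Z q : ℂ} (hq0 : q ≠ 0) (hq : ‖q‖ < 1) (hZ0 : Z ≠ 0)
    (hZ : ∀ k : ℤ, 1 - Z * q ^ k ≠ 0) (hZ2 : ∀ k : ℤ, 1 - Z ^ 2 * q ^ k ≠ 0) :
    lam 1 (q ^ 3 / Z ^ 3) q + Z ^ 3 * lam (Z ^ 2) (q ^ 3 * Z ^ 3) q =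
      Z * (jTheta (Z ^ 2) q / jTheta Z q) * lam Z (q ^ 3) q + (ell Z q + ell (Z ^ 2) q) := by
  have hq3 : q ^ 3 ≠ 0 := pow_ne_zero _ hq0
  have hZ3 : Z ^ 3 ≠ 0 := pow_ne_zero _ hZ0
  have hZ2' : Z ^ 2 ≠ 0 := pow_ne_zero _ hZ0
  have nZ := jTheta_ne_zero hZ0 hq0 hq hZ
  have nZ2 := jTheta_ne_zero hZ2' hq0 hq hZ2
  have nJ := qPochInf_self_ne_zero hq
  have lim1 := ((tendsto_lam_sub_inv hq0 hq (div_ne_zero hq3 hZ3)).add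
    ((tendsto_lam hZ2' hq0 hq (mul_ne_zero hq3 hZ3) hZ2).const_mul (Z ^ 3))).sub
    ((tendsto_lam hZ0 hq0 hq hq3 hZ).const_mul (Z * (jTheta (Z ^ 2) q / jTheta Z q)))
  have dK := ((hasDerivAt_jReduced_one hq).fun_mul (hasDerivAt_jTheta_mul one_ne_zero hZ0 hq
    (by rwa [mul_one]))).fun_mul (hasDerivAt_jTheta_mul one_ne_zero hZ2' hq (by rwa [mul_one]))
  have dH := (dK.fun_inv (by simpa [jReduced_one] using ⟨⟨nJ, nZ⟩, nZ2⟩)).const_mul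
    (qPochInf q q ^ 3 * (jTheta Z q * jTheta (Z ^ 2) q))
  have lim2 := (hasDerivAt_iff_tendsto_slope.1 dH).neg
  -- The addition formula is used at x = wZ with w → 1. Its theta quotient is H(w)/(1 - w) with H(1)
  -- = 1, so subtracting the pole 1/(1 - w) leaves minus the difference quotient of H. The limit is
  -- -H'(1), a sum of logarithmic derivatives, as `jReduced` has derivative 0 at 1.
  have hev : ∀ᶠ w in 𝓝[≠] (1 : ℂ), lam w (q ^ 3 / Z ^ 3) q - (1 - w)⁻¹ +
      Z ^ 3 * lam (w * Z ^ 2) (q ^ 3 * Z ^ 3) q -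
      Z * (jTheta (Z ^ 2) q / jTheta Z q) * lam (w * Z) (q ^ 3) q =
      -slope (fun w => qPochInf q q ^ 3 * (jTheta Z q * jTheta (Z ^ 2) q) *
        (jReduced w q * jTheta (Z * w) q * jTheta (Z ^ 2 * w) q)⁻¹) 1 w := by
    obtain ⟨δ₁, hδ₁, he1⟩ := eventually_le_norm_one_sub one_ne_zero hq0 hq
    obtain ⟨δ₂, hδ₂, he2⟩ := eventually_le_norm_one_sub hZ0 hq0 hq
    obtain ⟨δ₃, hδ₃, he3⟩ := eventually_le_norm_one_sub hZ2' hq0 hq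
    filter_upwards [nhdsWithin_le_nhds he1, nhdsWithin_le_nhds he2, nhdsWithin_le_nhds he3,
      nhdsWithin_le_nhds (isOpen_ne.mem_nhds (one_ne_zero (α := ℂ))), self_mem_nhdsWithin]
      with w h1 h2 h3 hw0 hw1
    have n1 : ∀ k : ℤ, 1 - w * q ^ k ≠ 0 := by
      intro k
      by_cases hk : k = 0
      · rw [hk, zpow_zero, mul_one, sub_ne_zero]; exact (Ne.symm hw1)
      · have := h1 k (by
          rw [one_mul, sub_ne_zero]
          exact (zpow_ne_one_of_norm_lt_one hq hk).symm)
        rw [mul_one] at this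
        exact norm_pos_iff.1 (hδ₁.trans_le this)
    have n2 : ∀ k : ℤ, 1 - w * Z * q ^ k ≠ 0 := fun k => norm_pos_iff.1 (hδ₂.trans_le (h2 k (hZ k)))
    have n3 : ∀ k : ℤ, 1 - w * Z ^ 2 * q ^ k ≠ 0 := fun k =>
      norm_pos_iff.1 (hδ₃.trans_le (h3 k (hZ2 k)))
    have hdiv : w * Z / Z = w := by field_simp
    have hmul : w * Z * Z = w * Z ^ 2 := by ring
    have key := lam_add_lam hq0 hq (mul_ne_zero hw0 hZ0) hZ0 hZ hZ2 (by rwa [hdiv]) n2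
      (by rwa [hmul])
    rw [hdiv, hmul] at key
    have m1 := jTheta_ne_zero hw0 hq0 hq n1
    rw [jTheta_eq_mul_jReduced hq w] at m1 key
    have m2 := jTheta_ne_zero (mul_ne_zero hw0 hZ0) hq0 hq n2
    have m3 := jTheta_ne_zero (mul_ne_zero hw0 hZ2') hq0 hq n3
    have m4 := left_ne_zero_of_mul m1
    have m5 := right_ne_zero_of_mul m1
    have m6 : w - 1 ≠ 0 := sub_ne_zero.2 hw1
    rw [slope_def_field, mul_one, mul_one, jReduced_one, mul_comm Z w, mul_comm (Z ^ 2) w]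
    have m7 : lam w (q ^ 3 / Z ^ 3) q - (1 - w)⁻¹ + Z ^ 3 * lam (w * Z ^ 2) (q ^ 3 * Z ^ 3) q -
      Z * (jTheta (Z ^ 2) q / jTheta Z q) * lam (w * Z) (q ^ 3) q = qPochInf q q ^ 3 *
        (jTheta Z q * jTheta (Z ^ 2) q) / ((1 - w) * jReduced w q * jTheta (w * Z) q *
          jTheta (w * Z ^ 2) q) - (1 - w)⁻¹ := by
      linear_combination key
    rw [m7]
    have m8 : 1 - w = -(w - 1) := by ring
    rw [m8]
    generalize jTheta Z q = A at *
    generalize jTheta (Z ^ 2) q = B at *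
    generalize w - 1 = t at *
    field_simp
    ring
  have h := tendsto_nhds_unique (lim1.congr' hev) lim2
  simp only [mul_one, jReduced_one] at h
  have e : -(qPochInf q q ^ 3 * (jTheta Z q * jTheta (Z ^ 2) q) *
      (-((0 * jTheta Z q + qPochInf q q ^ 3 * (ell Z q / 1 * jTheta Z q)) * jTheta (Z ^ 2) q +
        qPochInf q q ^ 3 * jTheta Z q * (ell (Z ^ 2) q / 1 * jTheta (Z ^ 2) q)) /
        (qPochInf q q ^ 3 * jTheta Z q * jTheta (Z ^ 2) q) ^ 2)) = ell Z q + ell (Z ^ 2) q := by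
    field_simp
    ring
  rw [e] at h
  linear_combination h

/-! ### Theta functions and logarithmic derivatives for modulus five -/

lemma norm_pow_lt_one {q : ℂ} (hq : ‖q‖ < 1) {n : ℕ} (hn : n ≠ 0) : ‖q ^ n‖ < 1 := by
  rw [norm_pow]; exact pow_lt_one₀ (norm_nonneg _) hq hn

lemma one_sub_pow_mul_zpow_ne_zero {p : ℂ} (hp : ‖p‖ < 1) {a m : ℕ} (h : ¬ m ∣ a) (k : ℤ) :
    1 - p ^ a * (p ^ m) ^ k ≠ 0 := by
  by_cases hp0 : p = 0
  · subst hp0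
    have ha : a ≠ 0 := by rintro rfl; exact h (dvd_zero m)
    simp [ha]
  rw [sub_ne_zero, ← zpow_natCast p a, ← zpow_natCast p m, ← zpow_mul, ← zpow_add₀ hp0]
  refine (zpow_ne_one_of_norm_lt_one hp fun h0 => h ?_).symm
  have : (m : ℤ) ∣ a := ⟨-k, by linarith⟩
  exact_mod_cast this

lemma jTheta_pow_ne_zero {p : ℂ} (hp0 : p ≠ 0) (hp : ‖p‖ < 1) {a m : ℕ} (hm : m ≠ 0)
    (h : ¬ m ∣ a) : jTheta (p ^ a) (p ^ m) ≠ 0 :=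
  jTheta_ne_zero (pow_ne_zero _ hp0) (pow_ne_zero _ hp0) (norm_pow_lt_one hp hm)
    (one_sub_pow_mul_zpow_ne_zero hp h)

lemma qPochInf_self_eq_five {p : ℂ} (hp0 : p ≠ 0) (hp : ‖p‖ < 1) :
    qPochInf p p * qPochInf (p ^ 5) (p ^ 5) = jTheta (p ^ 1) (p ^ 5) * jTheta (p ^ 2) (p ^ 5) := by
  rw [qPochInf_eq_prod hp p (m := 5) (by norm_num), jTheta, jTheta]
  simp only [prod_range_succ, prod_range_zero, one_mul, pow_zero, pow_one]
  rw [show p ^ 5 / p = p ^ 3 * p by field_simp, show p ^ 5 / p ^ 2 = p ^ 2 * p by field_simp,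
    show p * p = p ^ 2 by ring, show p ^ 4 * p = p ^ 5 by ring]
  ring

section five
variable {p : ℂ}

lemma jTheta_five_three (hp0 : p ≠ 0) : jTheta (p ^ 3) (p ^ 5) = jTheta (p ^ 2) (p ^ 5) := by
  rw [← jTheta_q_div (pow_ne_zero 2 hp0) (pow_ne_zero 5 hp0)]
  congr 1; field_simp

lemma jTheta_five_four (hp0 : p ≠ 0) : jTheta (p ^ 4) (p ^ 5) = jTheta (p ^ 1) (p ^ 5) := by
  rw [← jTheta_q_div (pow_ne_zero 1 hp0) (pow_ne_zero 5 hp0)]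
  congr 1; field_simp

lemma ell_five_three (hp0 : p ≠ 0) (hp : ‖p‖ < 1) :
    ell (p ^ 3) (p ^ 5) = -ell (p ^ 2) (p ^ 5) := by
  rw [← ell_q_div (pow_ne_zero 2 hp0) (pow_ne_zero 5 hp0) (norm_pow_lt_one hp (by norm_num))
    (jTheta_pow_ne_zero hp0 hp (by norm_num) (by norm_num))]
  congr 1; field_simp

/-- `ell_relation` at (x, y, z) = (p, 1, p²): reflection reduces all four logarithmic derivatives to
those at p and p². With `three_ell_two_sub_ell_one` it forms an invertible linear system for the
two. -/
lemma three_ell_one_add_ell_two (hp0 : p ≠ 0) (hp : ‖p‖ < 1) :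
    3 * ell (p ^ 1) (p ^ 5) + ell (p ^ 2) (p ^ 5) = 1 - qPochInf (p ^ 5) (p ^ 5) ^ 3 *
      jTheta (p ^ 2) (p ^ 5) ^ 2 / jTheta (p ^ 1) (p ^ 5) ^ 3 := by
  have hQ0 : p ^ 5 ≠ 0 := pow_ne_zero _ hp0
  have hQ : ‖p ^ 5‖ < 1 := norm_pow_lt_one hp (by norm_num)
  have n1 : jTheta (p ^ 1) (p ^ 5) ≠ 0 := jTheta_pow_ne_zero hp0 hp (by norm_num) (by norm_num)
  have n2 : jTheta (p ^ 2) (p ^ 5) ≠ 0 := jTheta_pow_ne_zero hp0 hp (by norm_num) (by norm_num)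
  have i1 := jTheta_inv (pow_ne_zero 1 hp0) hQ
  have i2 := jTheta_inv (pow_ne_zero 2 hp0) hQ
  have hinv : (p ^ 1)⁻¹ ≠ 0 := inv_ne_zero (pow_ne_zero 1 hp0)
  have e1 : (1 : ℂ) * p ^ 1 = p ^ 1 := one_mul _
  have e2 : (1 : ℂ) / p ^ 1 = (p ^ 1)⁻¹ := one_div _
  have e3 : p ^ 2 * p ^ 1 = p ^ 3 := by ring
  have e4 : p ^ 2 / p ^ 1 = p ^ 1 := by field_simp
  have e5 : p ^ 1 * p ^ 1 = p ^ 2 := by ring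
  have e6 : (1 : ℂ) * p ^ 2 = p ^ 2 := one_mul _
  have e7 : (1 : ℂ) / p ^ 2 = (p ^ 2)⁻¹ := one_div _
  have h := ell_relation (x := p ^ 1) (y := 1) (z := p ^ 2) (pow_ne_zero 1 hp0) one_ne_zero
    (pow_ne_zero 2 hp0) hQ0 hQ (by rwa [e1])
    (by rw [e2, i1]; exact mul_ne_zero (neg_ne_zero.2 hinv) n1)
    (by rwa [e3, jTheta_five_three hp0]) (by rwa [e4])
  rw [e1, e2, e3, e4, e5, e6, e7, i1, i2, jTheta_five_three hp0, ell_five_three hp0 hp,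
    ell_inv (pow_ne_zero 1 hp0) hQ n1] at h
  generalize jTheta (p ^ 1) (p ^ 5) = P1 at *
  generalize jTheta (p ^ 2) (p ^ 5) = P2 at *
  generalize ell (p ^ 1) (p ^ 5) = l1 at *
  generalize ell (p ^ 2) (p ^ 5) = l2 at *
  field_simp at h ⊢
  linear_combination -h

/-- `ell_relation` at (x, y, z) = (p², 1, p⁴). The argument p⁶ is brought back by quasi-periodicity,
and its shift by 1 cancels the one from inverting p². -/
lemma three_ell_two_sub_ell_one (hp0 : p ≠ 0) (hp : ‖p‖ < 1) :
    3 * ell (p ^ 2) (p ^ 5) - ell (p ^ 1) (p ^ 5) = p * qPochInf (p ^ 5) (p ^ 5) ^ 3 *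
      jTheta (p ^ 1) (p ^ 5) ^ 2 / jTheta (p ^ 2) (p ^ 5) ^ 3 := by
  have hQ0 : p ^ 5 ≠ 0 := pow_ne_zero _ hp0
  have hQ : ‖p ^ 5‖ < 1 := norm_pow_lt_one hp (by norm_num)
  have n1 : jTheta (p ^ 1) (p ^ 5) ≠ 0 := jTheta_pow_ne_zero hp0 hp (by norm_num) (by norm_num)
  have n2 : jTheta (p ^ 2) (p ^ 5) ≠ 0 := jTheta_pow_ne_zero hp0 hp (by norm_num) (by norm_num)
  have i2 := jTheta_inv (pow_ne_zero 2 hp0) hQ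
  have i4 := jTheta_inv (pow_ne_zero 4 hp0) hQ
  have hinv : (p ^ 2)⁻¹ ≠ 0 := inv_ne_zero (pow_ne_zero 2 hp0)
  have hinv1 : (p ^ 1)⁻¹ ≠ 0 := inv_ne_zero (pow_ne_zero 1 hp0)
  have e1 : (1 : ℂ) * p ^ 2 = p ^ 2 := one_mul _
  have e2 : (1 : ℂ) / p ^ 2 = (p ^ 2)⁻¹ := one_div _
  have e3 : p ^ 4 * p ^ 2 = p ^ 1 * p ^ 5 := by ring
  have e4 : p ^ 4 / p ^ 2 = p ^ 2 := by field_simp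
  have e5 : p ^ 2 * p ^ 2 = p ^ 4 := by ring
  have e6 : (1 : ℂ) * p ^ 4 = p ^ 4 := one_mul _
  have e7 : (1 : ℂ) / p ^ 4 = (p ^ 4)⁻¹ := one_div _
  have i6 := jTheta_mul_q (pow_ne_zero 1 hp0) hQ0 hQ
  have l6 := ell_q_mul (pow_ne_zero 1 hp0) hQ0 hQ n1
  rw [mul_comm (p ^ 5)] at l6
  have h := ell_relation (x := p ^ 2) (y := 1) (z := p ^ 4) (pow_ne_zero 2 hp0) one_ne_zero
    (pow_ne_zero 4 hp0) hQ0 hQ (by rwa [e1])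
    (by rw [e2, i2]; exact mul_ne_zero (neg_ne_zero.2 hinv) n2)
    (by rw [e3, i6]; exact mul_ne_zero (neg_ne_zero.2 hinv1) n1) (by rwa [e4])
  rw [e1, e2, e3, e4, e5, e6, e7, i2, i4, i6, l6, jTheta_five_four hp0,
    ell_inv (pow_ne_zero 2 hp0) hQ n2] at h
  generalize jTheta (p ^ 1) (p ^ 5) = P1 at *
  generalize jTheta (p ^ 2) (p ^ 5) = P2 at *
  generalize ell (p ^ 1) (p ^ 5) = l1 at *
  generalize ell (p ^ 2) (p ^ 5) = l2 at *
  field_simp at h ⊢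
  linear_combination h

end five

/-! ### Dissection of the Lambert series modulo five -/

lemma tsum_int_eq_five {f : ℤ → ℂ} (hf : Summable f) :
    ∑' n, f n = (∑' m, f (5 * m)) + (∑' m, f (5 * m + 1)) + (∑' m, f (5 * m + 2)) +
      (∑' m, f (5 * m + 3)) + (∑' m, f (5 * m + 4)) := by
  have hf' : Summable fun x => f ((Int.divModEquiv 5).symm x) :=
    (Int.divModEquiv 5).symm.summable_iff.2 hf
  rw [← (Int.divModEquiv 5).symm.tsum_eq, hf'.tsum_prod' (fun _ => Summable.of_finite)]
  have hs : ∀ r : ℤ, Summable fun m : ℤ => f (5 * m + r) := fun r =>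
    hf.comp_injective (i := fun m : ℤ => 5 * m + r) (fun a b h => by simp at h; exact h)
  have h0 := hs 0
  simp only [add_zero] at h0
  rw [← h0.tsum_add (hs 1), ← (h0.add (hs 1)).tsum_add (hs 2),
    ← ((h0.add (hs 1)).add (hs 2)).tsum_add (hs 3),
    ← (((h0.add (hs 1)).add (hs 2)).add (hs 3)).tsum_add (hs 4)]
  refine tsum_congr fun m => ?_
  rw [tsum_fintype, Fin.sum_univ_five]
  simp [Int.divModEquiv, mul_comm]

/-- `∑ (-1) ^ n q ^ (3 n (n - 1) / 2) y ^ n / (1 - w q ^ (5 n))` over the integers. -/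
noncomputable def lamFive (w y q : ℂ) : ℂ :=
  ∑' n : ℤ, (-1) ^ n * q ^ (3 * tri n) * y ^ n * (1 - w * (q ^ 5) ^ n)⁻¹

lemma summable_lamFive {w y q : ℂ} (hq0 : q ≠ 0) (hq : ‖q‖ < 1) (hw : w ≠ 0) (hy : y ≠ 0) :
    Summable fun n : ℤ => (-1) ^ n * q ^ (3 * tri n) * y ^ n * (1 - w * (q ^ 5) ^ n)⁻¹ :=
  (summable_norm_mul_inv (pow_ne_zero 5 hq0) (norm_pow_lt_one hq (by norm_num)) hw
    (summable_norm_lamCoeff hq0 hq hy)).of_norm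

lemma tsum_lamFive_residue {q : ℂ} (hq0 : q ≠ 0) (w : ℂ) (c r : ℤ) :
    ∑' m : ℤ, (-1) ^ (5 * m + r) * q ^ (3 * tri (5 * m + r)) * (q ^ c) ^ (5 * m + r) *
      (1 - w * (q ^ 5) ^ (5 * m + r))⁻¹ =
    (-1) ^ r * q ^ (3 * tri r + c * r) * lam (w * q ^ (5 * r)) (q ^ (30 + 15 * r + 5 * c)) (q ^ 25) := by
  rw [lam, ← tsum_mul_left]
  refine tsum_congr fun m => ?_
  have h1 : (-1 : ℂ) ^ (5 * m + r) = (-1) ^ r * (-1) ^ m := by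
    rw [zpow_add₀ (by norm_num), zpow_mul, mul_comm]
    norm_num
  have h2 : q ^ (3 * tri (5 * m + r)) * (q ^ c) ^ (5 * m + r) =
      q ^ (3 * tri r + c * r) * ((q ^ 25) ^ (3 * tri m) * (q ^ (30 + 15 * r + 5 * c)) ^ m) := by
    rw [← zpow_natCast q 25, ← zpow_mul, ← zpow_mul, ← zpow_mul, ← zpow_add₀ hq0, ← zpow_add₀ hq0,
      ← zpow_add₀ hq0]
    congr 1
    have h5 : tri (5 * m) = 25 * tri m + 10 * m := by
      linarith [two_mul_tri (5 * m), two_mul_tri m]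
    push_cast
    linear_combination 3 * tri_add (5 * m) r + 3 * h5
  have h3 : w * (q ^ 5) ^ (5 * m + r) = w * q ^ (5 * r) * (q ^ 25) ^ m := by
    rw [mul_assoc, ← zpow_natCast q 5, ← zpow_natCast q 25, ← zpow_mul, ← zpow_mul, ← zpow_add₀ hq0]
    congr 2
    push_cast; ring
  rw [h3, h1, mul_assoc ((-1 : ℂ) ^ r * (-1) ^ m), h2]
  ring

lemma lamFive_eq_sum {q w : ℂ} (hq0 : q ≠ 0) (hq : ‖q‖ < 1) (hw : w ≠ 0) (c : ℤ) :
    lamFive w (q ^ c) q = ∑ r ∈ range 5, (-1) ^ (r : ℤ) * q ^ (3 * tri r + c * r) *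
      lam (w * q ^ (5 * r : ℤ)) (q ^ (30 + 15 * r + 5 * c)) (q ^ 25) := by
  rw [lamFive, tsum_int_eq_five (summable_lamFive hq0 hq hw (zpow_ne_zero _ hq0))]
  simp only [sum_range_succ, sum_range_zero, zero_add, Nat.cast_zero, Nat.cast_one, Nat.cast_ofNat]
  rw [← tsum_lamFive_residue hq0, ← tsum_lamFive_residue hq0, ← tsum_lamFive_residue hq0,
    ← tsum_lamFive_residue hq0, ← tsum_lamFive_residue hq0]
  simp only [add_zero]

lemma lam_mul_q {x y q : ℂ} (hq0 : q ≠ 0) (hy : y ≠ 0) :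
    lam (x * q) y q = -(q ^ 3 / y) * lam x (y / q ^ 3) q := by
  rw [lam, ← (Equiv.subRight (1 : ℤ)).tsum_eq, lam, ← tsum_mul_left]
  refine tsum_congr fun k => ?_
  simp only [Equiv.subRight_apply]
  have h1 : tri (k - 1) = tri k - k + 1 := by linarith [two_mul_tri (k - 1), two_mul_tri k]
  have h2 : x * q * q ^ (k - 1) = x * q ^ k := by
    rw [zpow_sub_one₀ hq0]; field_simp
  have h3 : q ^ (3 * tri (k - 1)) = q ^ (3 * tri k) * q ^ 3 / (q ^ 3) ^ k := by
    rw [← zpow_natCast q 3, ← zpow_mul, ← zpow_add₀ hq0, ← zpow_sub₀ hq0, h1]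
    congr 1; push_cast; ring
  rw [h2, h3, zpow_sub_one₀ hy, zpow_sub_one₀ (by norm_num), div_zpow]
  norm_num
  ring

lemma tsum_cube_eq_jTheta {y q : ℂ} (hq0 : q ≠ 0) (hq : ‖q‖ < 1) (hy : y ≠ 0) :
    ∑' k : ℤ, (-1) ^ k * q ^ (3 * tri k) * y ^ k = jTheta y (q ^ 3) := by
  rw [jTheta_eq_tsum hy (pow_ne_zero _ hq0) (norm_pow_lt_one hq (by norm_num))]
  refine tsum_congr fun k => ?_
  rw [zpow_mul]
  norm_cast

/-- After the index shift the second argument is 1. Three steps y = 1, q, q² return it to q³; the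
first costs j(1; q³) = 0 and the other two cost the pentagonal series. -/
lemma lam_mul_q_cube {x q : ℂ} (hq0 : q ≠ 0) (hq : ‖q‖ < 1) (hx : x ≠ 0)
    (h : ∀ k : ℤ, 1 - x * q ^ k ≠ 0) :
    lam (x * q) (q ^ 3) q = -(x ^ 3 * lam x (q ^ 3) q + (x ^ 2 + x) * qPochInf q q) := by
  have h0 := lam_sub_mul_lam hq0 hq hx one_ne_zero h
  have h1 := lam_sub_mul_lam hq0 hq hx hq0 h
  have h2 := lam_sub_mul_lam hq0 hq hx (pow_ne_zero 2 hq0) h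
  rw [tsum_cube_eq_jTheta hq0 hq one_ne_zero,
    jTheta_one (norm_pow_lt_one hq (by norm_num)), mul_one] at h0
  rw [tsum_pentagonal hq0 hq, ← sq] at h1
  rw [tsum_pentagonal_two hq0 hq, ← pow_succ'] at h2
  have hq3 : q ^ 3 ≠ 0 := pow_ne_zero _ hq0
  rw [lam_mul_q hq0 hq3, div_self hq3]
  linear_combination -h0 - x * h1 - x ^ 2 * h2

lemma lamFive_mul {w y q : ℂ} (hq0 : q ≠ 0) (hy : y ≠ 0) :
    lamFive (w * q ^ 25) y q = -(q ^ 45 / y ^ 5) * lamFive w (y / q ^ 15) q := by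
  rw [lamFive, ← (Equiv.subRight (5 : ℤ)).tsum_eq, lamFive, ← tsum_mul_left]
  refine tsum_congr fun k => ?_
  simp only [Equiv.subRight_apply]
  have h1 : tri (k - 5) = tri k - 5 * k + 15 := by
    linarith [two_mul_tri (k - 5), two_mul_tri k]
  have h2 : w * q ^ 25 * (q ^ 5) ^ (k - 5) = w * (q ^ 5) ^ k := by
    rw [zpow_sub₀ (pow_ne_zero _ hq0)]
    rw [show (q ^ 5) ^ (5 : ℤ) = q ^ 25 by norm_cast; rw [← pow_mul]]
    field_simp
  have h3 : q ^ (3 * tri (k - 5)) = q ^ (3 * tri k) * q ^ 45 / (q ^ 15) ^ k := by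
    rw [← zpow_natCast q 15, ← zpow_natCast q 45, ← zpow_mul, ← zpow_add₀ hq0, ← zpow_sub₀ hq0, h1]
    congr 1; push_cast; ring
  have h4 : y ^ (k - 5) = y ^ k / y ^ 5 := by rw [zpow_sub₀ hy]; norm_cast
  have h5 : (-1 : ℂ) ^ (k - 5) = -(-1) ^ k := by
    rw [zpow_sub₀ (by norm_num)]; norm_num; ring
  rw [h2, h3, h4, h5, div_zpow]
  ring

lemma lamFive_sub {w y q : ℂ} (hq0 : q ≠ 0) (hq : ‖q‖ < 1) (hw : w ≠ 0) (hy : y ≠ 0)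
    (h : ∀ k : ℤ, 1 - w * (q ^ 5) ^ k ≠ 0) :
    lamFive w y q - w * lamFive w (y * q ^ 5) q = jTheta y (q ^ 3) := by
  rw [← tsum_cube_eq_jTheta hq0 hq hy, lamFive, lamFive, ← tsum_mul_left,
    ← (summable_lamFive hq0 hq hw hy).tsum_sub
    ((summable_lamFive hq0 hq hw (mul_ne_zero hy (pow_ne_zero _ hq0))).mul_left w)]
  refine tsum_congr fun k => ?_
  have := h k
  rw [mul_zpow]
  field_simp

/-- The five residue classes arranged for the addition formula: the class r = 1 is the centre x = w
q^5, the classes 0 and 2 are its neighbours for Z = q^5, and 4 and 3 those for Z = q^10. -/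
lemma lamFive_six_eq {w q : ℂ} (hq0 : q ≠ 0) (hq : ‖q‖ < 1) (hw : w ≠ 0) :
    lamFive w (q ^ 6) q = -q ^ 6 * lam (w * q ^ 5) ((q ^ 25) ^ 3) (q ^ 25) +
      (lam w ((q ^ 25) ^ 3 / (q ^ 5) ^ 3) (q ^ 25) +
        (q ^ 5) ^ 3 * lam (w * q ^ 10) ((q ^ 25) ^ 3 * (q ^ 5) ^ 3) (q ^ 25)) -
      (q ^ 3)⁻¹ * (lam (w / q ^ 5) ((q ^ 25) ^ 3 / (q ^ 10) ^ 3) (q ^ 25) +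
        (q ^ 10) ^ 3 * lam (w * q ^ 15) ((q ^ 25) ^ 3 * (q ^ 10) ^ 3) (q ^ 25)) := by
  have h := lamFive_eq_sum hq0 hq hw 6
  have h6 : q ^ (6 : ℤ) = q ^ 6 := by norm_cast
  rw [h6] at h
  have t3 : tri 3 = 3 := rfl
  have t4 : tri 4 = 6 := rfl
  have t2 : tri 2 = 1 := rfl
  -- The class r = 4 has argument w q^20, one period q^25 beyond the required w / q^5.
  have hs := lam_mul_q (x := w / q ^ 5) (y := q ^ 120) (pow_ne_zero 25 hq0) (pow_ne_zero 120 hq0)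
  rw [show w / q ^ 5 * q ^ 25 = w * q ^ 20 by field_simp] at hs
  simp only [sum_range_succ, sum_range_zero, Nat.cast_zero, Nat.cast_one, Nat.cast_ofNat, t2, t3,
    t4, tri_zero, tri_one] at h
  norm_num [zpow_ofNat] at h
  rw [h, hs, show (q ^ 25) ^ 3 = q ^ 75 by ring, show q ^ 75 / (q ^ 5) ^ 3 = q ^ 60 by field_simp,
    show q ^ 75 * (q ^ 5) ^ 3 = q ^ 90 by ring, show q ^ 75 / (q ^ 10) ^ 3 = q ^ 45 by field_simp,
    show q ^ 75 * (q ^ 10) ^ 3 = q ^ 105 by ring, show q ^ 120 / q ^ 75 = q ^ 45 by field_simp]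
  field_simp
  ring

/-- Here the centre is the class r = 2, with x = w q^10; its neighbours are 1 and 3 for Z = q^5, and
0 and 4 for Z = q^10, so no period shift is needed. -/
lemma lamFive_three_eq {w q : ℂ} (hq0 : q ≠ 0) (hq : ‖q‖ < 1) (hw : w ≠ 0) :
    lamFive w (q ^ 3) q = q ^ 9 * lam (w * q ^ 10) ((q ^ 25) ^ 3) (q ^ 25) -
      q ^ 3 * (lam (w * q ^ 5) ((q ^ 25) ^ 3 / (q ^ 5) ^ 3) (q ^ 25) +
        (q ^ 5) ^ 3 * lam (w * q ^ 15) ((q ^ 25) ^ 3 * (q ^ 5) ^ 3) (q ^ 25)) +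
      (lam w ((q ^ 25) ^ 3 / (q ^ 10) ^ 3) (q ^ 25) +
        (q ^ 10) ^ 3 * lam (w * q ^ 20) ((q ^ 25) ^ 3 * (q ^ 10) ^ 3) (q ^ 25)) := by
  have h := lamFive_eq_sum hq0 hq hw 3
  have h6 : q ^ (3 : ℤ) = q ^ 3 := by norm_cast
  rw [h6] at h
  have t3 : tri 3 = 3 := rfl
  have t4 : tri 4 = 6 := rfl
  have t2 : tri 2 = 1 := rfl
  simp only [sum_range_succ, sum_range_zero, Nat.cast_zero, Nat.cast_one, Nat.cast_ofNat, t2, t3,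
    t4, tri_zero, tri_one] at h
  norm_num [zpow_ofNat] at h
  rw [h, show (q ^ 25) ^ 3 = q ^ 75 by ring, show q ^ 75 / (q ^ 5) ^ 3 = q ^ 60 by field_simp,
    show q ^ 75 * (q ^ 5) ^ 3 = q ^ 90 by ring, show q ^ 75 / (q ^ 10) ^ 3 = q ^ 45 by field_simp,
    show q ^ 75 * (q ^ 10) ^ 3 = q ^ 105 by ring]
  ring

lemma one_sub_mul_zpow_of_dvd {w q : ℂ} (h : ∀ i : ℤ, 1 - w * q ^ i ≠ 0) (hq0 : q ≠ 0) (i : ℤ)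
    (m : ℕ) (k : ℤ) : 1 - w * q ^ i * (q ^ m) ^ k ≠ 0 := by
  rw [mul_assoc, ← zpow_natCast q m, ← zpow_mul, ← zpow_add₀ hq0]
  exact h _

lemma jTheta_five_two {q : ℂ} (hq0 : q ≠ 0) :
    jTheta (q ^ 20) (q ^ 25) = jTheta (q ^ 5) (q ^ 25) := by
  rw [show q ^ 20 = q ^ 25 / q ^ 5 by field_simp,
    jTheta_q_div (pow_ne_zero 5 hq0) (pow_ne_zero 25 hq0)]

/-- The addition formula applied to both pairs away from all poles. It serves to identify the
coefficient of the central series, by comparing v with v q^25. -/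
lemma lamFive_six_generic {q v : ℂ} (hq0 : q ≠ 0) (hq : ‖q‖ < 1) (hv : v ≠ 0)
    (h0 : ∀ k : ℤ, 1 - v * (q ^ 25) ^ k ≠ 0)
    (hn : ∀ (a : ℕ) (k : ℤ), 1 - v * q ^ a * (q ^ 25) ^ k ≠ 0)
    (hd : ∀ k : ℤ, 1 - v / q ^ 5 * (q ^ 25) ^ k ≠ 0) :
    lamFive v (q ^ 6) q = q ^ 5 * (jTheta (q ^ 10) (q ^ 25) / jTheta (q ^ 5) (q ^ 25) - q -
        q ^ 2 * (jTheta (q ^ 5) (q ^ 25) / jTheta (q ^ 10) (q ^ 25))) *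
          lam (v * q ^ 5) ((q ^ 25) ^ 3) (q ^ 25) +
        qPochInf (q ^ 25) (q ^ 25) ^ 3 * (jTheta (q ^ 5) (q ^ 25) * jTheta (q ^ 10) (q ^ 25)) *
        (1 / (jTheta v (q ^ 25) * jTheta (v * q ^ 5) (q ^ 25) * jTheta (v * q ^ 10) (q ^ 25)) -
          (q ^ 3)⁻¹ / (jTheta (v / q ^ 5) (q ^ 25) * jTheta (v * q ^ 5) (q ^ 25) *
            jTheta (v * q ^ 15) (q ^ 25))) := by
  have hQ0 : q ^ 25 ≠ 0 := pow_ne_zero _ hq0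
  have hQ : ‖q ^ 25‖ < 1 := norm_pow_lt_one hq (by norm_num)
  have n5 := fun k => one_sub_pow_mul_zpow_ne_zero hq (a := 5) (m := 25) (by norm_num) k
  have n10 := fun k => one_sub_pow_mul_zpow_ne_zero hq (a := 10) (m := 25) (by norm_num) k
  have n20 := fun k => one_sub_pow_mul_zpow_ne_zero hq (a := 20) (m := 25) (by norm_num) k
  have p5 : q ^ 5 ≠ 0 := pow_ne_zero _ hq0
  have p10 : q ^ 10 ≠ 0 := pow_ne_zero _ hq0
  have e1 : (q ^ 5) ^ 2 = q ^ 10 := by ring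
  have e2 : (q ^ 10) ^ 2 = q ^ 20 := by ring
  have f1 : v * q ^ 5 / q ^ 5 = v := by field_simp
  have f2 : v * q ^ 5 * q ^ 5 = v * q ^ 10 := by ring
  have f3 : v * q ^ 5 / q ^ 10 = v / q ^ 5 := by field_simp
  have f4 : v * q ^ 5 * q ^ 10 = v * q ^ 15 := by ring
  have k1 := lam_add_lam (x := v * q ^ 5) (Z := q ^ 5) hQ0 hQ (mul_ne_zero hv p5) p5 n5
    (by rwa [e1]) (by rwa [f1]) (hn 5) (by rw [f2]; exact hn 10)
  have k2 := lam_add_lam (x := v * q ^ 5) (Z := q ^ 10) hQ0 hQ (mul_ne_zero hv p5) p10 n10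
    (by rwa [e2]) (by rwa [f3]) (hn 5) (by rw [f4]; exact hn 15)
  rw [f1, f2, e1] at k1
  rw [f3, f4, e2, jTheta_five_two hq0] at k2
  rw [lamFive_six_eq hq0 hq hv, k1, k2]
  have nn1 := jTheta_ne_zero p5 hQ0 hQ n5
  have nn2 := jTheta_ne_zero p10 hQ0 hQ n10
  generalize lam (v * q ^ 5) ((q ^ 25) ^ 3) (q ^ 25) = L
  generalize jTheta (q ^ 5) (q ^ 25) = P1 at *
  generalize jTheta (q ^ 10) (q ^ 25) = P2 at *
  generalize jTheta v (q ^ 25) * jTheta (v * q ^ 5) (q ^ 25) * jTheta (v * q ^ 10) (q ^ 25) = A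
  generalize jTheta (v / q ^ 5) (q ^ 25) * jTheta (v * q ^ 5) (q ^ 25) *
    jTheta (v * q ^ 15) (q ^ 25) = B
  generalize qPochInf (q ^ 25) (q ^ 25) = J
  have hq3 : (q ^ 3)⁻¹ * q ^ 10 = q ^ 7 := by field_simp
  linear_combination (-L * P1 / P2) * hq3

/-- The generic dissection at w and at w q^25 are two expressions linked by quasi-periodicity. The
left sides differ by multiples of (q;q)_∞, the central series by multiples of (q^25;q^25)_∞ times
the coefficient in question, and the theta parts are proportional. Eliminating everything else
leaves the identity. -/
lemma qPochInf_dissection {q : ℂ} (hq0 : q ≠ 0) (hq : ‖q‖ < 1) :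
    qPochInf q q = qPochInf (q ^ 25) (q ^ 25) *
      (jTheta (q ^ 10) (q ^ 25) / jTheta (q ^ 5) (q ^ 25) - q -
        q ^ 2 * (jTheta (q ^ 5) (q ^ 25) / jTheta (q ^ 10) (q ^ 25))) := by
  have hr0 : 0 < ‖q‖ := norm_pos_iff.2 hq0
  -- With ‖w‖² = ‖q‖ every w q^i has norm ‖q‖^(i + 1/2) ≠ 1. This avoids all poles and also excludes
  -- w q^5 = -1, needed for the final cancellation.
  set w : ℂ := ((Real.sqrt ‖q‖ : ℝ) : ℂ) with hw
  have hwn : ‖w‖ = Real.sqrt ‖q‖ := by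
    rw [hw, Complex.norm_real, Real.norm_of_nonneg (Real.sqrt_nonneg _)]
  have hw0 : w ≠ 0 := by
    rw [← norm_pos_iff, hwn]; exact Real.sqrt_pos.2 hr0
  have hnorm : ∀ i : ℤ, ‖w * q ^ i‖ ≠ 1 := by
    intro i hi
    have h2 : ‖w * q ^ i‖ ^ 2 = ‖q‖ ^ (2 * i + 1) := by
      rw [norm_mul, mul_pow, hwn, Real.sq_sqrt hr0.le, norm_zpow, zpow_add₀ hr0.ne', zpow_mul',
        zpow_one]
      rw [mul_comm]; norm_cast
    rw [hi, one_pow] at h2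
    have := (zpow_eq_one_iff_right₀ hr0.le hq.ne).1 h2.symm
    omega
  have hgen : ∀ i : ℤ, 1 - w * q ^ i ≠ 0 := fun i h => hnorm i (by
    rw [← sub_eq_zero.1 h, norm_one])
  have hg := one_sub_mul_zpow_of_dvd hgen hq0
  have g0 : ∀ k : ℤ, 1 - w * (q ^ 25) ^ k ≠ 0 := by simpa using hg 0 25
  have gn : ∀ (a : ℕ) (k : ℤ), 1 - w * q ^ a * (q ^ 25) ^ k ≠ 0 := fun a => by simpa using hg a 25
  have gd : ∀ k : ℤ, 1 - w / q ^ 5 * (q ^ 25) ^ k ≠ 0 := by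
    intro k
    have := hg (-5) 25 k
    rw [zpow_neg] at this
    rw [div_eq_mul_inv]
    exact_mod_cast this
  have hQ0 : q ^ 25 ≠ 0 := pow_ne_zero _ hq0
  have hQ : ‖q ^ 25‖ < 1 := norm_pow_lt_one hq (by norm_num)
  have p5 : q ^ 5 ≠ 0 := pow_ne_zero _ hq0
  have p10 : q ^ 10 ≠ 0 := pow_ne_zero _ hq0
  have m1 := lamFive_six_generic hq0 hq hw0 g0 gn gd
  have hwQ : w * q ^ 25 ≠ 0 := mul_ne_zero hw0 hQ0
  have sh : ∀ (v : ℂ), (∀ k : ℤ, 1 - v * (q ^ 25) ^ k ≠ 0) →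
      ∀ k : ℤ, 1 - v * q ^ 25 * (q ^ 25) ^ k ≠ 0 := by
    intro v hv k
    rw [mul_assoc, ← zpow_one_add₀ hQ0]; exact hv _
  have r1 : ∀ a : ℕ, w * q ^ 25 * q ^ a = w * q ^ a * q ^ 25 := fun a => by ring
  have r2 : w * q ^ 25 / q ^ 5 = w / q ^ 5 * q ^ 25 := by ring
  have m2 := lamFive_six_generic hq0 hq hwQ (sh w g0) (fun a => by rw [r1]; exact sh _ (gn a))
    (by rw [r2]; exact sh _ gd)
  rw [r1, r1, r1, r2, lam_mul_q_cube hQ0 hQ (mul_ne_zero hw0 p5) (gn 5),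
    jTheta_mul_q hw0 hQ0 hQ, jTheta_mul_q (mul_ne_zero hw0 p5) hQ0 hQ,
    jTheta_mul_q (mul_ne_zero hw0 p10) hQ0 hQ,
    jTheta_mul_q (mul_ne_zero hw0 (pow_ne_zero 15 hq0)) hQ0 hQ,
    jTheta_mul_q (div_ne_zero hw0 p5) hQ0 hQ, lamFive_mul hq0 (pow_ne_zero 6 hq0)] at m2
  have h5 : ∀ k : ℤ, 1 - w * (q ^ 5) ^ k ≠ 0 := by simpa using hg 0 5
  have hq3 : q ^ 3 ≠ 0 := pow_ne_zero _ hq0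
  have hq3' : ‖q ^ 3‖ < 1 := norm_pow_lt_one hq (by norm_num)
  have t1 := jTheta_self_cube hq0 hq
  have t2 : jTheta ((q ^ 4)⁻¹) (q ^ 3) = (q ^ 5)⁻¹ * qPochInf q q := by
    have a1 := jTheta_mul_q (x := (q ^ 4)⁻¹) (inv_ne_zero (pow_ne_zero 4 hq0)) hq3 hq3'
    have a2 := jTheta_inv hq0 hq3' (x := q)
    rw [show (q ^ 4)⁻¹ * q ^ 3 = q⁻¹ by field_simp, a2, t1] at a1
    field_simp at a1 ⊢
    linear_combination a1
  have t3 : jTheta ((q ^ 9)⁻¹) (q ^ 3) = 0 := by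
    have a1 := jTheta_mul_q (x := (q ^ 9)⁻¹) (inv_ne_zero (pow_ne_zero 9 hq0)) hq3 hq3'
    have a2 := jTheta_mul_q (x := (q ^ 6)⁻¹) (inv_ne_zero (pow_ne_zero 6 hq0)) hq3 hq3'
    have a3 := jTheta_mul_q (x := (q ^ 3)⁻¹) (inv_ne_zero (pow_ne_zero 3 hq0)) hq3 hq3'
    rw [show (q ^ 9)⁻¹ * q ^ 3 = (q ^ 6)⁻¹ by field_simp] at a1
    rw [show (q ^ 6)⁻¹ * q ^ 3 = (q ^ 3)⁻¹ by field_simp, a1] at a2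
    rw [show (q ^ 3)⁻¹ * q ^ 3 = 1 by field_simp, a2, jTheta_one hq3'] at a3
    field_simp at a3
    simpa [hq0] using a3
  have s1 := lamFive_sub hq0 hq hw0 hq0 h5
  have s2 := lamFive_sub hq0 hq hw0 (inv_ne_zero (pow_ne_zero 4 hq0)) h5
  have s3 := lamFive_sub hq0 hq hw0 (inv_ne_zero (pow_ne_zero 9 hq0)) h5
  rw [t1, show q * q ^ 5 = q ^ 6 by ring] at s1
  rw [t2, show (q ^ 4)⁻¹ * q ^ 5 = q by field_simp] at s2
  rw [t3, show (q ^ 9)⁻¹ * q ^ 5 = (q ^ 4)⁻¹ by field_simp] at s3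
  rw [show q ^ 6 / q ^ 15 = (q ^ 9)⁻¹ by field_simp,
    show q ^ 45 / (q ^ 6) ^ 5 = q ^ 15 by field_simp] at m2
  have hne : w * q ^ 5 + 1 ≠ 0 := by
    intro h
    apply hnorm 5
    have h1 : w * q ^ (5 : ℤ) = -1 := by
      rw [show q ^ (5 : ℤ) = q ^ 5 by norm_cast]; linear_combination h
    rw [h1, norm_neg, norm_one]
  have nn1 := jTheta_ne_zero hw0 hQ0 hQ g0
  have nn2 := jTheta_ne_zero (mul_ne_zero hw0 p5) hQ0 hQ (gn 5)
  have nn3 := jTheta_ne_zero (mul_ne_zero hw0 p10) hQ0 hQ (gn 10)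
  have nn4 := jTheta_ne_zero (mul_ne_zero hw0 (pow_ne_zero 15 hq0)) hQ0 hQ (gn 15)
  have nn5 := jTheta_ne_zero (div_ne_zero hw0 p5) hQ0 hQ gd
  generalize jTheta w (q ^ 25) = A0 at *
  generalize jTheta (w * q ^ 5) (q ^ 25) = A1 at *
  generalize jTheta (w * q ^ 10) (q ^ 25) = A2 at *
  generalize jTheta (w * q ^ 15) (q ^ 25) = A3 at *
  generalize jTheta (w / q ^ 5) (q ^ 25) = A4 at *
  generalize (jTheta (q ^ 10) (q ^ 25) / jTheta (q ^ 5) (q ^ 25) - q -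
        q ^ 2 * (jTheta (q ^ 5) (q ^ 25) / jTheta (q ^ 10) (q ^ 25))) = κ at *
  generalize qPochInf (q ^ 25) (q ^ 25) ^ 3 * (jTheta (q ^ 5) (q ^ 25) * jTheta (q ^ 10) (q ^ 25))
    = K at *
  generalize qPochInf (q ^ 25) (q ^ 25) = J at *
  generalize lam (w * q ^ 5) ((q ^ 25) ^ 3) (q ^ 25) = L at *
  -- Both theta products acquire the same multiplier -(w q^5)³ under the shift, which is also the
  -- multiplier of the central series up to its inhomogeneous term.
  have m3 : 1 / (-w⁻¹ * A0 * (-(w * q ^ 5)⁻¹ * A1) * (-(w * q ^ 10)⁻¹ * A2)) -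
      (q ^ 3)⁻¹ / (-(w / q ^ 5)⁻¹ * A4 * (-(w * q ^ 5)⁻¹ * A1) * (-(w * q ^ 15)⁻¹ * A3)) =
      -(w * q ^ 5) ^ 3 * (1 / (A0 * A1 * A2) - (q ^ 3)⁻¹ / (A4 * A1 * A3)) := by
    field_simp
    ring
  rw [m3] at m2
  have fin : w * (w * q ^ 5 + 1) * q ^ 10 * (qPochInf q q - J * κ) = 0 := by
    have hq5 : q ^ 5 * (q ^ 5)⁻¹ = 1 := mul_inv_cancel₀ p5
    linear_combination (-1) * m2 + (-(w * q ^ 5) ^ 3) * m1 - q ^ 15 * s3 - q ^ 15 * w * s2 -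
      q ^ 15 * w ^ 2 * s1 - w * q ^ 10 * qPochInf q q * hq5
  have hz := (mul_eq_zero.1 fin).resolve_left
    (mul_ne_zero (mul_ne_zero hw0 hne) (pow_ne_zero _ hq0))
  linear_combination hz

/-- At w = 1 the class r = 0 has a pole, so the pair with Z = q^5 needs `lam_one_add_lam` while the
pair with Z = q^10 is regular. The coefficient of the central series is recognised by
`qPochInf_dissection`. -/
lemma lamFive_one_six {q : ℂ} (hq0 : q ≠ 0) (hq : ‖q‖ < 1) :
    lamFive 1 (q ^ 6) q =
      q ^ 5 * (qPochInf q q / qPochInf (q ^ 25) (q ^ 25)) * lam (q ^ 5) ((q ^ 25) ^ 3) (q ^ 25) +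
        (ell (q ^ 5) (q ^ 25) + ell (q ^ 10) (q ^ 25)) +
        q ^ 2 * qPochInf (q ^ 25) (q ^ 25) ^ 3 / jTheta (q ^ 5) (q ^ 25) := by
  have hQ0 : q ^ 25 ≠ 0 := pow_ne_zero _ hq0
  have hQ : ‖q ^ 25‖ < 1 := norm_pow_lt_one hq (by norm_num)
  have n5 := fun k => one_sub_pow_mul_zpow_ne_zero hq (a := 5) (m := 25) (by norm_num) k
  have n10 := fun k => one_sub_pow_mul_zpow_ne_zero hq (a := 10) (m := 25) (by norm_num) k
  have n15 := fun k => one_sub_pow_mul_zpow_ne_zero hq (a := 15) (m := 25) (by norm_num) k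
  have n20 := fun k => one_sub_pow_mul_zpow_ne_zero hq (a := 20) (m := 25) (by norm_num) k
  have p5 : q ^ 5 ≠ 0 := pow_ne_zero _ hq0
  have p10 : q ^ 10 ≠ 0 := pow_ne_zero _ hq0
  have e1 : (q ^ 5) ^ 2 = q ^ 10 := by ring
  have e2 : (q ^ 10) ^ 2 = q ^ 20 := by ring
  have f3 : q ^ 5 / q ^ 10 = (q ^ 5)⁻¹ := by field_simp
  have f4 : q ^ 5 * q ^ 10 = q ^ 15 := by ring
  have nm5 : ∀ k : ℤ, 1 - (q ^ 5)⁻¹ * (q ^ 25) ^ k ≠ 0 := by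
    intro k
    have h := n20 (k - 1)
    rwa [zpow_sub_one₀ hQ0, show q ^ 20 * ((q ^ 25) ^ k * (q ^ 25)⁻¹) =
      (q ^ 5)⁻¹ * (q ^ 25) ^ k by field_simp] at h
  have k1 := lam_one_add_lam (Z := q ^ 5) hQ0 hQ p5 n5 (by rw [e1]; exact n10)
  have k2 := lam_add_lam (x := q ^ 5) (Z := q ^ 10) hQ0 hQ p5 p10 n10
    (by rw [e2]; exact n20) (by rw [f3]; exact nm5) n5 (by rw [f4]; exact n15)
  have j15 : jTheta (q ^ 15) (q ^ 25) = jTheta (q ^ 10) (q ^ 25) := by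
    rw [show q ^ 15 = q ^ 25 / q ^ 10 by field_simp, jTheta_q_div p10 hQ0]
  rw [e1] at k1
  rw [f3, f4, e2, jTheta_five_two hq0, j15, jTheta_inv p5 hQ] at k2
  rw [lamFive_six_eq hq0 hq one_ne_zero, one_mul (q ^ 5), one_mul (q ^ 10), one_mul (q ^ 15), one_div (q ^ 5), k1, k2,
    qPochInf_dissection hq0 hq]
  have nn1 := jTheta_ne_zero p5 hQ0 hQ n5
  have nn2 := jTheta_ne_zero p10 hQ0 hQ n10
  have nJ := qPochInf_self_ne_zero hQ
  generalize lam (q ^ 5) ((q ^ 25) ^ 3) (q ^ 25) = L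
  generalize jTheta (q ^ 5) (q ^ 25) = P1 at *
  generalize jTheta (q ^ 10) (q ^ 25) = P2 at *
  generalize qPochInf (q ^ 25) (q ^ 25) = J at *
  generalize ell (q ^ 5) (q ^ 25) = l1
  generalize ell (q ^ 10) (q ^ 25) = l2
  clear k1 k2 n5 n10 n15 n20 nm5
  field_simp
  ring

/-- Here the pole lies in the pair with Z = q^10, and the pair with Z = q^5 is regular. -/
lemma lamFive_one_three {q : ℂ} (hq0 : q ≠ 0) (hq : ‖q‖ < 1) :
    lamFive 1 (q ^ 3) q =
      -q ^ 8 * (qPochInf q q / qPochInf (q ^ 25) (q ^ 25)) *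
          lam (q ^ 10) ((q ^ 25) ^ 3) (q ^ 25) +
        (ell (q ^ 10) (q ^ 25) - ell (q ^ 5) (q ^ 25)) -
        q ^ 3 * qPochInf (q ^ 25) (q ^ 25) ^ 3 / jTheta (q ^ 10) (q ^ 25) := by
  have hQ0 : q ^ 25 ≠ 0 := pow_ne_zero _ hq0
  have hQ : ‖q ^ 25‖ < 1 := norm_pow_lt_one hq (by norm_num)
  have n5 := fun k => one_sub_pow_mul_zpow_ne_zero hq (a := 5) (m := 25) (by norm_num) k
  have n10 := fun k => one_sub_pow_mul_zpow_ne_zero hq (a := 10) (m := 25) (by norm_num) k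
  have n15 := fun k => one_sub_pow_mul_zpow_ne_zero hq (a := 15) (m := 25) (by norm_num) k
  have n20 := fun k => one_sub_pow_mul_zpow_ne_zero hq (a := 20) (m := 25) (by norm_num) k
  have p5 : q ^ 5 ≠ 0 := pow_ne_zero _ hq0
  have p10 : q ^ 10 ≠ 0 := pow_ne_zero _ hq0
  have e1 : (q ^ 5) ^ 2 = q ^ 10 := by ring
  have e2 : (q ^ 10) ^ 2 = q ^ 20 := by ring
  have f3 : q ^ 10 / q ^ 5 = q ^ 5 := by field_simp
  have f4 : q ^ 10 * q ^ 5 = q ^ 15 := by ring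
  have k1 := lam_one_add_lam (Z := q ^ 10) hQ0 hQ p10 n10 (by rw [e2]; exact n20)
  have k2 := lam_add_lam (x := q ^ 10) (Z := q ^ 5) hQ0 hQ p10 p5 n5
    (by rw [e1]; exact n10) (by rw [f3]; exact n5) n10 (by rw [f4]; exact n15)
  have j15 : jTheta (q ^ 15) (q ^ 25) = jTheta (q ^ 10) (q ^ 25) := by
    rw [show q ^ 15 = q ^ 25 / q ^ 10 by field_simp, jTheta_q_div p10 hQ0]
  have nn1 := jTheta_ne_zero p5 hQ0 hQ n5
  have nn2 := jTheta_ne_zero p10 hQ0 hQ n10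
  have l20 : ell (q ^ 20) (q ^ 25) = -ell (q ^ 5) (q ^ 25) := by
    rw [show q ^ 20 = q ^ 25 / q ^ 5 by field_simp, ell_q_div p5 hQ0 hQ nn1]
  rw [e2, jTheta_five_two hq0, l20] at k1
  rw [f3, f4, e1, j15] at k2
  rw [lamFive_three_eq hq0 hq one_ne_zero, one_mul (q ^ 5), one_mul (q ^ 10), one_mul (q ^ 15), one_mul (q ^ 20), k1, k2,
    qPochInf_dissection hq0 hq]
  have nJ := qPochInf_self_ne_zero hQ
  generalize lam (q ^ 10) ((q ^ 25) ^ 3) (q ^ 25) = L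
  generalize jTheta (q ^ 5) (q ^ 25) = P1 at *
  generalize jTheta (q ^ 10) (q ^ 25) = P2 at *
  generalize qPochInf (q ^ 25) (q ^ 25) = J at *
  generalize ell (q ^ 5) (q ^ 25) = l1
  generalize ell (q ^ 10) (q ^ 25) = l2
  clear k1 k2 n5 n10 n15 n20
  field_simp
  ring

/-! ### Return to g and the theta constants -/

lemma J₁_eq {q : ℂ} {m : ℕ} (hm : m ≠ 0) (hq0 : q ≠ 0) (hq : ‖q‖ < 1) :
    J₁ m q = qPochInf (q ^ m) (q ^ m) := by
  rw [J₁, J₂, zpow_natCast, mul_comm 3 m, pow_mul,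
    jTheta_self_cube (pow_ne_zero m hq0) (norm_pow_lt_one hq hm)]

lemma gMock_pow_eq_lam {q : ℂ} {a m : ℕ} (hq0 : q ≠ 0) (hq : ‖q‖ < 1) (hm : m ≠ 0)
    (h : ¬ m ∣ a) :
    gMock (q ^ a) (q ^ m) = lam (q ^ a) ((q ^ m) ^ 3) (q ^ m) / qPochInf (q ^ m) (q ^ m) :=
  gMock_eq_lam (pow_ne_zero a hq0) (pow_ne_zero m hq0) (norm_pow_lt_one hq hm)
    (one_sub_pow_mul_zpow_ne_zero hq h)

lemma lamFive_one_six_eq_gMock {q : ℂ} (hq0 : q ≠ 0) (hq : ‖q‖ < 1) :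
    lamFive 1 (q ^ 6) q = 2 / 5 - qPochInf q q * (-q ^ 5 * gMock (q ^ 5) (q ^ 25) +
      2 / 5 * (J₁ 5 q * J₁ 25 q ^ 3 / J₂ 5 25 q ^ 3) + 2 / 5 * q * (J₁ 25 q ^ 2 / J₂ 5 25 q) -
      1 / 5 * q ^ 2 * (J₁ 25 q ^ 2 / J₂ 10 25 q) +
      1 / 5 * q ^ 3 * (J₁ 5 q * J₁ 25 q ^ 3 / J₂ 10 25 q ^ 3)) := by
  have p5 : q ^ 5 ≠ 0 := pow_ne_zero _ hq0
  have hp : ‖q ^ 5‖ < 1 := norm_pow_lt_one hq (by norm_num)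
  have hQ : ‖q ^ 25‖ < 1 := norm_pow_lt_one hq (by norm_num)
  have nn1 := jTheta_pow_ne_zero hq0 hq (a := 5) (m := 25) (by norm_num) (by norm_num)
  have nn2 := jTheta_pow_ne_zero hq0 hq (a := 10) (m := 25) (by norm_num) (by norm_num)
  have nJ := qPochInf_self_ne_zero hQ
  have a1 := three_ell_one_add_ell_two p5 hp
  have a2 := three_ell_two_sub_ell_one p5 hp
  have a3 := qPochInf_self_eq_five p5 hp
  rw [pow_one, ← pow_mul, ← pow_mul] at a1 a2 a3
  norm_num only at a1 a2 a3
  have a4 : qPochInf (q ^ 5) (q ^ 5) = jTheta (q ^ 5) (q ^ 25) * jTheta (q ^ 10) (q ^ 25) /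
      qPochInf (q ^ 25) (q ^ 25) := by rw [← a3]; field_simp
  -- Solves the linear system of the two evaluated combinations. The constant 1 in the first of them
  -- is the origin of the term 2/5.
  have a5 : ell (q ^ 5) (q ^ 25) + ell (q ^ 10) (q ^ 25) =
      (2 * (3 * ell (q ^ 5) (q ^ 25) + ell (q ^ 10) (q ^ 25)) +
        (3 * ell (q ^ 10) (q ^ 25) - ell (q ^ 5) (q ^ 25))) / 5 := by ring
  rw [lamFive_one_six hq0 hq, J₁_eq (by norm_num) hq0 hq, J₁_eq (by norm_num) hq0 hq, J₂, J₂,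
    gMock_pow_eq_lam hq0 hq (by norm_num) (by norm_num), a4, a5, a1, a2,
    show q ^ (5 : ℤ) = q ^ 5 by norm_cast, show q ^ (10 : ℤ) = q ^ 10 by norm_cast,
    qPochInf_dissection hq0 hq]
  generalize lam (q ^ 5) ((q ^ 25) ^ 3) (q ^ 25) = L
  generalize jTheta (q ^ 5) (q ^ 25) = P1 at *
  generalize jTheta (q ^ 10) (q ^ 25) = P2 at *
  generalize qPochInf (q ^ 25) (q ^ 25) = J at *
  clear a1 a2 a3 a4 a5
  field_simp
  ring

lemma lamFive_one_three_eq_gMock {q : ℂ} (hq0 : q ≠ 0) (hq : ‖q‖ < 1) :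
    lamFive 1 (q ^ 3) q = -(1 / 5) + qPochInf q q * (-q ^ 8 * gMock (q ^ 10) (q ^ 25) +
      1 / 5 * (J₁ 5 q * J₁ 25 q ^ 3 / J₂ 5 25 q ^ 3) + 1 / 5 * q * (J₁ 25 q ^ 2 / J₂ 5 25 q) +
      2 / 5 * q ^ 2 * (J₁ 25 q ^ 2 / J₂ 10 25 q) -
      2 / 5 * q ^ 3 * (J₁ 5 q * J₁ 25 q ^ 3 / J₂ 10 25 q ^ 3)) := by
  have p5 : q ^ 5 ≠ 0 := pow_ne_zero _ hq0
  have hp : ‖q ^ 5‖ < 1 := norm_pow_lt_one hq (by norm_num)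
  have hQ : ‖q ^ 25‖ < 1 := norm_pow_lt_one hq (by norm_num)
  have nn1 := jTheta_pow_ne_zero hq0 hq (a := 5) (m := 25) (by norm_num) (by norm_num)
  have nn2 := jTheta_pow_ne_zero hq0 hq (a := 10) (m := 25) (by norm_num) (by norm_num)
  have nJ := qPochInf_self_ne_zero hQ
  have a1 := three_ell_one_add_ell_two p5 hp
  have a2 := three_ell_two_sub_ell_one p5 hp
  have a3 := qPochInf_self_eq_five p5 hp
  rw [pow_one, ← pow_mul, ← pow_mul] at a1 a2 a3
  norm_num only at a1 a2 a3
  have a4 : qPochInf (q ^ 5) (q ^ 5) = jTheta (q ^ 5) (q ^ 25) * jTheta (q ^ 10) (q ^ 25) /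
      qPochInf (q ^ 25) (q ^ 25) := by rw [← a3]; field_simp
  have a5 : ell (q ^ 10) (q ^ 25) - ell (q ^ 5) (q ^ 25) =
      (2 * (3 * ell (q ^ 10) (q ^ 25) - ell (q ^ 5) (q ^ 25)) -
        (3 * ell (q ^ 5) (q ^ 25) + ell (q ^ 10) (q ^ 25))) / 5 := by ring
  rw [lamFive_one_three hq0 hq, J₁_eq (by norm_num) hq0 hq, J₁_eq (by norm_num) hq0 hq, J₂, J₂,
    gMock_pow_eq_lam hq0 hq (by norm_num) (by norm_num), a4, a5, a1, a2,
    show q ^ (5 : ℤ) = q ^ 5 by norm_cast, show q ^ (10 : ℤ) = q ^ 10 by norm_cast,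
    qPochInf_dissection hq0 hq]
  generalize lam (q ^ 10) ((q ^ 25) ^ 3) (q ^ 25) = L
  generalize jTheta (q ^ 5) (q ^ 25) = P1 at *
  generalize jTheta (q ^ 10) (q ^ 25) = P2 at *
  generalize qPochInf (q ^ 25) (q ^ 25) = J at *
  clear a1 a2 a3 a4 a5
  field_simp
  ring

/-! ### Fine's transformation -/

lemma qPoch_add (x q : ℂ) (m n : ℕ) : qPoch x q (m + n) = qPoch x q m * qPoch (q ^ m * x) q n := by
  simp only [qPoch, prod_range_add]
  congr 1
  exact prod_congr rfl fun i _ => by ring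

/-- Telescoping of t^n/(b;q)_n against its shift. The equation replaces (b, t) by (qb, qt), and
iterating it yields Fine's transformation. -/
lemma one_sub_mul_tsum_pow_div_qPoch {b t q : ℂ} (hq : ‖q‖ < 1) (ht : ‖t‖ < 1)
    (hb : ∀ i : ℕ, 1 - q ^ i * b ≠ 0) :
    (1 - t) * ∑' n : ℕ, t ^ n / qPoch b q n =
      1 + b * t / (1 - b) * ∑' n : ℕ, (q * t) ^ n / qPoch (q * b) q n := by
  obtain ⟨C, hC0, hC⟩ := exists_norm_inv_qPoch_le hq hb
  have hs : Summable fun n : ℕ => t ^ n / qPoch b q n := by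
    refine Summable.of_norm_bounded
      ((summable_geometric_of_lt_one (norm_nonneg _) ht).mul_right C) fun n => ?_
    rw [div_eq_mul_inv, norm_mul, norm_pow]
    exact mul_le_mul_of_nonneg_left (hC n) (by positivity)
  rw [sub_mul, one_mul, ← tsum_mul_left, hs.tsum_eq_zero_add, ← tsum_mul_left, pow_zero,
    qPoch_zero, div_one, add_sub_assoc, ← ((summable_nat_add_iff 1).2 hs).tsum_sub (hs.mul_left t)]
  congr 1
  refine tsum_congr fun n => ?_
  have h1 := qPoch_ne_zero hb (n + 1)
  have h2 := qPoch_ne_zero hb n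
  have h3 := h1
  have h4 := h1
  rw [qPoch_succ] at h3
  rw [qPoch_succ'] at h4
  have e : qPoch b q n * (1 - q ^ n * b) = (1 - b) * qPoch (q * b) q n := by
    rw [← qPoch_succ, ← qPoch_succ']
  have h5 := right_ne_zero_of_mul h3
  have h6 := right_ne_zero_of_mul h4
  have h7 := left_ne_zero_of_mul h4
  have e1 : b * t / (1 - b) * ((q * t) ^ n / qPoch (q * b) q n) =
      b * t * (q * t) ^ n / (qPoch b q n * (1 - q ^ n * b)) := by
    rw [e]; field_simp
  rw [e1, qPoch_succ]
  field_simp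
  ring

/-- Fine's transformation of `∑ tⁿ / (b; q)ₙ`. -/
lemma tsum_pow_div_qPoch {b t q : ℂ} (hq : ‖q‖ < 1) (ht : ‖t‖ < 1) (hbt : ‖b * t‖ < 1)
    (hb : ∀ i : ℕ, 1 - q ^ i * b ≠ 0) :
    ∑' n : ℕ, t ^ n / qPoch b q n =
      ∑' n : ℕ, (b * t) ^ n * q ^ (n * (n - 1)) / (qPoch b q n * qPoch t q (n + 1)) := by
  obtain ⟨C, hC0, hC⟩ := exists_norm_inv_qPoch_le hq hb
  obtain ⟨B, hB0, hB⟩ := exists_norm_qPoch_le hq b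
  have htn := one_sub_pow_mul_ne_zero hq ht
  obtain ⟨C', hC'0, hC'⟩ := exists_norm_inv_qPoch_le hq htn
  set Φ : ℕ → ℂ := fun N => ∑' n : ℕ, (q ^ N * t) ^ n / qPoch (q ^ N * b) q n with hΦ
  have hrec : ∀ N, (1 - q ^ N * t) * Φ N =
      1 + b * t * q ^ (2 * N) / (1 - q ^ N * b) * Φ (N + 1) := by
    intro N
    have h := one_sub_mul_tsum_pow_div_qPoch (b := q ^ N * b) (t := q ^ N * t) hq ?_ ?_
    · simp only [hΦ]
      rw [h, show q ^ N * b * (q ^ N * t) = b * t * q ^ (2 * N) by ring,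
        show q * (q ^ N * t) = q ^ (N + 1) * t by ring,
        show q * (q ^ N * b) = q ^ (N + 1) * b by ring]
    · rw [norm_mul, norm_pow]
      exact (mul_le_of_le_one_left (norm_nonneg _) (pow_le_one₀ (norm_nonneg _) hq.le)).trans_lt ht
    · intro i
      rw [← mul_assoc, ← pow_add]
      exact hb _
  -- A bound uniform in N, from 1/(q^N b;q)_n = (b;q)_N / (b;q)_(N+n). With ‖b t‖ < 1 it makes the
  -- remainder after N iterations vanish.
  have hbd : ∀ N, ‖Φ N‖ ≤ ∑' n : ℕ, ‖t‖ ^ n * (B * C) := by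
    intro N
    refine tsum_of_norm_bounded
      ((summable_geometric_of_lt_one (norm_nonneg _) ht).mul_right _).hasSum fun n => ?_
    have h1 : (qPoch (q ^ N * b) q n)⁻¹ = qPoch b q N * (qPoch b q (N + n))⁻¹ := by
      have := qPoch_ne_zero hb N
      have h2 := qPoch_ne_zero hb (N + n)
      rw [qPoch_add] at h2 ⊢
      have := right_ne_zero_of_mul h2
      field_simp
    rw [div_eq_mul_inv, norm_mul, h1, norm_mul, norm_pow, norm_mul, norm_pow]
    refine mul_le_mul (pow_le_pow_left₀ (by positivity)
      (mul_le_of_le_one_left (norm_nonneg _) (pow_le_one₀ (norm_nonneg _) hq.le)) _)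
      (mul_le_mul (hB _) (hC _) (norm_nonneg _) hB0.le) (by positivity) (by positivity)
  set a : ℕ → ℂ := fun n => (b * t) ^ n * q ^ (n * (n - 1)) / (qPoch b q n * qPoch t q (n + 1))
    with ha
  set r : ℕ → ℂ := fun n => (b * t) ^ n * q ^ (n * (n - 1)) / (qPoch b q n * qPoch t q n) with hr
  have hsum : ∀ N, Φ 0 = ∑ n ∈ range N, a n + r N * Φ N := by
    intro N
    induction N with
    | zero => simp [hr]
    | succ N ih =>
      rw [ih, sum_range_succ, add_assoc]
      congr 1
      have h1 := qPoch_ne_zero hb (N + 1)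
      have h2 := qPoch_ne_zero htn (N + 1)
      simp only [ha, hr]
      rw [qPoch_succ] at h1 h2 ⊢
      rw [qPoch_succ b]
      have h3 := right_ne_zero_of_mul h1
      have h4 := left_ne_zero_of_mul h1
      have h5 := right_ne_zero_of_mul h2
      have h6 := left_ne_zero_of_mul h2
      have h7 : Φ N = (1 + b * t * q ^ (2 * N) / (1 - q ^ N * b) * Φ (N + 1)) / (1 - q ^ N * t) := by
        rw [← hrec]; field_simp
      have h8 : q ^ ((N + 1) * (N + 1 - 1)) = q ^ (N * (N - 1)) * q ^ (2 * N) := by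
        rw [← pow_add]
        congr 1
        cases N with
        | zero => rfl
        | succ N => simp only [Nat.add_sub_cancel]; ring
      rw [h7, h8]
      field_simp
      ring
  have har : Summable a := by
    refine Summable.of_norm_bounded
      ((summable_geometric_of_lt_one (norm_nonneg _) hbt).mul_right (C * C')) fun n => ?_
    simp only [ha]
    rw [div_eq_mul_inv, norm_mul, mul_inv, norm_mul, norm_mul, norm_pow]
    refine mul_le_mul ?_ (mul_le_mul (hC _) (hC' _) (norm_nonneg _) hC0.le) (by positivity)
      (by positivity)
    rw [norm_pow]
    exact mul_le_of_le_one_right (by positivity) (pow_le_one₀ (norm_nonneg _) hq.le)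
  have hrt : Tendsto (fun N => r N * Φ N) atTop (𝓝 0) := by
    refine squeeze_zero_norm (a := fun N => ‖b * t‖ ^ N * (C * C' * ∑' n : ℕ, ‖t‖ ^ n * (B * C)))
      (fun n => ?_) ?_
    · rw [norm_mul, ← mul_assoc]
      refine mul_le_mul ?_ (hbd _) (norm_nonneg _) (by positivity)
      simp only [hr]
      rw [div_eq_mul_inv, norm_mul, mul_inv, norm_mul, norm_mul, norm_pow]
      refine mul_le_mul ?_ (mul_le_mul (hC _) (hC' _) (norm_nonneg _) hC0.le) (by positivity)
        (by positivity)
      rw [norm_pow]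
      exact mul_le_of_le_one_right (by positivity) (pow_le_one₀ (norm_nonneg _) hq.le)
    · simpa using (tendsto_pow_atTop_nhds_zero_of_lt_one (norm_nonneg _) hbt).mul_const _
  have hlim := har.hasSum.tendsto_sum_nat.add hrt
  simp_rw [← hsum] at hlim
  rw [add_zero] at hlim
  have := tendsto_nhds_unique hlim tendsto_const_nhds
  rw [this]
  simp [hΦ]

/-! ### The rank generating function -/

/-- The sum over all tuples of exponents of a product of geometric series. -/
lemma hasSum_prod_pow {𝕜 : Type*} [NormedField 𝕜] [CompleteSpace 𝕜] (L : ℕ) (a : Fin L → 𝕜)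
    (ha : ∀ i, ‖a i‖ < 1) :
    Summable (fun f : Fin L → ℕ => ‖∏ i, a i ^ f i‖) ∧
      HasSum (fun f : Fin L → ℕ => ∏ i, a i ^ f i) (∏ i, (1 - a i))⁻¹ := by
  induction L with
  | zero => exact ⟨Summable.of_finite, by simp⟩
  | succ L ih =>
    obtain ⟨h1, h2⟩ := ih (fun i => a i.succ) fun i => ha _
    have h3 := summable_norm_geometric_of_norm_lt_one (ha 0)
    have h4 := hasSum_geometric_of_norm_lt_one (ha 0)
    have h5 := h3.mul_norm h1
    have e : ∀ x : ℕ × (Fin L → ℕ), ∏ i, a i ^ (Fin.consEquiv (fun _ => ℕ) x) i =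
        a 0 ^ x.1 * ∏ i : Fin L, a i.succ ^ x.2 i := by
      intro x
      simp [Fin.prod_univ_succ]
    constructor
    · rw [← (Fin.consEquiv fun _ => ℕ).summable_iff]
      refine h5.congr fun x => ?_
      rw [Function.comp_apply, e]
    · rw [← (Fin.consEquiv fun _ => ℕ).hasSum_iff, Fin.prod_univ_succ, mul_inv]
      simp_rw [Function.comp_def, e]
      have h6 : Summable fun x : ℕ × (Fin L → ℕ) => a 0 ^ x.1 * ∏ i : Fin L, a i.succ ^ x.2 i :=
        Summable.of_norm h5
      have h7 := HasSum.mul h4 h2 h6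
      exact h7

/-- The multiset with `f i` copies of `i + 1`. -/
def multisetOfMultiplicity {L : ℕ} (f : Fin L → ℕ) : Multiset ℕ :=
  ∑ i, Multiset.replicate (f i) (i + 1 : ℕ)

lemma mem_multisetOfMultiplicity {L : ℕ} {f : Fin L → ℕ} {a : ℕ}
    (h : a ∈ multisetOfMultiplicity f) : 0 < a ∧ a ≤ L := by
  obtain ⟨i, -, hi⟩ := Multiset.mem_sum.1 h
  rw [Multiset.eq_of_mem_replicate hi]
  omega

lemma count_multisetOfMultiplicity {L : ℕ} (f : Fin L → ℕ) (i : Fin L) :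
    (multisetOfMultiplicity f).count (i + 1 : ℕ) = f i := by
  rw [multisetOfMultiplicity, Multiset.count_sum']
  simp [Multiset.count_replicate, Fin.val_inj]

lemma multisetOfMultiplicity_count {L : ℕ} (s : Multiset ℕ) (hs : ∀ a ∈ s, 0 < a ∧ a ≤ L) :
    multisetOfMultiplicity (fun i : Fin L => s.count (i + 1 : ℕ)) = s := by
  refine Multiset.ext.2 fun a => ?_
  by_cases ha : 0 < a ∧ a ≤ L
  · have := count_multisetOfMultiplicity (fun i : Fin L => s.count (i + 1 : ℕ)) ⟨a - 1, by omega⟩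
    simpa [Nat.sub_add_cancel ha.1] using this
  · rw [Multiset.count_eq_zero_of_notMem fun h => ha (mem_multisetOfMultiplicity h),
      Multiset.count_eq_zero_of_notMem fun h => ha (hs a h)]

/-- The parts of the partition with largest part `M` and given multiplicities of
`1, …, M`, not counting one copy of `M`. -/
def partsOfMultiplicity : (Σ M : ℕ, Fin M → ℕ) → Multiset ℕ
  | ⟨0, _⟩ => 0
  | ⟨M + 1, f⟩ => (M + 1) ::ₘ multisetOfMultiplicity f

lemma sup_partsOfMultiplicity (x : Σ M : ℕ, Fin M → ℕ) : (partsOfMultiplicity x).sup = x.1 := by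
  obtain ⟨_ | M, f⟩ := x
  · simp [partsOfMultiplicity]
  · rw [partsOfMultiplicity, Multiset.sup_cons]
    exact sup_eq_left.2 (Multiset.sup_le.2 fun b hb => (mem_multisetOfMultiplicity hb).2)

/-- The partition with largest part `M` and given multiplicities of
`1, …, M`, not counting one copy of `M`. -/
def partitionOfMultiplicity (x : Σ M : ℕ, Fin M → ℕ) : Σ n, Nat.Partition n :=
  ⟨(partsOfMultiplicity x).sum, partsOfMultiplicity x, by
    intro i hi
    obtain ⟨_ | M, f⟩ := x
    · simp [partsOfMultiplicity] at hi
    · rcases Multiset.mem_cons.1 hi with rfl | h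
      · omega
      · exact (mem_multisetOfMultiplicity h).1, rfl⟩

/-- Removing one copy of the largest part M leaves arbitrary multiplicities of 1, …, M; M itself is
recovered as the supremum. The empty partition is the case M = 0. -/
lemma bijective_partitionOfMultiplicity : Function.Bijective partitionOfMultiplicity := by
  constructor
  · intro x y h
    have h1 : partsOfMultiplicity x = partsOfMultiplicity y :=
      congrArg (fun P : Σ n, Nat.Partition n => P.2.parts) h
    obtain ⟨M, f⟩ := x
    obtain ⟨M', g⟩ := y
    obtain rfl : M = M' := by
      have := congrArg Multiset.sup h1
      rwa [sup_partsOfMultiplicity, sup_partsOfMultiplicity] at this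
    congr 1
    cases M with
    | zero => exact Subsingleton.elim _ _
    | succ M =>
      have h2 := (Multiset.cons_inj_right _).1 h1
      funext i
      rw [← count_multisetOfMultiplicity f, h2, count_multisetOfMultiplicity]
  · rintro ⟨n, P⟩
    suffices h : ∃ x, partsOfMultiplicity x = P.parts by
      obtain ⟨x, hx⟩ := h
      refine ⟨x, ?_⟩
      obtain ⟨s, hs, rfl⟩ := P
      simp only [partitionOfMultiplicity]
      subst hx
      rfl
    obtain ⟨s, hs, rfl⟩ := P
    rcases eq_or_ne s 0 with rfl | h0
    · exact ⟨⟨0, fun _ => 0⟩, rfl⟩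
    · obtain ⟨m, hm, hmax⟩ := s.toFinset.exists_max_image id
        (by rwa [Multiset.toFinset_nonempty])
      rw [Multiset.mem_toFinset] at hm
      have hm0 := hs hm
      refine ⟨⟨m - 1 + 1, fun i => (s.erase m).count (i + 1 : ℕ)⟩, ?_⟩
      rw [partsOfMultiplicity, multisetOfMultiplicity_count, Nat.sub_add_cancel hm0,
        Multiset.cons_erase hm]
      intro a ha
      have ha' := Multiset.mem_of_mem_erase ha
      rw [Nat.sub_add_cancel hm0]
      exact ⟨hs ha', hmax a (Multiset.mem_toFinset.2 ha')⟩

/-- The summand of the rank generating function. -/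
noncomputable def rankMonomial (z q : ℂ) (P : Σ n, Nat.Partition n) : ℂ := z ^ rank P.2 * q ^ P.1

lemma rankMonomial_zero (z q : ℂ) (f : Fin 0 → ℕ) :
    rankMonomial z q (partitionOfMultiplicity ⟨0, f⟩) = 1 := by
  simp [rankMonomial, partitionOfMultiplicity, rank, partsOfMultiplicity]

/-- The compulsory largest part L + 1 has weight z^L q^(L+1), and each further part i + 1 has weight
q^(i+1)/z since it only raises the number of parts. -/
lemma rankMonomial_succ {z : ℂ} (hz : z ≠ 0) (q : ℂ) (L : ℕ) (f : Fin (L + 1) → ℕ) :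
    rankMonomial z q (partitionOfMultiplicity ⟨L + 1, f⟩) =
      z ^ L * q ^ (L + 1) * ∏ i : Fin (L + 1), (q ^ (i : ℕ) * (q / z)) ^ f i := by
  have h1 : rank (partitionOfMultiplicity ⟨L + 1, f⟩).2 = (L : ℤ) - ∑ i, (f i : ℤ) := by
    rw [rank]
    rw [show (partitionOfMultiplicity ⟨L + 1, f⟩).2.parts = partsOfMultiplicity ⟨L + 1, f⟩ from rfl,
      sup_partsOfMultiplicity]
    simp [partsOfMultiplicity, multisetOfMultiplicity]
  have h2 : (partitionOfMultiplicity ⟨L + 1, f⟩).1 = L + 1 + ∑ i : Fin (L + 1), f i * (i + 1) := by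
    simp [partitionOfMultiplicity, partsOfMultiplicity, multisetOfMultiplicity,
      Multiset.sum_sum]
  rw [rankMonomial, h1, h2, zpow_sub₀ hz, pow_add, zpow_natCast]
  have h3 : ∏ i : Fin (L + 1), (q ^ (i : ℕ) * (q / z)) ^ f i =
      q ^ (∑ i : Fin (L + 1), f i * (i + 1)) / z ^ (∑ i, (f i : ℤ)) := by
    rw [← Nat.cast_sum, zpow_natCast, ← prod_pow_eq_pow_sum, ← prod_pow_eq_pow_sum,
      ← prod_div_distrib]
    refine prod_congr rfl fun i _ => ?_
    rw [← mul_div_assoc, ← pow_succ, div_pow, ← pow_mul, mul_comm (f i)]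
  rw [h3]
  ring


/-- The generating function of partitions by rank, as a sum over the largest part. -/
lemma hasSum_rankMonomial {z q : ℂ} (hz : ‖z‖ = 1) (hq : ‖q‖ < 1) :
    Summable (fun P => ‖rankMonomial z q P‖) ∧
      HasSum (rankMonomial z q)
        (1 + ∑' L : ℕ, z ^ L * q ^ (L + 1) / qPoch (q / z) q (L + 1)) := by
  have hz0 : z ≠ 0 := by rw [← norm_ne_zero_iff, hz]; exact one_ne_zero
  have hqz : ‖q / z‖ < 1 := by rwa [norm_div, hz, div_one]
  have hlt : ∀ i : ℕ, ‖q ^ i * (q / z)‖ < 1 := fun i => by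
    rw [norm_mul, norm_pow]
    exact (mul_le_of_le_one_left (norm_nonneg _) (pow_le_one₀ (norm_nonneg _) hq.le)).trans_lt hqz
  set e := Equiv.ofBijective _ bijective_partitionOfMultiplicity with he
  have hfib : ∀ L : ℕ, Summable (fun f : Fin (L + 1) → ℕ =>
        ‖rankMonomial z q (partitionOfMultiplicity ⟨L + 1, f⟩)‖) ∧
      HasSum (fun f : Fin (L + 1) → ℕ => rankMonomial z q (partitionOfMultiplicity ⟨L + 1, f⟩))
        (z ^ L * q ^ (L + 1) / qPoch (q / z) q (L + 1)) := by
    intro L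
    obtain ⟨h1, h2⟩ := hasSum_prod_pow (L + 1) (fun i => q ^ (i : ℕ) * (q / z)) fun i => hlt i
    simp_rw [rankMonomial_succ hz0]
    constructor
    · simp_rw [norm_mul (z ^ L * q ^ (L + 1))]
      exact h1.mul_left _
    · rw [div_eq_mul_inv (z ^ L * q ^ (L + 1)), qPoch,
        ← Fin.prod_univ_eq_prod_range (fun i => 1 - q ^ i * (q / z))]
      exact h2.mul_left _
  have hr0 := norm_nonneg q
  -- As ‖z‖ = 1, the sum of norms over one value of L is ‖q‖^(L+1) divided by (‖q‖;‖q‖)_(L+1), and C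
  -- bounds these reciprocals uniformly in L.
  obtain ⟨C, hC0, hC⟩ := exists_norm_inv_qPoch_le (x := (‖q‖ : ℂ)) (q := (‖q‖ : ℂ)) (by simpa)
    (one_sub_pow_mul_ne_zero (by simpa) (by simpa))
  have htsum : ∀ L : ℕ, ∑' f : Fin (L + 1) → ℕ,
      ‖rankMonomial z q (partitionOfMultiplicity ⟨L + 1, f⟩)‖ ≤ ‖q‖ ^ (L + 1) * C := by
    intro L
    have h2 := (hasSum_prod_pow (L + 1) (fun i => ‖q‖ ^ (i : ℕ) * ‖q‖) fun i => by
      have := hlt i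
      simpa [hz] using this).2
    simp_rw [rankMonomial_succ hz0, norm_mul, norm_prod, norm_pow, norm_mul, norm_div, norm_pow, hz,
      one_pow, one_mul, div_one]
    rw [tsum_mul_left, h2.tsum_eq]
    refine mul_le_mul_of_nonneg_left ?_ (by positivity)
    refine le_trans (le_abs_self _) ?_
    have h3 := hC (L + 1)
    rw [qPoch, ← Fin.prod_univ_eq_prod_range (fun i => 1 - (‖q‖ : ℂ) ^ i * (‖q‖ : ℂ))] at h3
    rw [← Real.norm_eq_abs, ← Complex.norm_real]
    push_cast
    exact h3
  have hsumm : Summable (fun x => ‖rankMonomial z q (partitionOfMultiplicity x)‖) := by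
    rw [summable_sigma_of_nonneg fun _ => norm_nonneg _]
    constructor
    · rintro (_ | L)
      · exact Summable.of_finite
      · exact (hfib L).1
    · rw [← summable_nat_add_iff 1]
      exact Summable.of_nonneg_of_le (fun L => tsum_nonneg fun _ => norm_nonneg _) htsum
        (((summable_nat_add_iff 1).2 (summable_geometric_of_lt_one hr0 hq)).mul_right C)
  have hsum : HasSum (fun x => rankMonomial z q (partitionOfMultiplicity x))
      (1 + ∑' L : ℕ, z ^ L * q ^ (L + 1) / qPoch (q / z) q (L + 1)) := by
    have h1 := hsumm.of_norm
    have h2 := h1.sigma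
    have h3 : ∑' x, rankMonomial z q (partitionOfMultiplicity x) =
        1 + ∑' L : ℕ, z ^ L * q ^ (L + 1) / qPoch (q / z) q (L + 1) := by
      rw [h1.tsum_sigma, h2.tsum_eq_zero_add]
      congr 1
      · rw [tsum_congr fun f => rankMonomial_zero z q f]
        simp
      · exact tsum_congr fun L => (hfib L).2.tsum_eq
    rw [← h3]
    exact h1.hasSum
  exact ⟨(Equiv.summable_iff (f := fun P => ‖rankMonomial z q P‖) e).1 hsumm,
    (Equiv.hasSum_iff (f := rankMonomial z q) e).1 hsum⟩

/-- The generating function of partitions by rank in Eulerian form. -/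
lemma tsum_rankMonomial {z q : ℂ} (hz : ‖z‖ = 1) (hz1 : z ≠ 1) (hq0 : q ≠ 0) (hq : ‖q‖ < 1) :
    ∑' P, rankMonomial z q P = (1 - z) * (lam z (q ^ 2) q / qPochInf q q) := by
  have hz0 : z ≠ 0 := by rw [← norm_ne_zero_iff, hz]; exact one_ne_zero
  have hz1' : 1 - z ≠ 0 := sub_ne_zero.2 hz1.symm
  have hgen : ∀ k : ℤ, 1 - z * q ^ k ≠ 0 := by
    intro k h
    have h1 : ‖z * q ^ k‖ = 1 := by rw [← sub_eq_zero.1 h, norm_one]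
    rw [norm_mul, hz, one_mul, norm_zpow,
      zpow_eq_one_iff_right₀ (norm_nonneg _) hq.ne] at h1
    rw [h1] at h
    simp [hz1'] at h
  have hlt : ∀ y : ℂ, ‖y‖ = 1 → ‖q * y‖ < 1 := fun y hy => by rwa [norm_mul, hy, mul_one]
  have hqz : ‖q / z‖ < 1 := by rwa [norm_div, hz, div_one]
  have hqz' := one_sub_pow_mul_ne_zero hq hqz
  have hb : ∀ i : ℕ, 1 - q ^ i * (q * (q / z)) ≠ 0 := fun i => by
    rw [← mul_assoc, ← pow_succ]; exact hqz' _
  have hne : 1 - q / z ≠ 0 := one_sub_ne_zero_of_norm_lt hqz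
  have hbt : q * (q / z) * (z * q) = q ^ 3 := by field_simp
  -- Fine's transformation with b = q²/z and t = zq, so that b t = q³. Together with the prefactor
  -- q, the powers q^(3n) and q^(n(n-1)) combine to q^((n+1)²).
  have hF := tsum_pow_div_qPoch (b := q * (q / z)) (t := z * q) hq (by rwa [norm_mul, hz, one_mul])
    (by rw [hbt]; exact norm_pow_lt_one hq (by norm_num)) hb
  rw [(hasSum_rankMonomial hz hq).2.tsum_eq, ← tsum_eulerian_eq_lam hz0 hq0 hq hgen]
  have e1 : ∑' L : ℕ, z ^ L * q ^ (L + 1) / qPoch (q / z) q (L + 1) =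
      q / (1 - q / z) * ∑' n : ℕ, (z * q) ^ n / qPoch (q * (q / z)) q n := by
    rw [← tsum_mul_left]
    refine tsum_congr fun n => ?_
    rw [qPoch_succ', div_mul_div_comm]
    ring
  have hd : ∀ n, (1 - z) * (q ^ (n ^ 2) / (qPoch z q (n + 1) * qPoch (q / z) q n)) =
      q ^ (n ^ 2) / (qPoch (q * z) q n * qPoch (q / z) q n) := by
    intro n
    rw [qPoch_succ', mul_assoc, ← mul_div_assoc, mul_div_mul_left _ _ hz1']
  obtain ⟨C, hC0, hC⟩ := exists_norm_inv_qPoch_le hq hqz'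
  obtain ⟨C', hC'0, hC'⟩ := exists_norm_inv_qPoch_le hq
    (one_sub_pow_mul_ne_zero hq (hlt z hz))
  have hs : Summable fun n : ℕ => q ^ (n ^ 2) / (qPoch (q * z) q n * qPoch (q / z) q n) := by
    refine Summable.of_norm_bounded
      ((summable_geometric_of_lt_one (norm_nonneg _) hq).mul_right (C' * C)) fun n => ?_
    rw [div_eq_mul_inv, norm_mul, mul_inv, norm_mul, norm_pow]
    refine mul_le_mul (pow_le_pow_of_le_one (norm_nonneg _) hq.le (by nlinarith))
      (mul_le_mul (hC' _) (hC _) (norm_nonneg _) hC'0.le) (by positivity) (by positivity)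
  rw [← tsum_mul_left, tsum_congr hd, hs.tsum_eq_zero_add, e1, hF, ← tsum_mul_left]
  congr 1
  · simp [qPoch_zero]
  · refine tsum_congr fun n => ?_
    have h2 := qPoch_ne_zero hqz' (n + 1)
    rw [qPoch_succ' (q / z)] at h2 ⊢
    rw [hbt, mul_comm z q, div_mul_div_comm]
    have e3 : q * ((q ^ 3) ^ n * q ^ (n * (n - 1))) = q ^ ((n + 1) ^ 2) := by
      rw [← pow_mul, ← pow_add, ← pow_succ']
      congr 1
      cases n with
      | zero => rfl
      | succ n => simp only [Nat.add_sub_cancel]; ring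
    rw [e3]
    congr 1
    ring

/-! ### Fifth roots of unity and the deviations -/

/-- Reflection k ↦ -k. The case i = j = 4 forces that series to vanish; the missing summand k = 0 is
harmless, being 0 on both sides. -/
lemma lamFive_one_reflect {q : ℂ} (hq0 : q ≠ 0) (hq : ‖q‖ < 1) {i j : ℕ} (hij : i + j = 8) :
    lamFive 1 (q ^ i) q = -lamFive 1 (q ^ j) q := by
  rw [lamFive, ← (Equiv.neg ℤ).tsum_eq, lamFive, ← tsum_neg]
  refine tsum_congr fun k => ?_
  simp only [Equiv.neg_apply, one_mul]
  rcases eq_or_ne k 0 with rfl | hk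
  · simp
  have h1 : 1 - (q ^ 5) ^ k ≠ 0 := by
    rw [sub_ne_zero]
    exact (zpow_ne_one_of_norm_lt_one (norm_pow_lt_one hq (by norm_num)) hk).symm
  have h5 : (q ^ 5) ^ k ≠ 0 := zpow_ne_zero _ (pow_ne_zero _ hq0)
  have h2 : (1 - (q ^ 5) ^ (-k))⁻¹ = -(q ^ 5) ^ k * (1 - (q ^ 5) ^ k)⁻¹ := by
    rw [zpow_neg]
    have h3 : (q ^ 5) ^ k - 1 ≠ 0 := by rw [← neg_sub]; exact neg_ne_zero.2 h1
    have h4 : 1 - ((q ^ 5) ^ k)⁻¹ = ((q ^ 5) ^ k - 1) / (q ^ 5) ^ k := by field_simp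
    rw [h4, inv_div, ← neg_sub ((q ^ 5) ^ k), inv_neg]
    field_simp
  have h3 : (-1 : ℂ) ^ (-k) = (-1) ^ k := by
    rw [zpow_neg, ← inv_zpow]; norm_num
  have h6 : q ^ (3 * tri (-k)) * (q ^ i) ^ (-k) * (q ^ 5) ^ k = q ^ (3 * tri k) * (q ^ j) ^ k := by
    rw [← zpow_natCast q i, ← zpow_natCast q j, ← zpow_natCast q 5, ← zpow_mul, ← zpow_mul,
      ← zpow_mul, ← zpow_add₀ hq0, ← zpow_add₀ hq0, ← zpow_add₀ hq0, tri_neg]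
    congr 1
    have : (i : ℤ) = 8 - j := by omega
    rw [this]; push_cast; ring
  rw [h2, h3]
  linear_combination (-(-1) ^ k * (1 - (q ^ 5) ^ k)⁻¹) * h6

/-- Since z⁵ = 1, for k ≠ 0 one has 1/(1 - z q^k) = ∑ z^i q^(ik) / (1 - q^(5k)) over i < 5. The five
series obtained have y = q², …, q⁶, and reflection identifies them up to sign. -/
lemma lam_root_of_unity {z q : ℂ} (hz : z ^ 5 = 1) (hz1 : z ≠ 1) (hq0 : q ≠ 0) (hq : ‖q‖ < 1) :
    (1 - z) * lam z (q ^ 2) q = 1 - (2 - z - z ^ 4) * lamFive 1 (q ^ 6) q +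
      (z - z ^ 2 - z ^ 3 + z ^ 4) * lamFive 1 (q ^ 3) q := by
  have hz1' : 1 - z ≠ 0 := sub_ne_zero.2 hz1.symm
  have hz0 : z ≠ 0 := by rintro rfl; norm_num at hz
  have hnz : ‖z‖ = 1 := by
    have : ‖z‖ ^ 5 = 1 := by rw [← norm_pow, hz, norm_one]
    exact (pow_eq_one_iff_of_nonneg (norm_nonneg _) (by norm_num)).1 this
  have hS := fun i : ℕ => summable_lamFive hq0 hq one_ne_zero (y := q ^ (2 + i))
    (pow_ne_zero _ hq0)
  have h1 : lam z (q ^ 2) q = (1 - z)⁻¹ + ∑ i ∈ range 5, z ^ i * lamFive 1 (q ^ (2 + i)) q := by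
    -- The summand k = 0 is recorded separately: on the left it is (1 - z)⁻¹, while in each `lamFive
    -- 1` it is the default 0.
    have e : ∀ k : ℤ, (-1) ^ k * q ^ (3 * tri k) * (q ^ 2) ^ k * (1 - z * q ^ k)⁻¹ =
        (if k = 0 then (1 - z)⁻¹ else 0) + ∑ i ∈ range 5, z ^ i *
          ((-1) ^ k * q ^ (3 * tri k) * (q ^ (2 + i)) ^ k * (1 - 1 * (q ^ 5) ^ k)⁻¹) := by
      intro k
      rcases eq_or_ne k 0 with rfl | hk
      · simp
      have h2 : 1 - (q ^ 5) ^ k ≠ 0 := by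
        rw [sub_ne_zero]
        exact (zpow_ne_one_of_norm_lt_one (norm_pow_lt_one hq (by norm_num)) hk).symm
      have h3 : (q ^ 5) ^ k = (q ^ k) ^ 5 := by
        rw [← zpow_natCast q 5, zpow_comm]; norm_cast
      have h4 : (1 - z * q ^ k) * ∑ i ∈ range 5, (z * q ^ k) ^ i = 1 - (q ^ 5) ^ k := by
        rw [mul_neg_geom_sum, mul_pow, hz, h3, one_mul]
      have h5 : 1 - z * q ^ k ≠ 0 := by
        intro h; rw [h, zero_mul] at h4; exact h2 h4.symm
      have h6 : (1 - z * q ^ k)⁻¹ = (∑ i ∈ range 5, (z * q ^ k) ^ i) * (1 - (q ^ 5) ^ k)⁻¹ := by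
        rw [← h4] at h2 ⊢
        have := right_ne_zero_of_mul h2
        field_simp
      rw [if_neg hk, zero_add, h6, sum_mul, mul_sum]
      refine sum_congr rfl fun i _ => ?_
      rw [pow_add q 2 i, mul_zpow, mul_pow, one_mul]
      have h7 : (q ^ i) ^ k = (q ^ k) ^ i := by
        rw [← zpow_natCast q i, zpow_comm]; norm_cast
      rw [h7]; ring
    have hs2 : Summable fun k : ℤ => if k = 0 then (1 - z)⁻¹ else (0 : ℂ) :=
      (hasSum_ite_eq 0 _).summable
    rw [lam, tsum_congr e, hs2.tsum_add (summable_sum fun i _ => (hS i).mul_left (z ^ i)),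
      tsum_ite_eq, Summable.tsum_finsetSum fun i _ => (hS i).mul_left (z ^ i)]
    congr 1
    exact sum_congr rfl fun i _ => tsum_mul_left
  have r0 := lamFive_one_reflect hq0 hq (i := 2) (j := 6) rfl
  have r1 := lamFive_one_reflect hq0 hq (i := 5) (j := 3) rfl
  have r2 := lamFive_one_reflect hq0 hq (i := 4) (j := 4) rfl
  have r2' : lamFive 1 (q ^ 4) q = 0 := by linear_combination (1 / 2) * r2
  simp only [sum_range_succ, sum_range_zero] at h1
  norm_num only at h1
  rw [r0, r1, r2'] at h1
  rw [h1, mul_add, mul_inv_cancel₀ hz1']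
  linear_combination (-lamFive 1 (q ^ 6) q) * hz

lemma hasSum_rank {z q : ℂ} (hz : z ^ 5 = 1) (hz1 : z ≠ 1) (hq0 : q ≠ 0) (hq : ‖q‖ < 1) :
    HasSum (fun n : ℕ => ∑ P : Nat.Partition n, z ^ rank P * q ^ n)
      ((1 - (2 - z - z ^ 4) * lamFive 1 (q ^ 6) q +
        (z - z ^ 2 - z ^ 3 + z ^ 4) * lamFive 1 (q ^ 3) q) / qPochInf q q) := by
  have hnz : ‖z‖ = 1 := by
    have : ‖z‖ ^ 5 = 1 := by rw [← norm_pow, hz, norm_one]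
    exact (pow_eq_one_iff_of_nonneg (norm_nonneg _) (by norm_num)).1 this
  have h1 := (hasSum_rankMonomial hnz hq).1.of_norm.hasSum
  rw [tsum_rankMonomial hnz hz1 hq0 hq, ← mul_div_assoc, lam_root_of_unity hz hz1 hq0 hq] at h1
  exact h1.sigma fun n => hasSum_fintype _

/-- Orthogonality of the characters modulo 5; the trivial character j = 0 is exactly the subtracted
p(n)/5. -/
lemma rankCount_sub_eq {ζ : ℂ} (hζ : IsPrimitiveRoot ζ 5) (a : ℤ) (n : ℕ) :
    (rankCount a 5 n : ℂ) - (numPartitions n : ℂ) / 5 =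
      1 / 5 * ∑ j ∈ Icc 1 4, (ζ ^ j) ^ (-a) * ∑ P : Nat.Partition n, (ζ ^ j) ^ rank P := by
  have hζ0 : ζ ≠ 0 := hζ.ne_zero (by norm_num)
  have h1 : ∀ P : Nat.Partition n, ∑ j ∈ Icc 1 4, (ζ ^ j) ^ (-a) * (ζ ^ j) ^ rank P =
      5 * (if rank P ≡ a [ZMOD ((5 : ℕ) : ℤ)] then 1 else 0) - 1 := by
    intro P
    have h2 : ∀ j ∈ Icc 1 4, (ζ ^ j) ^ (-a) * (ζ ^ j) ^ rank P = (ζ ^ (rank P - a)) ^ j := by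
      intro j _
      rw [← zpow_add₀ (pow_ne_zero _ hζ0), ← zpow_natCast, ← zpow_natCast, zpow_comm,
        neg_add_eq_sub]
    have h3 : ζ ^ (rank P - a) = 1 ↔ rank P ≡ a [ZMOD ((5 : ℕ) : ℤ)] := by
      rw [hζ.zpow_eq_one_iff_dvd, Int.modEq_comm, Int.modEq_iff_dvd]
    have h4 : (ζ ^ (rank P - a)) ^ 5 = 1 := by
      rw [← zpow_natCast, zpow_comm, zpow_natCast, hζ.pow_eq_one, one_zpow]
    rw [sum_congr rfl h2]
    set w := ζ ^ (rank P - a)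
    have h5 : ∑ j ∈ Icc 1 4, w ^ j = w + w ^ 2 + w ^ 3 + w ^ 4 := by
      rw [show Icc 1 4 = {1, 2, 3, 4} from rfl]
      simp; ring
    rw [h5]
    split_ifs with h
    · rw [h3.2 h]; norm_num
    · have h6 : (w - 1) * (w + w ^ 2 + w ^ 3 + w ^ 4 + 1) = 0 := by linear_combination h4
      have h7 := (mul_eq_zero.1 h6).resolve_left (sub_ne_zero.2 fun h' => h (h3.1 h'))
      linear_combination h7
  simp_rw [mul_sum]
  rw [sum_comm]
  simp_rw [← mul_sum, h1]
  rw [sum_sub_distrib, ← mul_sum, sum_boole, sum_const, rankCount, numPartitions, card_univ]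
  simp
  ring

/-- The deviation of the rank modulo `5` in terms of two Lambert series. -/
lemma hasSum_deviationTerm {ζ q : ℂ} (hζ : IsPrimitiveRoot ζ 5) (a : ℤ) (hq0 : q ≠ 0)
    (hq : ‖q‖ < 1) :
    HasSum (deviationTerm a 5 q) (1 / 5 * ∑ j ∈ Icc 1 4, (ζ ^ j) ^ (-a) *
      ((1 - (2 - ζ ^ j - (ζ ^ j) ^ 4) * lamFive 1 (q ^ 6) q +
        (ζ ^ j - (ζ ^ j) ^ 2 - (ζ ^ j) ^ 3 + (ζ ^ j) ^ 4) * lamFive 1 (q ^ 3) q) /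
          qPochInf q q)) := by
  have h1 : ∀ j ∈ Icc 1 4, HasSum
      (fun n : ℕ => (ζ ^ j) ^ (-a) * ∑ P : Nat.Partition n, (ζ ^ j) ^ rank P * q ^ n)
      ((ζ ^ j) ^ (-a) *
      ((1 - (2 - ζ ^ j - (ζ ^ j) ^ 4) * lamFive 1 (q ^ 6) q +
        (ζ ^ j - (ζ ^ j) ^ 2 - (ζ ^ j) ^ 3 + (ζ ^ j) ^ 4) * lamFive 1 (q ^ 3) q) /
          qPochInf q q)) := by
    intro j hj
    rw [mem_Icc] at hj
    exact (hasSum_rank (by rw [← pow_mul, mul_comm, pow_mul, hζ.pow_eq_one, one_pow])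
      (hζ.pow_ne_one_of_pos_of_lt (by omega) (by omega)) hq0 hq).mul_left _
  have h2 := (hasSum_sum h1).mul_left (1 / 5)
  have h3 : deviationTerm a 5 q = fun n => 1 / 5 * ∑ j ∈ Icc 1 4,
      (ζ ^ j) ^ (-a) * ∑ P : Nat.Partition n, (ζ ^ j) ^ rank P * q ^ n := by
    funext n
    rw [deviationTerm, Nat.cast_ofNat, rankCount_sub_eq hζ]
    simp_rw [← sum_mul, ← mul_assoc]
    rw [← sum_mul, mul_assoc]
  rw [h3]
  exact h2

lemma sum_pow_root_of_unity {ζ : ℂ} (hζ : IsPrimitiveRoot ζ 5) (m : ℕ) :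
    ∑ j ∈ Icc 1 4, (ζ ^ j) ^ m = if 5 ∣ m then 4 else -1 := by
  have h2 : ∀ j ∈ Icc 1 4, (ζ ^ j) ^ m = (ζ ^ m) ^ j := fun j _ => by rw [← pow_mul, ← pow_mul']
  have h4 : (ζ ^ m) ^ 5 = 1 := by rw [← pow_mul, mul_comm, pow_mul, hζ.pow_eq_one, one_pow]
  rw [sum_congr rfl h2, show Icc 1 4 = {1, 2, 3, 4} from rfl]
  have h3 := hζ.pow_eq_one_iff_dvd m
  generalize ζ ^ m = w at *
  simp only [mem_insert, mem_singleton, not_false_eq_true, sum_insert, sum_singleton,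
    OfNat.one_ne_ofNat, Nat.reduceEqDiff, or_self]
  split_ifs with h
  · rw [h3.2 h]; norm_num
  · have h6 : (w - 1) * (w + w ^ 2 + w ^ 3 + w ^ 4 + 1) = 0 := by linear_combination h4
    have h7 := (mul_eq_zero.1 h6).resolve_left (sub_ne_zero.2 fun h' => h (h3.1 h'))
    linear_combination h7

/-- The residue is written as -m so that only natural powers of ζ occur; their sums over the
nontrivial characters are the values 4 and -1 of `s`. -/
lemma hasSum_deviationTerm_neg {q : ℂ} (m : ℕ) (hq0 : q ≠ 0) (hq : ‖q‖ < 1) {s : ℕ → ℂ}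
    (hs : s = fun m => if 5 ∣ m then 4 else -1) :
    HasSum (deviationTerm (-m) 5 q) (1 / 5 * ((s m -
      (2 * s m - s (m + 1) - s (m + 4)) * lamFive 1 (q ^ 6) q +
      (s (m + 1) - s (m + 2) - s (m + 3) + s (m + 4)) * lamFive 1 (q ^ 3) q) / qPochInf q q)) := by
  have hζ := Complex.isPrimitiveRoot_exp 5 (by norm_num)
  generalize Complex.exp (2 * Real.pi * Complex.I / (5 : ℕ)) = ζ at hζ
  have h := hasSum_deviationTerm hζ (-m) hq0 hq
  have hs' : ∀ m, s m = ∑ j ∈ Icc 1 4, (ζ ^ j) ^ m := fun m => by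
    rw [sum_pow_root_of_unity hζ, hs]
  convert h using 2
  simp_rw [hs', neg_neg, zpow_natCast, mul_sum, ← sum_sub_distrib, ← sum_add_distrib, sum_mul,
    ← sum_sub_distrib, ← sum_add_distrib, sum_div]
  refine sum_congr rfl fun j _ => ?_
  ring

lemma deviationTerm_congr {a b : ℤ} (h : a ≡ b [ZMOD 5]) (q : ℂ) :
    deviationTerm a 5 q = deviationTerm b 5 q := by
  funext n
  have : rankCount a 5 n = rankCount b 5 n := by
    rw [rankCount, rankCount]
    congr 1
    refine filter_congr fun P _ => ?_
    exact ⟨fun h' => h'.trans h, fun h' => h'.trans h.symm⟩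
  rw [deviationTerm, deviationTerm, this]

lemma summable_norm_deviationTerm (a : ℤ) {q : ℂ} (hq0 : q ≠ 0) (hq : ‖q‖ < 1) :
    Summable fun n => ‖deviationTerm a 5 q n‖ :=
  (hasSum_deviationTerm (Complex.isPrimitiveRoot_exp 5 (by norm_num)) a hq0 hq).summable.norm

lemma hasSum_deviationTerm_zero {q : ℂ} (hq0 : q ≠ 0) (hq : ‖q‖ < 1) :
    HasSum (deviationTerm 0 5 q) ((4 / 5 - 2 * lamFive 1 (q ^ 6) q) / qPochInf q q) := by
  have h := hasSum_deviationTerm_neg 0 hq0 hq rfl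
  norm_num at h
  convert h using 1
  ring

lemma hasSum_deviationTerm_one {q : ℂ} (hq0 : q ≠ 0) (hq : ‖q‖ < 1) :
    HasSum (deviationTerm 1 5 q)
      ((-(1 / 5) + lamFive 1 (q ^ 6) q + lamFive 1 (q ^ 3) q) / qPochInf q q) := by
  have h := hasSum_deviationTerm_neg 4 hq0 hq rfl
  rw [deviationTerm_congr (b := 1) (by decide)] at h
  norm_num at h
  convert h using 1
  ring

lemma hasSum_deviationTerm_four {q : ℂ} (hq0 : q ≠ 0) (hq : ‖q‖ < 1) :
    HasSum (deviationTerm 4 5 q)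
      ((-(1 / 5) + lamFive 1 (q ^ 6) q + lamFive 1 (q ^ 3) q) / qPochInf q q) := by
  have h := hasSum_deviationTerm_neg 1 hq0 hq rfl
  rw [deviationTerm_congr (b := 4) (by decide)] at h
  norm_num at h
  convert h using 1
  ring

lemma hasSum_deviationTerm_two {q : ℂ} (hq0 : q ≠ 0) (hq : ‖q‖ < 1) :
    HasSum (deviationTerm 2 5 q) ((-(1 / 5) - lamFive 1 (q ^ 3) q) / qPochInf q q) := by
  have h := hasSum_deviationTerm_neg 3 hq0 hq rfl
  rw [deviationTerm_congr (b := 2) (by decide)] at h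
  norm_num at h
  convert h using 1
  ring

lemma hasSum_deviationTerm_three {q : ℂ} (hq0 : q ≠ 0) (hq : ‖q‖ < 1) :
    HasSum (deviationTerm 3 5 q) ((-(1 / 5) - lamFive 1 (q ^ 3) q) / qPochInf q q) := by
  have h := hasSum_deviationTerm_neg 2 hq0 hq rfl
  rw [deviationTerm_congr (b := 3) (by decide)] at h
  norm_num at h
  convert h using 1
  ring

lemma deviation_zero_eq {q : ℂ} (hq0 : q ≠ 0) (hq : ‖q‖ < 1) :
    deviation 0 5 q = -2 * q ^ 5 * gMock (q ^ 5) (q ^ 25)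
      + 4 / 5 * (J₁ 5 q * J₁ 25 q ^ 3 / J₂ 5 25 q ^ 3)
      + 4 / 5 * q * (J₁ 25 q ^ 2 / J₂ 5 25 q)
      - 2 / 5 * q ^ 2 * (J₁ 25 q ^ 2 / J₂ 10 25 q)
      + 2 / 5 * q ^ 3 * (J₁ 5 q * J₁ 25 q ^ 3 / J₂ 10 25 q ^ 3) := by
  rw [deviation, (hasSum_deviationTerm_zero hq0 hq).tsum_eq, lamFive_one_six_eq_gMock hq0 hq,
    div_eq_iff (qPochInf_self_ne_zero hq)]
  ring

lemma deviation_four_eq {q : ℂ} (hq0 : q ≠ 0) (hq : ‖q‖ < 1) :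
    deviation 4 5 q = q ^ 5 * gMock (q ^ 5) (q ^ 25) - q ^ 8 * gMock (q ^ 10) (q ^ 25)
      - 1 / 5 * (J₁ 5 q * J₁ 25 q ^ 3 / J₂ 5 25 q ^ 3)
      - 1 / 5 * q * (J₁ 25 q ^ 2 / J₂ 5 25 q)
      + 3 / 5 * q ^ 2 * (J₁ 25 q ^ 2 / J₂ 10 25 q)
      - 3 / 5 * q ^ 3 * (J₁ 5 q * J₁ 25 q ^ 3 / J₂ 10 25 q ^ 3) := by
  rw [deviation, (hasSum_deviationTerm_four hq0 hq).tsum_eq, lamFive_one_six_eq_gMock hq0 hq,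
    lamFive_one_three_eq_gMock hq0 hq, div_eq_iff (qPochInf_self_ne_zero hq)]
  ring

lemma deviation_three_eq {q : ℂ} (hq0 : q ≠ 0) (hq : ‖q‖ < 1) :
    deviation 3 5 q = q ^ 8 * gMock (q ^ 10) (q ^ 25)
      - 1 / 5 * (J₁ 5 q * J₁ 25 q ^ 3 / J₂ 5 25 q ^ 3)
      - 1 / 5 * q * (J₁ 25 q ^ 2 / J₂ 5 25 q)
      - 2 / 5 * q ^ 2 * (J₁ 25 q ^ 2 / J₂ 10 25 q)
      + 2 / 5 * q ^ 3 * (J₁ 5 q * J₁ 25 q ^ 3 / J₂ 10 25 q ^ 3) := by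
  rw [deviation, (hasSum_deviationTerm_three hq0 hq).tsum_eq,
    lamFive_one_three_eq_gMock hq0 hq, div_eq_iff (qPochInf_self_ne_zero hq)]
  ring

lemma deviation_one_eq_four {q : ℂ} (hq0 : q ≠ 0) (hq : ‖q‖ < 1) :
    deviation 1 5 q = deviation 4 5 q :=
  (hasSum_deviationTerm_one hq0 hq).tsum_eq.trans (hasSum_deviationTerm_four hq0 hq).tsum_eq.symm

lemma deviation_two_eq_three {q : ℂ} (hq0 : q ≠ 0) (hq : ‖q‖ < 1) :
    deviation 2 5 q = deviation 3 5 q :=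
  (hasSum_deviationTerm_two hq0 hq).tsum_eq.trans (hasSum_deviationTerm_three hq0 hq).tsum_eq.symm

/-! ### Rank differences by residue class -/

lemma pow_mul_rankDiffTerm (a b : ℤ) (M c m : ℕ) (q : ℂ) (n : ℕ) :
    q ^ c * rankDiffTerm a b M c m (q ^ m) n =
      deviationTerm a M q (m * n + c) - deviationTerm b M q (m * n + c) := by
  rw [rankDiffTerm, deviationTerm, deviationTerm, pow_add, pow_mul]
  ring

lemma exists_pow_five_eq {q : ℂ} (hq0 : q ≠ 0) (hq : ‖q‖ < 1) :
    ∃ p : ℂ, p ≠ 0 ∧ ‖p‖ < 1 ∧ p ^ 5 = q := by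
  obtain ⟨p, hp⟩ := IsAlgClosed.exists_pow_nat_eq q (n := 5) (by norm_num)
  refine ⟨p, ?_, ?_, hp⟩
  · rintro rfl
    exact hq0 (by rw [← hp]; norm_num)
  · rw [← hp, norm_pow] at hq
    exact (pow_lt_one_iff_of_nonneg (norm_nonneg _) (by norm_num)).1 hq

/-- With p⁵ = q, the series is up to the factor p^c a subseries of the difference of two deviation
series at p. -/
lemma summable_norm_rankDiffTerm (a b : ℤ) (c : ℕ) {q : ℂ} (hq0 : q ≠ 0) (hq : ‖q‖ < 1) :
    Summable fun n => ‖rankDiffTerm a b 5 c 5 q n‖ := by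
  obtain ⟨p, hp0, hp, rfl⟩ := exists_pow_five_eq hq0 hq
  have hinj : Function.Injective fun n => 5 * n + c := fun m n h => by simp at h; omega
  have h := ((summable_norm_deviationTerm a hp0 hp).of_norm.sub
    (summable_norm_deviationTerm b hp0 hp).of_norm).comp_injective hinj
  refine ((h.mul_left (p ^ c)⁻¹).congr fun n => ?_).norm
  rw [Function.comp_apply, ← pow_mul_rankDiffTerm, inv_mul_cancel_left₀ (pow_ne_zero _ hp0)]

lemma deviation_sub_eq_sum_rankDiff (a b : ℤ) {p : ℂ} (hp0 : p ≠ 0) (hp : ‖p‖ < 1) :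
    deviation a 5 p - deviation b 5 p = ∑ c ∈ range 5, p ^ c * rankDiff a b 5 c 5 (p ^ 5) := by
  have ha := (summable_norm_deviationTerm a hp0 hp).of_norm
  have hb := (summable_norm_deviationTerm b hp0 hp).of_norm
  have h := ha.sub hb
  rw [deviation, deviation, ← ha.tsum_sub hb, Nat.sumByResidueClasses h 5]
  change ∑ j : Fin 5, ∑' m, (deviationTerm a 5 p ((j : ℕ) + 5 * m) -
    deviationTerm b 5 p ((j : ℕ) + 5 * m)) = _
  rw [Fin.sum_univ_eq_sum_range (fun j : ℕ => ∑' m, (deviationTerm a 5 p (j + 5 * m) -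
    deviationTerm b 5 p (j + 5 * m)))]
  refine sum_congr rfl fun c _ => ?_
  rw [rankDiff, ← tsum_mul_left]
  refine tsum_congr fun n => ?_
  rw [pow_mul_rankDiffTerm, add_comm]

/-- Two expansions in residue classes of exponents modulo `5` agree class by class. -/
lemma eq_of_sum_pow_mul_eq {p : ℂ} (hp0 : p ≠ 0) {u v : ℕ → ℂ}
    (h : ∀ t : ℂ, t ^ 5 = p ^ 5 → ∑ c ∈ range 5, t ^ c * u c = ∑ c ∈ range 5, t ^ c * v c)
    {c : ℕ} (hc : c < 5) : u c = v c := by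
  have hζ := Complex.isPrimitiveRoot_exp 5 (by norm_num)
  -- The identity at the five distinct points ζ^j p is a Vandermonde system for the differences u c
  -- - v c.
  generalize Complex.exp (2 * Real.pi * Complex.I / (5 : ℕ)) = ζ at hζ
  have h0 := Matrix.eq_zero_of_forall_index_sum_pow_mul_eq_zero
    (f := fun j : Fin 5 => ζ ^ (j : ℕ) * p) (v := fun c : Fin 5 => u c - v c) ?_ ?_
  · exact sub_eq_zero.1 (congrFun h0 ⟨c, hc⟩)
  · intro i j hij
    exact Fin.ext (hζ.pow_inj i.2 j.2 (mul_right_cancel₀ hp0 hij))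
  · intro j
    have h1 := h (ζ ^ (j : ℕ) * p) (by
      rw [mul_pow, ← pow_mul, mul_comm, pow_mul', hζ.pow_eq_one, one_pow, mul_one])
    rw [Fin.sum_univ_eq_sum_range (fun c => (ζ ^ (j : ℕ) * p) ^ c * (u c - v c))]
    simp_rw [mul_sub]
    rw [sum_sub_distrib, h1, sub_self]

lemma gMock_pow_five (q : ℂ) (a : ℕ) :
    gMock (q ^ (5 * a)) (q ^ 25) = gMock ((q ^ 5) ^ a) ((q ^ 5) ^ 5) := by
  rw [← pow_mul, ← pow_mul]

lemma J₁_pow_five (q : ℂ) (m : ℕ) : J₁ m (q ^ 5) = J₁ (5 * m) q := by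
  rw [J₁, J₁, J₂, J₂, zpow_natCast, zpow_natCast, ← pow_mul, ← pow_mul]
  ring_nf

lemma J₂_pow_five (q : ℂ) (a m : ℕ) : J₂ a m (q ^ 5) = J₂ ((5 * a : ℕ) : ℤ) (5 * m) q := by
  rw [J₂, J₂, zpow_natCast, zpow_natCast, ← pow_mul, ← pow_mul]

/-- Every g and theta constant in the formulas for D(0, 5) and D(2, 5) depends on q only through
q^5. Entry c of the list collects the terms with prefactor q^c modulo 5; classes 2 and 4 cancel or
are absent. -/
lemma rankDiff_zero_two {q : ℂ} (hq0 : q ≠ 0) (hq : ‖q‖ < 1) {c : ℕ} (hc : c < 5) :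
    rankDiff 0 2 5 c 5 q = ([J₁ 1 q * J₁ 5 q ^ 3 / J₂ 1 5 q ^ 3 - 2 * q * gMock q (q ^ 5),
      J₁ 5 q ^ 2 / J₂ 1 5 q, 0, -q * gMock (q ^ 2) (q ^ 5), 0] : List ℂ).getD c 0 := by
  obtain ⟨p, hp0, hp, rfl⟩ := exists_pow_five_eq hq0 hq
  refine eq_of_sum_pow_mul_eq hp0 (u := fun c => rankDiff 0 2 5 c 5 (p ^ 5))
    (v := fun c => List.getD _ c 0) (fun t ht => ?_) hc
  have ht0 : t ≠ 0 := by
    rintro rfl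
    exact hq0 (by rw [← ht]; norm_num)
  have ht1 : ‖t‖ < 1 := by
    rw [← ht, norm_pow] at hq
    exact (pow_lt_one_iff_of_nonneg (norm_nonneg _) (by norm_num)).1 hq
  rw [← ht, ← deviation_sub_eq_sum_rankDiff 0 2 ht0 ht1, deviation_two_eq_three ht0 ht1,
    deviation_zero_eq ht0 ht1, deviation_three_eq ht0 ht1]
  have e1 := gMock_pow_five t 1
  have e2 := gMock_pow_five t 2
  have e3 := J₁_pow_five t 1
  have e4 := J₁_pow_five t 5
  have e5 := J₂_pow_five t 1 5
  norm_num only [pow_one] at e1 e2 e3 e4 e5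
  simp [sum_range_succ, e1, e2, e3, e4, e5]
  ring

/-- The same comparison for D(1, 5) - D(2, 5), where the q-terms have equal coefficients and cancel,
so classes 1 and 4 are empty. -/
lemma rankDiff_one_two {q : ℂ} (hq0 : q ≠ 0) (hq : ‖q‖ < 1) {c : ℕ} (hc : c < 5) :
    rankDiff 1 2 5 c 5 q = ([q * gMock q (q ^ 5), 0, J₁ 5 q ^ 2 / J₂ 2 5 q,
      -2 * q * gMock (q ^ 2) (q ^ 5) - J₁ 1 q * J₁ 5 q ^ 3 / J₂ 2 5 q ^ 3, 0] :
        List ℂ).getD c 0 := by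
  obtain ⟨p, hp0, hp, rfl⟩ := exists_pow_five_eq hq0 hq
  refine eq_of_sum_pow_mul_eq hp0 (u := fun c => rankDiff 1 2 5 c 5 (p ^ 5))
    (v := fun c => List.getD _ c 0) (fun t ht => ?_) hc
  have ht0 : t ≠ 0 := by
    rintro rfl
    exact hq0 (by rw [← ht]; norm_num)
  have ht1 : ‖t‖ < 1 := by
    rw [← ht, norm_pow] at hq
    exact (pow_lt_one_iff_of_nonneg (norm_nonneg _) (by norm_num)).1 hq
  rw [← ht, ← deviation_sub_eq_sum_rankDiff 1 2 ht0 ht1, deviation_two_eq_three ht0 ht1,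
    deviation_one_eq_four ht0 ht1, deviation_four_eq ht0 ht1, deviation_three_eq ht0 ht1]
  have e1 := gMock_pow_five t 1
  have e2 := gMock_pow_five t 2
  have e3 := J₁_pow_five t 1
  have e4 := J₁_pow_five t 5
  have e6 := J₂_pow_five t 2 5
  norm_num only [pow_one] at e1 e2 e3 e4 e6
  simp [sum_range_succ, e1, e2, e3, e4, e6]
  ring

lemma rankDiff_sub (a b d : ℤ) (c : ℕ) {q : ℂ} (hq0 : q ≠ 0) (hq : ‖q‖ < 1) :
    rankDiff a d 5 c 5 q - rankDiff b d 5 c 5 q = rankDiff a b 5 c 5 q := by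
  rw [rankDiff, rankDiff, rankDiff,
    ← (summable_norm_rankDiffTerm a d c hq0 hq).of_norm.tsum_sub
      (summable_norm_rankDiffTerm b d c hq0 hq).of_norm]
  refine tsum_congr fun n => ?_
  simp only [rankDiffTerm]
  ring

/-! ### Uniqueness of coefficients and Dyson's conjectures -/

/-- A power series that vanishes on a punctured disc has zero coefficients. -/
lemma eq_zero_of_tsum_mul_pow_eq_zero {a : ℕ → ℂ} {r : ℝ} (hr : 0 < r)
    (hs : ∀ q : ℂ, q ≠ 0 → ‖q‖ < r → Summable fun n => ‖a n * q ^ n‖)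
    (h : ∀ q : ℂ, q ≠ 0 → ‖q‖ < r → ∑' n, a n * q ^ n = 0) (n : ℕ) : a n = 0 := by
  induction n using Nat.strong_induction_on with
  | _ k ih =>
  set ρ : ℂ := ((r / 2 : ℝ) : ℂ) with hρ
  have hρn : ‖ρ‖ = r / 2 := by rw [hρ, Complex.norm_real, Real.norm_of_nonneg (by positivity)]
  have hρ0 : ρ ≠ 0 := by rw [← norm_pos_iff, hρn]; positivity
  have hB := (summable_nat_add_iff (k + 1)).2 (hs ρ hρ0 (by rw [hρn]; linarith))
  set B := ∑' n, ‖a (n + (k + 1)) * ρ ^ (n + (k + 1))‖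
  -- With all lower coefficients zero, a k q^k equals minus the tail, which is O(‖q‖^(k+1)) by
  -- comparison with the absolutely convergent series at `ρ`. Small q then force a k = 0.
  have key : ∀ q : ℂ, q ≠ 0 → ‖q‖ < r / 2 → ‖a k‖ ≤ ‖q‖ * (B / ‖ρ‖ ^ (k + 1)) := by
    intro q hq0 hq
    have hqs := (hs q hq0 (by linarith)).of_norm
    have h1 := h q hq0 (by linarith)
    rw [← hqs.sum_add_tsum_nat_add (k + 1), sum_range_succ, sum_eq_zero, zero_add] at h1
    · have h2 : ‖∑' n, a (n + (k + 1)) * q ^ (n + (k + 1))‖ ≤ (‖q‖ / ‖ρ‖) ^ (k + 1) * B := by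
        refine tsum_of_norm_bounded (hB.hasSum.mul_left _) fun n => ?_
        rw [norm_mul, norm_mul, norm_pow, norm_pow, pow_add ‖q‖, pow_add ‖ρ‖, div_pow]
        have hρ1 : 0 < ‖ρ‖ := norm_pos_iff.2 hρ0
        have h3 : ‖q‖ ^ n ≤ ‖ρ‖ ^ n := pow_le_pow_left₀ (norm_nonneg _) (by rw [hρn]; linarith) n
        have h4 : ‖q‖ ^ (k + 1) / ‖ρ‖ ^ (k + 1) *
            (‖a (n + (k + 1))‖ * (‖ρ‖ ^ n * ‖ρ‖ ^ (k + 1))) =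
            ‖a (n + (k + 1))‖ * (‖ρ‖ ^ n * ‖q‖ ^ (k + 1)) := by
          field_simp
        rw [h4]
        gcongr
      have h5 : a k * q ^ k = -∑' n, a (n + (k + 1)) * q ^ (n + (k + 1)) :=
        eq_neg_of_add_eq_zero_left h1
      rw [← norm_neg, ← h5, norm_mul, norm_pow] at h2
      have hq1 : 0 < ‖q‖ ^ k := pow_pos (norm_pos_iff.2 hq0) _
      refine le_of_mul_le_mul_right (h2.trans_eq ?_) hq1
      rw [div_pow, pow_succ ‖q‖]
      ring
    · intro i hi
      rw [ih i (mem_range.1 hi), zero_mul]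
  by_contra hne
  have hpos : 0 < ‖a k‖ := norm_pos_iff.2 hne
  have hBn : 0 ≤ B / ‖ρ‖ ^ (k + 1) := div_nonneg (tsum_nonneg fun _ => norm_nonneg _) (by positivity)
  set D := B / ‖ρ‖ ^ (k + 1)
  set ε : ℝ := min (r / 4) (‖a k‖ / (2 * (D + 1))) with hε
  have hε0 : 0 < ε := by positivity
  have hεn : ‖(ε : ℂ)‖ = ε := by rw [Complex.norm_real, Real.norm_of_nonneg hε0.le]
  have h1 := key ε (by exact_mod_cast hε0.ne')
    (by rw [hεn]; exact (min_le_left _ _).trans_lt (by linarith))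
  rw [hεn] at h1
  have h2 : ε * D ≤ ‖a k‖ / (2 * (D + 1)) * D := mul_le_mul_of_nonneg_right (min_le_right _ _) hBn
  have h3 : ‖a k‖ / (2 * (D + 1)) * D < ‖a k‖ := by
    rw [div_mul_eq_mul_div, div_lt_iff₀ (by positivity)]
    nlinarith
  linarith

lemma rankCount_eq_of_rankDiff_eq_zero {a b : ℤ} {c : ℕ}
    (h : ∀ q : ℂ, q ≠ 0 → ‖q‖ < 1 → rankDiff a b 5 c 5 q = 0) (n : ℕ) :
    rankCount a 5 (5 * n + c) = rankCount b 5 (5 * n + c) := by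
  have := eq_zero_of_tsum_mul_pow_eq_zero one_pos
    (fun q hq0 hq => summable_norm_rankDiffTerm a b c hq0 hq) h n
  exact_mod_cast sub_eq_zero.1 this

end DysonRank

open DysonRank in
theorem mainTheorem3 :
    (∀ q : ℂ, 0 < ‖q‖ → ‖q‖ < 1 →
      -- absolute convergence of the series in the explicit formulas and rank differences
      (∀ a : ℤ, Summable (fun n : ℕ => ‖deviationTerm a 5 q n‖)) ∧
      (∀ (a b : ℤ) (c : ℕ), Summable (fun n : ℕ => ‖rankDiffTerm a b 5 c 5 q n‖)) ∧
      -- explicit formulas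
      deviation 0 5 q =
        -2 * q ^ 5 * gMock (q ^ 5) (q ^ 25)
          + 4 / 5 * (J₁ 5 q * J₁ 25 q ^ 3 / J₂ 5 25 q ^ 3)
          + 4 / 5 * q * (J₁ 25 q ^ 2 / J₂ 5 25 q)
          - 2 / 5 * q ^ 2 * (J₁ 25 q ^ 2 / J₂ 10 25 q)
          + 2 / 5 * q ^ 3 * (J₁ 5 q * J₁ 25 q ^ 3 / J₂ 10 25 q ^ 3) ∧
      deviation 1 5 q = deviation 4 5 q ∧
      deviation 4 5 q =
        q ^ 5 * gMock (q ^ 5) (q ^ 25) - q ^ 8 * gMock (q ^ 10) (q ^ 25)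
          - 1 / 5 * (J₁ 5 q * J₁ 25 q ^ 3 / J₂ 5 25 q ^ 3)
          - 1 / 5 * q * (J₁ 25 q ^ 2 / J₂ 5 25 q)
          + 3 / 5 * q ^ 2 * (J₁ 25 q ^ 2 / J₂ 10 25 q)
          - 3 / 5 * q ^ 3 * (J₁ 5 q * J₁ 25 q ^ 3 / J₂ 10 25 q ^ 3) ∧
      deviation 2 5 q = deviation 3 5 q ∧
      deviation 3 5 q =
        q ^ 8 * gMock (q ^ 10) (q ^ 25)
          - 1 / 5 * (J₁ 5 q * J₁ 25 q ^ 3 / J₂ 5 25 q ^ 3)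
          - 1 / 5 * q * (J₁ 25 q ^ 2 / J₂ 5 25 q)
          - 2 / 5 * q ^ 2 * (J₁ 25 q ^ 2 / J₂ 10 25 q)
          + 2 / 5 * q ^ 3 * (J₁ 5 q * J₁ 25 q ^ 3 / J₂ 10 25 q ^ 3) ∧
      -- rank differences modulo 5
      rankDiff 1 2 5 0 5 q = q * gMock q (q ^ 5) ∧
      rankDiff 0 2 5 0 5 q + 2 * rankDiff 1 2 5 0 5 q = J₁ 1 q * J₁ 5 q ^ 3 / J₂ 1 5 q ^ 3 ∧
      rankDiff 0 2 5 1 5 q = J₁ 5 q ^ 2 / J₂ 1 5 q ∧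
      rankDiff 1 2 5 2 5 q = J₁ 5 q ^ 2 / J₂ 2 5 q ∧
      rankDiff 0 2 5 3 5 q = -q * gMock (q ^ 2) (q ^ 5) ∧
      rankDiff 0 1 5 3 5 q + rankDiff 0 2 5 3 5 q = J₁ 1 q * J₁ 5 q ^ 3 / J₂ 2 5 q ^ 3) ∧
    -- Dyson's conjectures for modulus 5
    (∀ n : ℕ,
      rankCount 1 5 (5 * n + 1) = rankCount 2 5 (5 * n + 1) ∧
      rankCount 0 5 (5 * n + 2) = rankCount 2 5 (5 * n + 2) ∧
      rankCount 0 5 (5 * n + 4) = rankCount 1 5 (5 * n + 4) ∧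
      rankCount 1 5 (5 * n + 4) = rankCount 2 5 (5 * n + 4)) := by
  refine ⟨fun q hq0' hq => ?_, fun n => ?_⟩
  · have hq0 : q ≠ 0 := norm_pos_iff.1 hq0'
    have a0 := rankDiff_zero_two hq0 hq (c := 0) (by norm_num)
    have a1 := rankDiff_zero_two hq0 hq (c := 1) (by norm_num)
    have a3 := rankDiff_zero_two hq0 hq (c := 3) (by norm_num)
    have b0 := rankDiff_one_two hq0 hq (c := 0) (by norm_num)
    have b2 := rankDiff_one_two hq0 hq (c := 2) (by norm_num)
    have b3 := rankDiff_one_two hq0 hq (c := 3) (by norm_num)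
    -- R(0,1) = R(0,2) - R(1,2) reduces the last identity to the two tables.
    have d3 := rankDiff_sub 0 1 2 3 hq0 hq
    refine ⟨fun a => summable_norm_deviationTerm a hq0 hq,
      fun a b c => summable_norm_rankDiffTerm a b c hq0 hq, deviation_zero_eq hq0 hq,
      deviation_one_eq_four hq0 hq, deviation_four_eq hq0 hq, deviation_two_eq_three hq0 hq,
      deviation_three_eq hq0 hq, b0, ?_, a1, b2, a3, ?_⟩
    · rw [a0, b0]
      simp only [List.getD_cons_zero]
      ring
    · rw [← d3, a3, b3]
      simp only [List.getD_cons_zero, List.getD_cons_succ]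
      ring
  -- Each equality is a zero entry of the tables; for the ranks 0 and 1 in class 4 it is the
  -- difference of two zero entries.
  · refine ⟨rankCount_eq_of_rankDiff_eq_zero (fun q hq0 hq => ?_) n,
      rankCount_eq_of_rankDiff_eq_zero (fun q hq0 hq => ?_) n,
      rankCount_eq_of_rankDiff_eq_zero (fun q hq0 hq => ?_) n,
      rankCount_eq_of_rankDiff_eq_zero (fun q hq0 hq => ?_) n⟩
    · exact rankDiff_one_two hq0 hq (c := 1) (by norm_num)
    · exact rankDiff_zero_two hq0 hq (c := 2) (by norm_num)
    · rw [← rankDiff_sub 0 1 2 4 hq0 hq, rankDiff_zero_two hq0 hq (c := 4) (by norm_num),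
        rankDiff_one_two hq0 hq (c := 4) (by norm_num)]
      simp
    · exact rankDiff_one_two hq0 hq (c := 4) (by norm_num)
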